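/- **Setting.** Let $n\ge 0$, let $\epsilon_1,\dots,\epsilon_n$ be distinct real numbers and $s>0$. The phase space $\mathcal M$ of the classical Jaynes–Cummings–Gaudin model consists of the points $x=(b,\vec s_1,\dots,\vec s_n)$, $b\in\mathbb C$, $\vec s_j\in\mathbb R^3$, $|\vec s_j|=s$, with Poisson brackets $\{s_j^a,s_j^b\}=-\epsilon_{abc}s_j^c$, $\{b,\bar b\}=i$; write $s_j^\pm=s_j^1\pm i s_j^2$, $s_j^z=s_j^3$. Put $$H_j=2\epsilon_js_j^z+bs_j^++\bar bs_j^-+\sum_{k\ne j}\frac{\vec s_j\cdot\vec s_k}{\epsilon_j-\epsilon_k}\ (1\le j\le n),\qquad H_{n+1}=b\bar b+\sum_js_j^z,$$ let $F=(H_1,\dots,H_{n+1}):\mathcal M\to\mathbb R^{n+1}$ be the moment map, and let the flow of $H_i$ be $\partial_{t_i}f=\{H_i,f\}$. Put $$A(\lambda)=2\lambda+\sum_j\frac{s_j^z}{\lambda-\epsilon_j},\quad B(\lambda)=2b+\sum_j\frac{s_j^-}{\lambda-\epsilon_j},\quad C(\lambda)=2\bar b+\sum_j\frac{s_j^+}{\lambda-\epsilon_j},\quad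 L=\begin{pmatrix}A&B\\C&-A\end{pmatrix}.$$ For $h\in\mathbb R^{n+1}$ let $Q_h$ be the real polynomial of degree $2n+2$ with $$\frac{Q_h(\lambda)}{\prod_j(\lambda-\epsilon_j)^2}=4\lambda^2+4h_{n+1}+\sum_j\frac{2h_j}{\lambda-\epsilon_j}+\sum_j\frac{s^2}{(\lambda-\epsilon_j)^2},$$ and for $x\in\mathcal M$ write $Q_{2n+2}=Q_{F(x)}$; the spectral curve is $y^2=Q_{2n+2}(\lambda)$. When $b\ne0$, the separated variables $\lambda_1,\dots,\lambda_n\in\mathbb C$ are given by $C(\lambda)=2\bar b\prod_k(\lambda-\lambda_k)/\prod_j(\lambda-\epsilon_j)$. **Theorem.** 0. $\frac12\operatorname{Tr}L(\lambda)^2=Q_{2n+2}(\lambda)/\prod_j(\lambda-\epsilon_j)^2$ for every $x\in\mathcal M$ and $\lambda\in\mathbb C\setminus\{\epsilon_1,\dots,\epsilon_n\}$. 1. Let $x\in\mathcal M$ and suppose $Q_{2n+2}(\lambda)=(\lambda-E)^2\widetilde Q(\lambda)$ with $E\in\mathbb R$. Then: * (a) $E\ne\epsilon_j$ for all $j$,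 and $A(E)=B(E)=C(E)=0$. * (b) Along every integral curve of the flow of any $H_i$, $1\le i\le n+1$, through $x$ on an open interval, $A,B,C$ continue to vanish at $E$, and whenever $b\neq 0$ one of the separated variables equals $E$. If $b\ne0$ on the interval and $\lambda_1(t),\dots,\lambda_n(t)$ is a continuous labelling of pairwise distinct separated variables, then one fixed $\lambda_k(t)$ is constantly equal to $E$. * (c) Suppose $b\ne0$ and the separated variables at $x$ are pairwise distinct, labelled so that $\lambda_1=E$. For every $i=1,\dots,n$, take any integral curve of $H_i$ through $x$ and any labelling of the separated variables near $x$ along it that is continuous at $x$ and starts from the given one. Then the $\lambda_k$ are differentiable at $x$ along these flows, $\partial_{t_i}\lambda_1=0$, and for $k\ne1$ $$\partial_{t_i}\lambda_k=-i\,\frac{w_k}{\prod_{l\ne k,1}(\lambda_k-\lambda_l)}\,\frac{\prod_{l\ne k,1}(\epsilon_i-\lambda_l)}{\prod_{j\ne i}(\epsilon_i-\epsilon_j)}\,(\epsilon_i-E),$$ where $w_k$ is the square root of $\widetilde Q(\lambda_k)$ equal to $w_k=-\mathcal A(\lambda_k)/(\lambda_k-E)$, $\mathcal A$ being the polynomial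 $A(\lambda)\prod_j(\lambda-\epsilon_j)$. Consequently $\sum_{i=1}^n\frac1{\epsilon_i-E}\,\partial_{t_i}\lambda_k=0$ for all $k$. * (d) The rank of $F$ at $x$ is at most $n$. It is equal to $n$ if $\widetilde Q$ has no multiple root; more precisely it is equal to $n$ if and only if $\widetilde Q(E)\ne0$ and $E$ is the only common zero of $A,B,C$ in $\mathbb C\setminus\{\epsilon_1,\dots,\epsilon_n\}$. 2. Let the *stratum of rank $r$*, $\Sigma_r\subset\mathbb R^{n+1}$, be the set of values $h$ of $F$ for which the least rank of $F$ on the fibre $F^{-1}(h)$ is $r$. Let $\Sigma'_r$ be the image under $F$ of the set of points where $F$ has rank $r$. Below, $a,b$ are real polynomials, $a$ is monic of degree $n+1-r$ and $b$ has degree $2r$ (in particular $r\le n+1$). * (a) $h\in\Sigma_r$ if and only if $h\in F(\mathcal M)$ and $Q_h=a^2b$ for some such $a,b$ with $b$ squarefree. * (b) If $x\in\mathcal M$ and $Q_{2n+2}=a^2b$ for such $a,b$ with $b$ squarefree, then $F$ has rank $r$ at $x$ if and only if $a$ divides the three polynomials $A\prod_j(\lambda-\epsilon_j)$, $B\prod_j(\lambda-\epsilon_j)$,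 $C\prod_j(\lambda-\epsilon_j)$. * (c) $h\in\Sigma'_r$ if and only if $Q_h=a^2b$ for some such $a,b$ with $b$ without real roots. * (d) For every $0\le r\le n+1$, $\Sigma_r$ and $\Sigma'_r$ have (Hausdorff) dimension $r$. -/

import Mathlib

open Polynomial Matrix

namespace JCG

noncomputable section

/-- Ambient space of the model: the oscillator amplitude `b` and `n` spin vectors
`(s_j^1, s_j^2, s_j^3)`, where `s_j^3 = s_j^z`. Here `b = x.1` and `s_j^a = x.2 j a`. -/
abbrev Ambient (n : ℕ) : Type := ℂ × (Fin n → Fin 3 → ℝ)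

/-- Phase space: all spins have length `s`. -/
def phaseSpace (n : ℕ) (s : ℝ) : Set (Ambient n) :=
  {x | ∀ j, x.2 j ⬝ᵥ x.2 j = s ^ 2}

/-- Tangent space of phase space at `x`: the kernel of the differentials of the Casimirs. -/
def tangent {n : ℕ} (x : Ambient n) : Submodule ℝ (Ambient n) where
  carrier := {v | ∀ j, x.2 j ⬝ᵥ v.2 j = 0}
  add_mem' := by
    intro a b ha hb j
    simp [dotProduct_add, ha j, hb j]
  zero_mem' := by
    intro j
    simp
  smul_mem' := by
    intro c a ha j
    simp [dotProduct_smul, ha j]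

/-- `s_j^+`. -/
def sPlus {n : ℕ} (x : Ambient n) (j : Fin n) : ℂ := (x.2 j 0 : ℂ) + Complex.I * (x.2 j 1 : ℂ)

/-- `s_j^-`. -/
def sMinus {n : ℕ} (x : Ambient n) (j : Fin n) : ℂ := (x.2 j 0 : ℂ) - Complex.I * (x.2 j 1 : ℂ)

/-- `s_j^z`. -/
def sZ {n : ℕ} (x : Ambient n) (j : Fin n) : ℝ := x.2 j 2

/-- `H_j` for `j = 1, …, n`. -/
def spinHam {n : ℕ} (ε : Fin n → ℝ) (j : Fin n) (x : Ambient n) : ℝ :=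
  2 * ε j * sZ x j + (x.1 * sPlus x j + (starRingEnd ℂ) x.1 * sMinus x j).re
    + ∑ k ∈ Finset.univ.erase j, (x.2 j ⬝ᵥ x.2 k) / (ε j - ε k)

/-- `H_{n+1}`. -/
def totalHam {n : ℕ} (x : Ambient n) : ℝ := Complex.normSq x.1 + ∑ j, sZ x j

/-- The moment map `(H_1, …, H_n, H_{n+1})`. -/
def momentMap {n : ℕ} (ε : Fin n → ℝ) (x : Ambient n) : Fin (n + 1) → ℝ :=
  Fin.snoc (fun j => spinHam ε j x) (totalHam x)

/-- Rank at `x` of the moment map restricted to phase space. -/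
def momentRank {n : ℕ} (ε : Fin n → ℝ) (x : Ambient n) : ℕ :=
  Module.finrank ℝ
    ((tangent x).map (fderiv ℝ (momentMap ε) x : Ambient n →ₗ[ℝ] (Fin (n + 1) → ℝ)))

/-- Partial derivative in `s_j^a`, as a vector indexed by `a`. -/
def spinGrad {n : ℕ} (f : Ambient n → ℝ) (x : Ambient n) (j : Fin n) : Fin 3 → ℝ :=
  fun a => fderiv ℝ f x (0, Pi.single j (Pi.single a 1))

/-- The Poisson bracket determined by `{s_j^a, s_j^b} = - ε_{abc} s_j^c` and
`{b, conj b} = i`, that is `{Re b, Im b} = -1/2`. -/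
def poisson {n : ℕ} (f g : Ambient n → ℝ) (x : Ambient n) : ℝ :=
  -(1 / 2) * (fderiv ℝ f x (1, 0) * fderiv ℝ g x (Complex.I, 0)
      - fderiv ℝ f x (Complex.I, 0) * fderiv ℝ g x (1, 0))
    - ∑ j, x.2 j ⬝ᵥ (spinGrad f x j ⨯₃ spinGrad g x j)

/-- The Hamiltonian vector field of `H`: each coordinate `f` moves by `f' = {H, f}`. -/
def hamField {n : ℕ} (H : Ambient n → ℝ) (x : Ambient n) : Ambient n :=
  (⟨poisson H (fun y => y.1.re) x, poisson H (fun y => y.1.im) x⟩,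
    fun j a => poisson H (fun y => y.2 j a) x)

/-- Entries of the Lax matrix. -/
def laxA {n : ℕ} (ε : Fin n → ℝ) (x : Ambient n) (z : ℂ) : ℂ :=
  2 * z + ∑ j, (sZ x j : ℂ) / (z - ε j)

def laxB {n : ℕ} (ε : Fin n → ℝ) (x : Ambient n) (z : ℂ) : ℂ :=
  2 * x.1 + ∑ j, sMinus x j / (z - ε j)

def laxC {n : ℕ} (ε : Fin n → ℝ) (x : Ambient n) (z : ℂ) : ℂ :=
  2 * (starRingEnd ℂ) x.1 + ∑ j, sPlus x j / (z - ε j)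

/-- The Lax matrix `L(z)`. -/
def lax {n : ℕ} (ε : Fin n → ℝ) (x : Ambient n) (z : ℂ) : Matrix (Fin 2) (Fin 2) ℂ :=
  !![laxA ε x z, laxB ε x z; laxC ε x z, -laxA ε x z]

/-- `∏_j (X - ε_j)`. -/
def poleProd {n : ℕ} (ε : Fin n → ℝ) : ℝ[X] := ∏ j, (X - C (ε j))

/-- `∏_{i ≠ j} (X - ε_i)`. -/
def poleProdErase {n : ℕ} (ε : Fin n → ℝ) (j : Fin n) : ℝ[X] :=
  ∏ i ∈ Finset.univ.erase j, (X - C (ε i))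

/-- The polynomial `Q_{2n+2}` attached to the value `h` of the moment map:
`Q / ∏ (z - ε_j)² = 4 z² + 4 h_{n+1} + 2 ∑ h_j / (z - ε_j) + ∑ s² / (z - ε_j)²`. -/
def spectralPoly {n : ℕ} (ε : Fin n → ℝ) (s : ℝ) (h : Fin (n + 1) → ℝ) : ℝ[X] :=
  (C 4 * X ^ 2 + C (4 * h (Fin.last n))) * poleProd ε ^ 2
    + ∑ j : Fin n, C (2 * h j.castSucc) * (poleProd ε * poleProdErase ε j)
    + ∑ j : Fin n, C (s ^ 2) * poleProdErase ε j ^ 2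

/-- Numerators: `A(z) ∏ (z - ε_j)`, `B(z) ∏ (z - ε_j)`, `C(z) ∏ (z - ε_j)`. -/
def numA {n : ℕ} (ε : Fin n → ℝ) (x : Ambient n) : ℂ[X] :=
  C 2 * X * (poleProd ε).map (algebraMap ℝ ℂ)
    + ∑ j, C (sZ x j : ℂ) * (poleProdErase ε j).map (algebraMap ℝ ℂ)

def numB {n : ℕ} (ε : Fin n → ℝ) (x : Ambient n) : ℂ[X] :=
  C (2 * x.1) * (poleProd ε).map (algebraMap ℝ ℂ)
    + ∑ j, C (sMinus x j) * (poleProdErase ε j).map (algebraMap ℝ ℂ)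

def numC {n : ℕ} (ε : Fin n → ℝ) (x : Ambient n) : ℂ[X] :=
  C (2 * (starRingEnd ℂ) x.1) * (poleProd ε).map (algebraMap ℝ ℂ)
    + ∑ j, C (sPlus x j) * (poleProdErase ε j).map (algebraMap ℝ ℂ)

/-- `l` lists the separated variables at `x`:
`b ≠ 0` and `C(z) = 2 conj b ∏_k (z - l_k) / ∏_j (z - ε_j)`. -/
def IsSeparated {n : ℕ} (ε : Fin n → ℝ) (x : Ambient n) (l : Fin n → ℂ) : Prop :=
  x.1 ≠ 0 ∧ numC ε x = C (2 * (starRingEnd ℂ) x.1) * ∏ k, (X - C (l k))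

/-- The image under the moment map of the points of phase space where it has rank `r`. -/
def rankImage {n : ℕ} (ε : Fin n → ℝ) (s : ℝ) (r : ℕ) : Set (Fin (n + 1) → ℝ) :=
  momentMap ε '' {x | x ∈ phaseSpace n s ∧ momentRank ε x = r}

/-- The stratum of rank `r`: the values of the moment map for which `r` is the least rank
that the moment map takes on the fibre. -/
def stratum {n : ℕ} (ε : Fin n → ℝ) (s : ℝ) (r : ℕ) : Set (Fin (n + 1) → ℝ) :=
  {h | IsLeast (momentRank ε '' {x | x ∈ phaseSpace n s ∧ momentMap ε x = h}) r}

end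

end JCG

/-!
The idea is to replace the Lax matrix by the vector `L = (L₁, L₂, L₃)` of real polynomials
(`laxVec`) for which the numerators of `A, B, C` are `L₃`, `L₁ - i L₂`, `L₁ + i L₂`. Then
`Q = L₁² + L₂² + L₃²` (`spectralPoly_momentMap`), a sum of real squares. Hence a real root of `Q` is
a common zero of the `L_i`, and every square factor of `Q` reflects a common factor of the `L_i`.

*Rank.* Let `d` be the greatest common divisor of the `L_i`. Differentiating `Q = ∑ L_i²` along
phase space shows that the differential of the moment map takes its values in the multiples of
`d`, and the Bézout identity for the cofactors shows that all multiples occur, so that the rank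
is `n + 1 - deg d` (`IsLaxGCD.momentRank_add`).

*Flows.* Up to a pole factor, the Hamiltonian flows rotate the vector `L(E)`, so its length is
conserved and a real common zero persists (`laxVec_eval_eq_zero_of_flow`). The velocities of the
separated variables follow by differentiating `C(λ_k(t)) = 0` (`separated_flow`), and the relation
between them is the vanishing of a divided difference of a polynomial of degree at most `n - 2`.

*Fibres.* A real polynomial `b` of degree `2 r` and leading coefficient `4` without real roots is
`p² + q²` with `p, q` coprime (`exists_sq_add_sq`). Thus `Q = a² b` is the spectral polynomial of
the point with `L = (a q, 0, a p)`, which has rank `r`. With the divisibility `d ∣ a` for squarefree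
`b` this describes both kinds of strata (`mem_rankImage_iff`, `mem_stratum_iff`).

*Dimension from above.* On the set of values where `gcd (Q, Q')` has degree `e`, tangent directions
`v` are such that the denominator of the logarithmic derivative `Q' / Q` is kept to first order.
This makes `gcd (Q, Q')` divide the variation of `Q`, which leaves `n + 1 - e` dimensions
(`mem_dvdValues_of_mem_tangentCone`). A set whose tangent cones lie in `k`-dimensional subspaces
has dimension at most `k` (`dimH_le_of_tangentCone`).

*Dimension from below.* With all spins pointing down, `A` has real simple zeros, and its numerator
splits as `a p` with `deg a = n + 1 - r`. Near it one solves `Q = a² (p² + σ)` with `σ > 0`, where `σ`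
has prescribed values at the `r` zeros of the unperturbed `p`
(`exists_isOpen_subset_image_rankImage`).
-/

namespace JCG

variable {n : ℕ}

/-! ### Partial fractions over the poles -/

lemma X_sub_mul_poleProdErase (ε : Fin n → ℝ) (j : Fin n) :
    (X - C (ε j)) * poleProdErase ε j = poleProd ε :=
  Finset.mul_prod_erase Finset.univ (fun i => X - C (ε i)) (Finset.mem_univ j)

lemma poleProd_monic (ε : Fin n → ℝ) : (poleProd ε).Monic :=
  monic_prod_of_monic _ _ fun j _ => monic_X_sub_C (ε j)

lemma natDegree_poleProd (ε : Fin n → ℝ) : (poleProd ε).natDegree = n := by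
  simp [poleProd, natDegree_finsetProd_X_sub_C_eq_card]

lemma degree_poleProd (ε : Fin n → ℝ) : (poleProd ε).degree = n := by
  rw [degree_eq_natDegree (poleProd_monic ε).ne_zero, natDegree_poleProd]

lemma degree_poleProdErase_lt (ε : Fin n → ℝ) (j : Fin n) :
    (poleProdErase ε j).degree < n := by
  have hm : (poleProdErase ε j).Monic := monic_prod_of_monic _ _ fun i _ => monic_X_sub_C (ε i)
  have h := congrArg natDegree (X_sub_mul_poleProdErase ε j)
  rw [(monic_X_sub_C (ε j)).natDegree_mul hm, natDegree_poleProd, natDegree_X_sub_C] at h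
  rw [degree_eq_natDegree hm.ne_zero]
  exact_mod_cast (by omega : (poleProdErase ε j).natDegree < n)

lemma eval_poleProd_self (ε : Fin n → ℝ) (j : Fin n) : (poleProd ε).eval (ε j) = 0 := by
  rw [← X_sub_mul_poleProdErase ε j]
  simp

lemma eval_poleProd_ne_zero {ε : Fin n → ℝ} {t : ℝ} (ht : ∀ j, t ≠ ε j) :
    (poleProd ε).eval t ≠ 0 := by
  rw [poleProd, eval_prod]
  exact Finset.prod_ne_zero_iff.2 fun j _ => by simpa [sub_eq_zero] using ht j

lemma eval_poleProdErase_of_ne (ε : Fin n → ℝ) {j k : Fin n} (h : k ≠ j) :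
    (poleProdErase ε j).eval (ε k) = 0 := by
  rw [poleProdErase, eval_prod]
  exact Finset.prod_eq_zero (Finset.mem_erase.2 ⟨h, Finset.mem_univ k⟩) (by simp)

lemma eval_poleProdErase_self_ne_zero {ε : Fin n → ℝ} (hε : Function.Injective ε) (j : Fin n) :
    (poleProdErase ε j).eval (ε j) ≠ 0 := by
  rw [poleProdErase, eval_prod]
  refine Finset.prod_ne_zero_iff.2 fun i hi => ?_
  have : ε j ≠ ε i := fun h => Finset.ne_of_mem_erase hi (hε h).symm
  simpa [sub_eq_zero] using this

/-- A polynomial of degree at most `n`, written in partial fractions over `∏ (X - ε_j)`: the pair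
`(c, u)` stands for `(c + ∑ u_j / (X - ε_j)) ∏ (X - ε_j)`. -/
noncomputable def poleComb (ε : Fin n → ℝ) : ℝ × (Fin n → ℝ) →ₗ[ℝ] ℝ[X] where
  toFun p := C p.1 * poleProd ε + ∑ j, C (p.2 j) * poleProdErase ε j
  map_add' p q := by
    simp only [Prod.fst_add, Prod.snd_add, Pi.add_apply, map_add, add_mul, Finset.sum_add_distrib]
    ring
  map_smul' c p := by
    simp only [Prod.smul_fst, Prod.smul_snd, Pi.smul_apply, smul_eq_mul, map_mul, mul_assoc,
      ← Finset.mul_sum, RingHom.id_apply, smul_eq_C_mul]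
    ring

lemma poleComb_apply (ε : Fin n → ℝ) (c : ℝ) (u : Fin n → ℝ) :
    poleComb ε (c, u) = C c * poleProd ε + ∑ j, C (u j) * poleProdErase ε j := rfl

lemma eval_poleComb (ε : Fin n → ℝ) (c : ℝ) (u : Fin n → ℝ) (j : Fin n) :
    (poleComb ε (c, u)).eval (ε j) = u j * (poleProdErase ε j).eval (ε j) := by
  rw [poleComb_apply, eval_add, eval_mul, eval_poleProd_self, eval_finsetSum,
    Finset.sum_eq_single j]
  · simp
  · intro i _ hi
    simp [eval_poleProdErase_of_ne ε hi.symm]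
  · simp

lemma degree_sum_poleProdErase_lt (ε : Fin n → ℝ) (u : Fin n → ℝ) :
    (∑ j, C (u j) * poleProdErase ε j).degree < n := by
  rw [← mem_degreeLT]
  refine Submodule.sum_mem _ fun j _ => ?_
  rw [← smul_eq_C_mul]
  exact Submodule.smul_mem _ _ (mem_degreeLT.2 (degree_poleProdErase_lt ε j))

lemma degree_poleComb_lt (ε : Fin n → ℝ) (p : ℝ × (Fin n → ℝ)) :
    (poleComb ε p).degree < (n + 1 : ℕ) := by
  obtain ⟨c, u⟩ := p
  rw [poleComb_apply, ← mem_degreeLT]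
  refine Submodule.add_mem _ ?_ ?_
  · rw [← smul_eq_C_mul]
    refine Submodule.smul_mem _ _ (mem_degreeLT.2 ?_)
    rw [degree_poleProd]
    exact_mod_cast Nat.lt_succ_self n
  · refine mem_degreeLT.2 ((degree_sum_poleProdErase_lt ε u).trans ?_)
    exact_mod_cast Nat.lt_succ_self n

lemma coeff_poleComb (ε : Fin n → ℝ) (c : ℝ) (u : Fin n → ℝ) :
    (poleComb ε (c, u)).coeff n = c := by
  have h1 : (poleProd ε).coeff n = 1 := by
    have := (poleProd_monic ε).coeff_natDegree
    rwa [natDegree_poleProd] at this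
  rw [poleComb_apply, coeff_add, coeff_eq_zero_of_degree_lt (degree_sum_poleProdErase_lt ε u),
    coeff_C_mul, h1]
  ring

lemma degree_lt_of_coeff_eq_zero {f : ℝ[X]} {k : ℕ} (hf : f.degree < (k + 1 : ℕ))
    (h : f.coeff k = 0) : f.degree < k := by
  rw [degree_lt_iff_coeff_zero] at hf ⊢
  intro m hm
  rcases hm.eq_or_lt with rfl | hm
  · exact h
  · exact hf m hm

lemma eq_zero_of_eval_poles {ε : Fin n → ℝ} (hε : Function.Injective ε) {f : ℝ[X]}
    (hf : f.degree < n) (h : ∀ j, f.eval (ε j) = 0) : f = 0 :=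
  eq_zero_of_degree_lt_of_eval_index_eq_zero Finset.univ hε.injOn (by simpa using hf)
    fun j _ => h j

lemma poleComb_injective {ε : Fin n → ℝ} (hε : Function.Injective ε) :
    Function.Injective (poleComb ε) := by
  rw [← LinearMap.ker_eq_bot, LinearMap.ker_eq_bot']
  rintro ⟨c, u⟩ h
  have hc := coeff_poleComb ε c u
  rw [h, coeff_zero] at hc
  have hu : u = 0 := by
    funext j
    have := eval_poleComb ε c u j
    rw [h, eval_zero] at this
    simpa [eval_poleProdErase_self_ne_zero hε j] using this.symm
  rw [← hc, hu]; rfl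

lemma exists_poleComb_eq {ε : Fin n → ℝ} (hε : Function.Injective ε) {f : ℝ[X]}
    (hf : f.degree < (n + 1 : ℕ)) :
    poleComb ε (f.coeff n, fun j => f.eval (ε j) / (poleProdErase ε j).eval (ε j)) = f := by
  refine (sub_eq_zero.1 (eq_zero_of_eval_poles hε (degree_lt_of_coeff_eq_zero ?_ ?_) ?_)).symm
  · rw [← mem_degreeLT]
    exact Submodule.sub_mem _ (mem_degreeLT.2 hf) (mem_degreeLT.2 (degree_poleComb_lt ε _))
  · rw [coeff_sub, coeff_poleComb, sub_self]
  · intro j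
    rw [eval_sub, eval_poleComb, div_mul_cancel₀ _ (eval_poleProdErase_self_ne_zero hε j), sub_self]

lemma poleProd_dvd_of_eval {ε : Fin n → ℝ} (hε : Function.Injective ε) {f : ℝ[X]}
    (h : ∀ j, f.eval (ε j) = 0) : poleProd ε ∣ f := by
  rw [← modByMonic_eq_zero_iff_dvd (poleProd_monic ε)]
  refine eq_zero_of_eval_poles hε ?_ fun j => ?_
  · have := degree_modByMonic_lt f (poleProd_monic ε)
    rwa [degree_poleProd] at this
  · have := congrArg (eval (ε j)) (modByMonic_add_div f (poleProd ε))
    rw [eval_add, eval_mul, eval_poleProd_self, h j, zero_mul, add_zero] at this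
    exact this

/-- A polynomial without zeros at the poles is coprime to `∏ (X - ε_j)`. -/
lemma isCoprime_poleProd {ε : Fin n → ℝ} {f : ℝ[X]} (h : ∀ j, f.eval (ε j) ≠ 0) :
    IsCoprime f (poleProd ε) := by
  refine IsCoprime.prod_right fun j _ => IsCoprime.symm ?_
  refine (irreducible_X_sub_C (ε j)).coprime_iff_not_dvd.2 fun hd => h j ?_
  exact dvd_iff_isRoot.1 hd

/-! ### The Lax matrix as a vector of real polynomials -/

/-- The oscillator part of the Lax vector: `2 b = β₁ - i β₂`, `β₃ = 0`. -/
def oscVec (v : Ambient n) : Fin 3 → ℝ := ![2 * v.1.re, -2 * v.1.im, 0]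

/-- The part of the Lax vector which is linear in the point of phase space. -/
noncomputable def laxDir (ε : Fin n → ℝ) (v : Ambient n) (a : Fin 3) : ℝ[X] :=
  poleComb ε (oscVec v a, fun j => v.2 j a)

/-- The Lax vector `(2 λ ẑ + β + ∑ s_j / (λ - ε_j)) ∏ (λ - ε_j)`, with real polynomial entries
`(L₁, L₂, L₃)`. The numerators of `A, B, C` are `L₃, L₁ - i L₂, L₁ + i L₂`. -/
noncomputable def laxVec (ε : Fin n → ℝ) (x : Ambient n) (a : Fin 3) : ℝ[X] :=
  (![0, 0, C 2 * X * poleProd ε] : Fin 3 → ℝ[X]) a + laxDir ε x a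

lemma oscVec_add (v w : Ambient n) : oscVec (v + w) = oscVec v + oscVec w := by
  funext a; fin_cases a <;> simp [oscVec] <;> ring

lemma oscVec_smul (t : ℝ) (v : Ambient n) : oscVec (t • v) = t • oscVec v := by
  funext a; fin_cases a <;> simp [oscVec] <;> ring

lemma laxDir_add (ε : Fin n → ℝ) (v w : Ambient n) (a : Fin 3) :
    laxDir ε (v + w) a = laxDir ε v a + laxDir ε w a := by
  rw [laxDir, laxDir, laxDir, ← map_add, oscVec_add]; rfl

lemma laxDir_smul (ε : Fin n → ℝ) (t : ℝ) (v : Ambient n) (a : Fin 3) :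
    laxDir ε (t • v) a = C t * laxDir ε v a := by
  rw [laxDir, laxDir, ← smul_eq_C_mul, ← map_smul, oscVec_smul]; rfl

lemma laxVec_add (ε : Fin n → ℝ) (x v : Ambient n) (a : Fin 3) :
    laxVec ε (x + v) a = laxVec ε x a + laxDir ε v a := by
  rw [laxVec, laxVec, laxDir_add, add_assoc]

lemma laxVec_zero (ε : Fin n → ℝ) (x : Ambient n) : laxVec ε x 0 = laxDir ε x 0 := by
  simp [laxVec]

lemma laxVec_one (ε : Fin n → ℝ) (x : Ambient n) : laxVec ε x 1 = laxDir ε x 1 := by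
  simp [laxVec]

lemma laxVec_two (ε : Fin n → ℝ) (x : Ambient n) :
    laxVec ε x 2 = C 2 * X * poleProd ε + laxDir ε x 2 := by
  simp [laxVec]

lemma eval_laxVec_pole (ε : Fin n → ℝ) (x : Ambient n) (a : Fin 3) (j : Fin n) :
    (laxVec ε x a).eval (ε j) = x.2 j a * (poleProdErase ε j).eval (ε j) := by
  have : eval (ε j) ((![0, 0, C 2 * X * poleProd ε] : Fin 3 → ℝ[X]) a) = 0 := by
    fin_cases a <;> simp [eval_poleProd_self]
  rw [laxVec, eval_add, this, laxDir, eval_poleComb, zero_add]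

lemma degree_laxDir_lt (ε : Fin n → ℝ) (v : Ambient n) (a : Fin 3) :
    (laxDir ε v a).degree < (n + 1 : ℕ) := degree_poleComb_lt ε _

lemma degree_laxDir_two_lt (ε : Fin n → ℝ) (v : Ambient n) : (laxDir ε v 2).degree < n :=
  degree_lt_of_coeff_eq_zero (degree_laxDir_lt ε v 2) (by rw [laxDir, coeff_poleComb]; rfl)

lemma numA_eq (ε : Fin n → ℝ) (x : Ambient n) :
    numA ε x = (laxVec ε x 2).map (algebraMap ℝ ℂ) := by
  simp [numA, laxVec_two, laxDir, poleComb_apply, sZ, Polynomial.map_sum, oscVec]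

lemma numB_eq (ε : Fin n → ℝ) (x : Ambient n) :
    numB ε x = (laxVec ε x 0).map (algebraMap ℝ ℂ)
      - C Complex.I * (laxVec ε x 1).map (algebraMap ℝ ℂ) := by
  have h : (2 * x.1 : ℂ) = ((2 * x.1.re : ℝ) : ℂ) - Complex.I * ((-2 * x.1.im : ℝ) : ℂ) := by
    apply Complex.ext <;> simp
  simp only [numB, h, laxVec_zero, laxVec_one, laxDir, poleComb_apply, sMinus, Polynomial.map_sum,
    oscVec, Polynomial.map_add, Polynomial.map_mul, map_C, Finset.mul_sum, map_sub, map_mul,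
    sub_mul, Finset.sum_sub_distrib, mul_add]
  simp
  ring_nf

lemma numC_eq (ε : Fin n → ℝ) (x : Ambient n) :
    numC ε x = (laxVec ε x 0).map (algebraMap ℝ ℂ)
      + C Complex.I * (laxVec ε x 1).map (algebraMap ℝ ℂ) := by
  have h : (2 * (starRingEnd ℂ) x.1 : ℂ)
      = ((2 * x.1.re : ℝ) : ℂ) + Complex.I * ((-2 * x.1.im : ℝ) : ℂ) := by
    apply Complex.ext <;> simp
  simp only [numC, h, laxVec_zero, laxVec_one, laxDir, poleComb_apply, sPlus, Polynomial.map_sum,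
    oscVec, Polynomial.map_add, Polynomial.map_mul, map_C, Finset.mul_sum, map_add, map_mul,
    add_mul, Finset.sum_add_distrib, mul_add]
  simp
  ring_nf

/-- The summand `k = j`, excluded in the definition, may be included because `x / 0 = 0`. -/
lemma spinHam_eq (ε : Fin n → ℝ) (j : Fin n) (x : Ambient n) :
    spinHam ε j x = 2 * ε j * x.2 j 2 + ∑ a, oscVec x a * x.2 j a
      + ∑ k, (x.2 j ⬝ᵥ x.2 k) / (ε j - ε k) := by
  have h : (x.1 * sPlus x j + (starRingEnd ℂ) x.1 * sMinus x j).re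
      = ∑ a, oscVec x a * x.2 j a := by
    simp [sPlus, sMinus, Fin.sum_univ_three, oscVec]; ring
  rw [spinHam, h, Finset.sum_erase _ (by simp)]
  rfl

lemma totalHam_eq (x : Ambient n) :
    4 * totalHam x = ∑ a, oscVec x a ^ 2 + 4 * ∑ j, x.2 j 2 := by
  simp [totalHam, Fin.sum_univ_three, oscVec, Complex.normSq_apply, sZ]; ring

/-- The product of two simple fractions is a combination of the two. -/
lemma C_sub_mul_poleProdErase (ε : Fin n → ℝ) (j k : Fin n) :
    C (ε j - ε k) * (poleProdErase ε j * poleProdErase ε k)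
      = poleProd ε * poleProdErase ε j - poleProd ε * poleProdErase ε k := by
  have hj := X_sub_mul_poleProdErase ε j
  have hk := X_sub_mul_poleProdErase ε k
  rw [C_sub]
  linear_combination poleProdErase ε j * hk - poleProdErase ε k * hj

/-- The square of the spin part in partial fractions: products over distinct poles contribute simple
fractions, the diagonal stays as double poles. The diagonal terms on the right vanish by
`x / 0 = 0`. -/
lemma sum_sum_dot_poleProdErase {ε : Fin n → ℝ} (hε : Function.Injective ε) (x : Ambient n) :
    ∑ j, ∑ k, C (x.2 j ⬝ᵥ x.2 k) * (poleProdErase ε j * poleProdErase ε k)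
      = ∑ j, C (2 * ∑ k, (x.2 j ⬝ᵥ x.2 k) / (ε j - ε k)) * (poleProd ε * poleProdErase ε j)
        + ∑ j, C (x.2 j ⬝ᵥ x.2 j) * poleProdErase ε j ^ 2 := by
  have h1 : ∀ j k, C (x.2 j ⬝ᵥ x.2 k) * (poleProdErase ε j * poleProdErase ε k)
      = C ((x.2 j ⬝ᵥ x.2 k) / (ε j - ε k)) * (poleProd ε * poleProdErase ε j)
        - C ((x.2 j ⬝ᵥ x.2 k) / (ε j - ε k)) * (poleProd ε * poleProdErase ε k)
        + if j = k then C (x.2 j ⬝ᵥ x.2 j) * poleProdErase ε j ^ 2 else 0 := by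
    intro j k
    rcases eq_or_ne j k with rfl | hjk
    · simp [sq]
    · have h : ε j - ε k ≠ 0 := sub_ne_zero.2 (hε.ne hjk)
      rw [if_neg hjk, add_zero, ← mul_sub, ← C_sub_mul_poleProdErase,
        ← mul_assoc (C _) (C _), ← C_mul, div_mul_cancel₀ _ h]
  have h2 : ∑ j, ∑ k, C ((x.2 j ⬝ᵥ x.2 k) / (ε j - ε k)) * (poleProd ε * poleProdErase ε k)
      = - ∑ j, ∑ k, C ((x.2 j ⬝ᵥ x.2 k) / (ε j - ε k)) * (poleProd ε * poleProdErase ε j) := by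
    rw [Finset.sum_comm, ← Finset.sum_neg_distrib]
    refine Finset.sum_congr rfl fun j _ => ?_
    rw [← Finset.sum_neg_distrib]
    refine Finset.sum_congr rfl fun k _ => ?_
    rw [dotProduct_comm, ← neg_sub, div_neg, C_neg, neg_mul]
  simp only [h1, Finset.sum_add_distrib, Finset.sum_sub_distrib, h2]
  simp only [Finset.sum_ite_eq, Finset.mem_univ, if_true, map_mul, map_sum, Finset.mul_sum,
    Finset.sum_mul, sub_neg_eq_add, ← Finset.sum_add_distrib]
  refine Finset.sum_congr rfl fun j _ => congrArg (· + _) ?_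
  refine Finset.sum_congr rfl fun k _ => ?_
  rw [map_ofNat]
  ring

/-- The square of the Lax vector, in partial fractions. This holds on the whole ambient space;
the spin lengths enter through the double poles only. -/
lemma sum_laxVec_sq {ε : Fin n → ℝ} (hε : Function.Injective ε) (x : Ambient n) :
    ∑ a, laxVec ε x a ^ 2
      = (C 4 * X ^ 2 + C (4 * totalHam x)) * poleProd ε ^ 2
        + ∑ j, C (2 * spinHam ε j x) * (poleProd ε * poleProdErase ε j)
        + ∑ j, C (x.2 j ⬝ᵥ x.2 j) * poleProdErase ε j ^ 2 := by
  have hsq : ∑ a, (∑ j, C (x.2 j a) * poleProdErase ε j) ^ 2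
      = ∑ j, ∑ k, C (x.2 j ⬝ᵥ x.2 k) * (poleProdErase ε j * poleProdErase ε k) := by
    simp_rw [sq, Finset.sum_mul_sum, dotProduct, map_sum, Finset.sum_mul]
    rw [Finset.sum_comm]
    refine Finset.sum_congr rfl fun j _ => ?_
    rw [Finset.sum_comm]
    refine Finset.sum_congr rfl fun k _ => Finset.sum_congr rfl fun a _ => ?_
    rw [C_mul]; ring
  have hX : X * ∑ j, C (x.2 j 2) * poleProdErase ε j
      = ∑ j, C (x.2 j 2) * poleProd ε + ∑ j, C (ε j * x.2 j 2) * poleProdErase ε j := by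
    rw [Finset.mul_sum, ← Finset.sum_add_distrib]
    refine Finset.sum_congr rfl fun j _ => ?_
    rw [← X_sub_mul_poleProdErase ε j, C_mul]; ring
  have hcross : ∑ j, C (2 * spinHam ε j x) * (poleProd ε * poleProdErase ε j)
      = poleProd ε * (C 4 * ∑ j, C (ε j * x.2 j 2) * poleProdErase ε j
        + ∑ a, C (2 * oscVec x a) * ∑ j, C (x.2 j a) * poleProdErase ε j)
        + ∑ j, C (2 * ∑ k, (x.2 j ⬝ᵥ x.2 k) / (ε j - ε k)) * (poleProd ε * poleProdErase ε j) := by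
    simp only [Finset.mul_sum, mul_add]
    rw [Finset.sum_comm (γ := Fin 3), ← Finset.sum_add_distrib, ← Finset.sum_add_distrib]
    refine Finset.sum_congr rfl fun j _ => ?_
    rw [spinHam_eq]
    simp only [Fin.sum_univ_three, map_mul, map_add, map_ofNat, ← Finset.mul_sum]
    have h4 : (4 : ℝ[X]) = 2 * 2 := by norm_num
    rw [h4]
    ring
  rw [totalHam_eq, hcross]
  have h3 := sum_sum_dot_poleProdErase hε x
  rw [← hsq] at h3
  simp only [Fin.sum_univ_three, laxVec_zero, laxVec_one, laxVec_two, laxDir, poleComb_apply] at h3 ⊢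
  simp only [map_add, map_mul, map_pow, map_ofNat, map_sum] at h3 ⊢
  have h0 : oscVec x 2 = 0 := rfl
  rw [h0] at *
  simp only [← Finset.sum_mul] at hX
  simp only [map_mul] at hX
  simp only [map_zero] at *
  linear_combination h3 + 4 * poleProd ε * hX

/-- The part of the spectral polynomial which depends on the value of the moment map,
divided by `∏ (X - ε_j)`. -/
noncomputable def valuePoly (ε : Fin n → ℝ) : (Fin (n + 1) → ℝ) →ₗ[ℝ] ℝ[X] where
  toFun h := poleComb ε (4 * h (Fin.last n), fun j => 2 * h j.castSucc)
  map_add' h k := by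
    rw [← map_add]
    congr 1
    refine Prod.ext ?_ (funext fun j => ?_) <;> simp [mul_add]
  map_smul' c h := by
    rw [RingHom.id_apply, ← map_smul]
    congr 1
    refine Prod.ext ?_ (funext fun j => ?_) <;> simp <;> ring

lemma valuePoly_apply (ε : Fin n → ℝ) (h : Fin (n + 1) → ℝ) :
    valuePoly ε h = poleComb ε (4 * h (Fin.last n), fun j => 2 * h j.castSucc) := rfl

lemma valuePoly_injective {ε : Fin n → ℝ} (hε : Function.Injective ε) :
    Function.Injective (valuePoly ε) := by
  intro h k hk
  have := poleComb_injective hε (hk : poleComb ε _ = poleComb ε _)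
  rw [Prod.mk.injEq] at this
  funext i
  refine Fin.lastCases ?_ (fun j => ?_) i
  · linarith [this.1]
  · linarith [congrFun this.2 j]

lemma degree_valuePoly_lt (ε : Fin n → ℝ) (h : Fin (n + 1) → ℝ) :
    (valuePoly ε h).degree < (n + 1 : ℕ) := degree_poleComb_lt ε _

lemma exists_valuePoly_eq {ε : Fin n → ℝ} (hε : Function.Injective ε) {f : ℝ[X]}
    (hf : f.degree < (n + 1 : ℕ)) : ∃ h, valuePoly ε h = f := by
  refine ⟨Fin.snoc (fun j => f.eval (ε j) / (poleProdErase ε j).eval (ε j) / 2) (f.coeff n / 4), ?_⟩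
  rw [valuePoly_apply]
  refine Eq.trans ?_ (exists_poleComb_eq hε hf)
  congr 1
  refine Prod.ext ?_ (funext fun j => ?_)
  · simp; ring
  · simp only [Fin.snoc_castSucc]; ring

lemma spectralPoly_eq (ε : Fin n → ℝ) (s : ℝ) (h : Fin (n + 1) → ℝ) :
    spectralPoly ε s h = C 4 * X ^ 2 * poleProd ε ^ 2 + poleProd ε * valuePoly ε h
      + ∑ j : Fin n, C (s ^ 2) * poleProdErase ε j ^ 2 := by
  rw [spectralPoly, valuePoly_apply, poleComb_apply, mul_add, Finset.mul_sum]
  simp only [mul_left_comm (poleProd ε)]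
  ring

lemma spectralPoly_sub (ε : Fin n → ℝ) (s : ℝ) (h k : Fin (n + 1) → ℝ) :
    spectralPoly ε s h - spectralPoly ε s k = poleProd ε * valuePoly ε (h - k) := by
  rw [spectralPoly_eq, spectralPoly_eq, map_sub]; ring

lemma spectralPoly_injective {ε : Fin n → ℝ} (hε : Function.Injective ε) (s : ℝ) :
    Function.Injective (spectralPoly ε s) := by
  intro h k hk
  have := spectralPoly_sub ε s h k
  rw [hk, sub_self, eq_comm, mul_eq_zero] at this
  have := this.resolve_left (poleProd_monic ε).ne_zero
  rw [map_sub, sub_eq_zero] at this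
  exact valuePoly_injective hε this

lemma eval_spectralPoly_pole (ε : Fin n → ℝ) (s : ℝ) (h : Fin (n + 1) → ℝ) (j : Fin n) :
    (spectralPoly ε s h).eval (ε j) = s ^ 2 * (poleProdErase ε j).eval (ε j) ^ 2 := by
  rw [spectralPoly_eq, eval_add, eval_add, eval_mul, eval_mul (p := poleProd ε), eval_pow,
    eval_poleProd_self, eval_finsetSum, Finset.sum_eq_single j]
  · simp
  · intro i _ hi
    simp [eval_poleProdErase_of_ne ε hi.symm]
  · simp

lemma eval_spectralPoly_pole_ne_zero {ε : Fin n → ℝ} (hε : Function.Injective ε) {s : ℝ}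
    (hs : 0 < s) (h : Fin (n + 1) → ℝ) (j : Fin n) : (spectralPoly ε s h).eval (ε j) ≠ 0 := by
  rw [eval_spectralPoly_pole]
  have := eval_poleProdErase_self_ne_zero hε j
  positivity

/-- On phase space the spectral polynomial is the square of the Lax vector. -/
lemma spectralPoly_momentMap {ε : Fin n → ℝ} (hε : Function.Injective ε) {s : ℝ} {x : Ambient n}
    (hx : x ∈ phaseSpace n s) : spectralPoly ε s (momentMap ε x) = ∑ a, laxVec ε x a ^ 2 := by
  rw [sum_laxVec_sq hε, spectralPoly]
  simp only [momentMap, Fin.snoc_last, Fin.snoc_castSucc]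
  congr 1
  exact Finset.sum_congr rfl fun j _ => by rw [hx j]

/-! ### The differential of the moment map -/

lemma differentiable_re : Differentiable ℝ fun x : Ambient n => x.1.re :=
  Complex.reCLM.differentiable.comp differentiable_fst

lemma differentiable_im : Differentiable ℝ fun x : Ambient n => x.1.im :=
  Complex.imCLM.differentiable.comp differentiable_fst

lemma differentiable_spin (j : Fin n) (a : Fin 3) :
    Differentiable ℝ fun x : Ambient n => x.2 j a := by fun_prop

lemma differentiable_oscVec (a : Fin 3) : Differentiable ℝ fun x : Ambient n => oscVec x a := by
  fin_cases a
  · exact differentiable_re.const_mul 2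
  · exact differentiable_im.const_mul (-2)
  · exact differentiable_const 0

lemma differentiable_spinHam (ε : Fin n → ℝ) (j : Fin n) : Differentiable ℝ (spinHam ε j) := by
  have h : spinHam ε j = fun x => 2 * ε j * x.2 j 2 + ∑ a, oscVec x a * x.2 j a
      + ∑ k, (∑ a, x.2 j a * x.2 k a) / (ε j - ε k) := funext fun x => spinHam_eq ε j x
  have h1 := fun a => differentiable_oscVec (n := n) a
  rw [h]
  fun_prop

lemma differentiable_totalHam : Differentiable ℝ (totalHam (n := n)) := by
  have h : totalHam (n := n) = fun x => (∑ a, oscVec x a ^ 2 + 4 * ∑ j, x.2 j 2) / 4 :=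
    funext fun x => by rw [← totalHam_eq]; ring
  have h1 := fun a => differentiable_oscVec (n := n) a
  rw [h]
  fun_prop

lemma differentiable_momentMap (ε : Fin n → ℝ) : Differentiable ℝ (momentMap ε) := by
  rw [differentiable_pi]
  refine fun i => Fin.lastCases ?_ (fun j => ?_) i
  · simpa [momentMap] using differentiable_totalHam
  · simpa [momentMap] using differentiable_spinHam ε j

lemma sum_laxVec_sq' {ε : Fin n → ℝ} (hε : Function.Injective ε) (x : Ambient n) :
    ∑ a, laxVec ε x a ^ 2
      = C 4 * X ^ 2 * poleProd ε ^ 2 + poleProd ε * valuePoly ε (momentMap ε x)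
        + ∑ j, C (x.2 j ⬝ᵥ x.2 j) * poleProdErase ε j ^ 2 := by
  rw [sum_laxVec_sq hε, valuePoly_apply, poleComb_apply, mul_add, Finset.mul_sum]
  simp only [momentMap, Fin.snoc_last, Fin.snoc_castSucc, mul_left_comm (poleProd ε)]
  ring

/-- The differential of the moment map along a tangent vector, read off from the differential of
the square of the Lax vector. -/
lemma poleProd_mul_valuePoly_fderiv {ε : Fin n → ℝ} (hε : Function.Injective ε) {x v : Ambient n}
    (hv : v ∈ tangent x) :
    poleProd ε * valuePoly ε (fderiv ℝ (momentMap ε) x v)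
      = C 2 * ∑ a, laxVec ε x a * laxDir ε v a := by
  refine Polynomial.funext fun z => ?_
  have hF : HasDerivAt (fun t : ℝ => momentMap ε (x + t • v)) (fderiv ℝ (momentMap ε) x v) 0 := by
    have h1 : HasDerivAt (fun t : ℝ => x + t • v) v 0 := by
      simpa using ((hasDerivAt_id (0 : ℝ)).smul_const v).const_add x
    have h2 : HasFDerivAt (momentMap ε) (fderiv ℝ (momentMap ε) x) (x + (0 : ℝ) • v) := by
      simpa using (differentiable_momentMap ε x).hasFDerivAt
    exact h2.comp_hasDerivAt 0 h1
  have hL := ((((leval z).comp (valuePoly ε)).toContinuousLinearMap.hasFDerivAt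
    (x := momentMap ε (x + (0 : ℝ) • v))).comp_hasDerivAt 0 hF).const_mul ((poleProd ε).eval z)
  have hR : HasDerivAt (fun t : ℝ => ∑ a, ((laxVec ε x a).eval z + t * (laxDir ε v a).eval z) ^ 2)
      (∑ a, 2 * ((laxVec ε x a).eval z * (laxDir ε v a).eval z)) 0 := by
    refine HasDerivAt.fun_sum fun a _ => ?_
    have h := (((hasDerivAt_id (0 : ℝ)).mul_const ((laxDir ε v a).eval z)).const_add
      ((laxVec ε x a).eval z)).pow 2
    convert! h using 1
    simp [mul_assoc]
  have hD : HasDerivAt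
      (fun t : ℝ => ∑ j, (t ^ 2 * (v.2 j ⬝ᵥ v.2 j)) * (poleProdErase ε j).eval z ^ 2) 0 0 := by
    have h : HasDerivAt
        (fun t : ℝ => ∑ j, (t ^ 2 * (v.2 j ⬝ᵥ v.2 j)) * (poleProdErase ε j).eval z ^ 2)
        (∑ _j : Fin n, 0) 0 := by
      refine HasDerivAt.fun_sum fun j _ => ?_
      have := (((hasDerivAt_id (0 : ℝ)).pow 2).mul_const (v.2 j ⬝ᵥ v.2 j)).mul_const
        ((poleProdErase ε j).eval z ^ 2)
      simpa using this
    simpa using h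
  have key : (fun t : ℝ => ∑ a, ((laxVec ε x a).eval z + t * (laxDir ε v a).eval z) ^ 2)
      = fun t : ℝ => (4 * z ^ 2 * (poleProd ε).eval z ^ 2
          + ∑ j, (x.2 j ⬝ᵥ x.2 j) * (poleProdErase ε j).eval z ^ 2)
        + ((poleProd ε).eval z * (valuePoly ε (momentMap ε (x + t • v))).eval z
        + ∑ j, (t ^ 2 * (v.2 j ⬝ᵥ v.2 j)) * (poleProdErase ε j).eval z ^ 2) := by
    funext t
    have h := congrArg (eval z) (sum_laxVec_sq' hε (x + t • v))
    simp only [laxVec_add, laxDir_smul, eval_finsetSum, eval_add, eval_mul, eval_pow, eval_C,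
      eval_X] at h
    have hdot : ∀ j, ((x + t • v).2 j ⬝ᵥ (x + t • v).2 j)
        = x.2 j ⬝ᵥ x.2 j + t ^ 2 * (v.2 j ⬝ᵥ v.2 j) := by
      intro j
      have hj : x.2 j ⬝ᵥ v.2 j = 0 := hv j
      simp only [Prod.snd_add, Prod.smul_snd, Pi.add_apply, Pi.smul_apply, dotProduct_add,
        add_dotProduct, dotProduct_smul, smul_dotProduct, hj, dotProduct_comm (v.2 j) (x.2 j),
        smul_eq_mul]
      ring
    simp only [hdot, add_mul, Finset.sum_add_distrib] at h
    rw [h]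
    ring
  rw [key] at hR
  have h := hR.unique ((hL.add hD).const_add _)
  rw [← Finset.mul_sum] at h
  rw [eval_mul, eval_mul, eval_finsetSum, eval_C]
  simp only [eval_mul]
  rw [h]
  simp [leval]

/-! ### The rank of the moment map -/

/-- The directions in the space of values along which the variation of the spectral polynomial,
divided by `∏ (X - ε_j)`, is divisible by `G`. -/
noncomputable def dvdValues (ε : Fin n → ℝ) (G : ℝ[X]) : Submodule ℝ (Fin (n + 1) → ℝ) :=
  ((Ideal.span {G}).restrictScalars ℝ).comap (valuePoly ε)

lemma mem_dvdValues {ε : Fin n → ℝ} {G : ℝ[X]} {v : Fin (n + 1) → ℝ} :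
    v ∈ dvdValues ε G ↔ G ∣ valuePoly ε v := by
  simp [dvdValues, Ideal.mem_span_singleton]

lemma finrank_map_of_injective {V W : Type*} [AddCommGroup V] [Module ℝ V] [AddCommGroup W]
    [Module ℝ W] {f : V →ₗ[ℝ] W} (hf : Function.Injective f) (S : Submodule ℝ V) :
    Module.finrank ℝ (S.map f) = Module.finrank ℝ S :=
  (Submodule.equivMapOfInjective f hf S).finrank_eq.symm

lemma degree_mul_lt_iff {G q : ℝ[X]} (hG : G ≠ 0) (k : ℕ) :
    (G * q).degree < k ↔ q.degree < (k - G.natDegree : ℕ) := by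
  rcases eq_or_ne q 0 with rfl | hq
  · simp
  · rw [degree_eq_natDegree (mul_ne_zero hG hq), degree_eq_natDegree hq, natDegree_mul hG hq]
    norm_cast
    omega

lemma finrank_dvdValues {ε : Fin n → ℝ} (hε : Function.Injective ε) {G : ℝ[X]} (hG : G ≠ 0) :
    Module.finrank ℝ (dvdValues ε G) = n + 1 - G.natDegree := by
  have hmul : Function.Injective (LinearMap.mulLeft ℝ G) := fun p q h => mul_left_cancel₀ hG h
  have h : (dvdValues ε G).map (valuePoly ε)
      = (degreeLT ℝ (n + 1 - G.natDegree)).map (LinearMap.mulLeft ℝ G) := by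
    ext f
    simp only [Submodule.mem_map, mem_dvdValues, mem_degreeLT, LinearMap.mulLeft_apply]
    constructor
    · rintro ⟨v, ⟨q, hq⟩, rfl⟩
      refine ⟨q, ?_, hq.symm⟩
      rw [← degree_mul_lt_iff hG, ← hq]
      exact degree_valuePoly_lt ε v
    · rintro ⟨q, hq, rfl⟩
      obtain ⟨v, hv⟩ := exists_valuePoly_eq hε ((degree_mul_lt_iff hG (n + 1)).2 hq)
      exact ⟨v, hv ▸ dvd_mul_right G q, hv⟩
  rw [← finrank_map_of_injective (valuePoly_injective hε), h, finrank_map_of_injective hmul,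
    (degreeLTEquiv ℝ _).finrank_eq, Module.finrank_fin_fun]

/-- A monic greatest common divisor `d` of the entries of the Lax vector, with cofactors `c` whose
coprimality is witnessed by the Bézout coefficients `u`. -/
structure IsLaxGCD (ε : Fin n → ℝ) (x : Ambient n) (d : ℝ[X]) (c u : Fin 3 → ℝ[X]) : Prop where
  monic : d.Monic
  eq_mul : ∀ a, laxVec ε x a = d * c a
  bezout : ∑ a, u a * c a = 1

lemma laxVec_two_ne_zero (ε : Fin n → ℝ) (x : Ambient n) :
    (laxVec ε x 2).natDegree = n + 1 ∧ (laxVec ε x 2).leadingCoeff = 2 := by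
  have h1 : (C 2 * X * poleProd ε).natDegree = n + 1 := by
    rw [mul_assoc, natDegree_C_mul two_ne_zero, natDegree_X_mul (poleProd_monic ε).ne_zero,
      natDegree_poleProd]
  have h2 : (C 2 * X * poleProd ε).leadingCoeff = 2 := by
    rw [leadingCoeff_mul, (poleProd_monic ε).leadingCoeff]; simp
  have h3 : (laxDir ε x 2).degree < (C 2 * X * poleProd ε).degree := by
    rw [degree_eq_natDegree (p := C 2 * X * poleProd ε) (by intro h; rw [h] at h2; simp at h2), h1]
    exact degree_laxDir_lt ε x 2
  rw [laxVec_two]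
  refine ⟨?_, ?_⟩
  · rw [natDegree_add_eq_left_of_degree_lt h3, h1]
  · rw [leadingCoeff_add_of_degree_lt' h3, h2]

lemma exists_isLaxGCD (ε : Fin n → ℝ) (x : Ambient n) : ∃ d c u, IsLaxGCD ε x d c u := by
  set I : Ideal ℝ[X] := Ideal.span (Set.range (laxVec ε x)) with hI
  obtain ⟨g, hg⟩ := (IsPrincipalIdealRing.principal I).principal
  have hmem : ∀ a, g ∣ laxVec ε x a := fun a => by
    have : laxVec ε x a ∈ I := Ideal.subset_span ⟨a, rfl⟩
    rw [hg] at this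
    exact Ideal.mem_span_singleton.1 this
  have h2 : laxVec ε x 2 ≠ 0 := fun h => by
    have := (laxVec_two_ne_zero ε x).1
    rw [h] at this
    simp at this
  have hg0 : g ≠ 0 := fun h => h2 (zero_dvd_iff.1 (h ▸ hmem 2))
  have hgI : g ∈ I := hg ▸ Submodule.mem_span_singleton_self g
  obtain ⟨w, hw⟩ := (Ideal.mem_span_range_iff_exists_fun).1 hgI
  have hd : (normalize g).Monic := monic_normalize hg0
  choose c hc using fun a => (normalize_dvd_iff.2 (hmem a) : normalize g ∣ laxVec ε x a)
  obtain ⟨e, he⟩ := (dvd_normalize_iff.2 (dvd_refl g) : g ∣ normalize g)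
  refine ⟨normalize g, c, fun a => e * w a, hd, hc, ?_⟩
  refine mul_left_cancel₀ hd.ne_zero ?_
  calc normalize g * ∑ a, e * w a * c a = e * ∑ a, w a * laxVec ε x a := by
        rw [Finset.mul_sum, Finset.mul_sum]
        exact Finset.sum_congr rfl fun a _ => by rw [hc a]; ring
    _ = normalize g * 1 := by rw [hw, mul_one, he, mul_comm]

/-- The directions of the Lax vector are the triples of polynomials of degree at most `n`, at most `n`
and less than `n`: the coefficients of `X ^ n` give the oscillator, the values at the poles the
spins. -/
lemma exists_laxDir_eq {ε : Fin n → ℝ} (hε : Function.Injective ε) {f g k : ℝ[X]}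
    (hf : f.degree < (n + 1 : ℕ)) (hg : g.degree < (n + 1 : ℕ)) (hk : k.degree < n) :
    ∃ v : Ambient n, laxDir ε v 0 = f ∧ laxDir ε v 1 = g ∧ laxDir ε v 2 = k := by
  have rf := exists_poleComb_eq hε hf
  have rg := exists_poleComb_eq hε hg
  have rk := exists_poleComb_eq hε (hk.trans (by exact_mod_cast Nat.lt_succ_self n))
  rw [coeff_eq_zero_of_degree_lt hk] at rk
  refine ⟨(⟨f.coeff n / 2, -g.coeff n / 2⟩,
    fun j => ![f.eval (ε j) / (poleProdErase ε j).eval (ε j),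
      g.eval (ε j) / (poleProdErase ε j).eval (ε j),
      k.eval (ε j) / (poleProdErase ε j).eval (ε j)]), ?_, ?_, ?_⟩
  · refine Eq.trans ?_ rf
    simp [laxDir, oscVec, mul_div_cancel₀]
  · refine Eq.trans ?_ rg
    simp [laxDir, oscVec, mul_div_cancel₀, neg_div]
  · exact rk

namespace IsLaxGCD

variable {ε : Fin n → ℝ} {x : Ambient n} {d : ℝ[X]} {c u : Fin 3 → ℝ[X]}

lemma dvd_of_forall_dvd (h : IsLaxGCD ε x d c u) {e : ℝ[X]} (he : ∀ a, e ∣ laxVec ε x a) :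
    e ∣ d := by
  have : d = ∑ a, u a * laxVec ε x a := by
    rw [← mul_one d, ← h.bezout, Finset.mul_sum]
    exact Finset.sum_congr rfl fun a _ => by rw [h.eq_mul]; ring
  rw [this]
  exact Finset.dvd_sum fun a _ => (he a).mul_left _

lemma sum_sq (h : IsLaxGCD ε x d c u) : ∑ a, laxVec ε x a ^ 2 = d ^ 2 * ∑ a, c a ^ 2 := by
  rw [Finset.mul_sum]
  exact Finset.sum_congr rfl fun a _ => by rw [h.eq_mul]; ring

lemma eval_sum_sq_ne_zero (h : IsLaxGCD ε x d c u) (t : ℝ) : (∑ a, c a ^ 2).eval t ≠ 0 := by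
  intro h0
  simp only [eval_finsetSum, eval_pow] at h0
  have hc : ∀ a, (c a).eval t = 0 := fun a => by
    have := (Finset.sum_eq_zero_iff_of_nonneg (fun i _ => sq_nonneg _)).1 h0 a (Finset.mem_univ a)
    exact pow_eq_zero_iff two_ne_zero |>.1 this
  have := congrArg (eval t) h.bezout
  simp [eval_finsetSum, hc] at this

lemma eval_pole_ne_zero (h : IsLaxGCD ε x d c u) (hε : Function.Injective ε) {s : ℝ} (hs : 0 < s)
    (hx : x ∈ phaseSpace n s) (j : Fin n) : d.eval (ε j) ≠ 0 := by
  intro h0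
  refine eval_spectralPoly_pole_ne_zero hε hs (momentMap ε x) j ?_
  rw [spectralPoly_momentMap hε hx, h.sum_sq, eval_mul, eval_pow, h0]
  ring

lemma natDegree_add (h : IsLaxGCD ε x d c u) : d.natDegree + (c 2).natDegree = n + 1 := by
  have h2 := (laxVec_two_ne_zero ε x).1
  rw [h.eq_mul, h.monic.natDegree_mul' (fun h0 => by simp [h0] at h2)] at h2
  exact h2

/-- Every polynomial of degree less than `2 n + 1 - deg d` is a combination of the cofactors, with
coefficients of the degrees which occur in directions of the Lax vector. -/
lemma exists_laxDir (h : IsLaxGCD ε x d c u) (hε : Function.Injective ε) {f : ℝ[X]}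
    (hf : f.degree < (n + (c 2).natDegree : ℕ)) :
    ∃ v : Ambient n, ∑ a, c a * laxDir ε v a = f := by
  have hc2 : c 2 ≠ 0 := fun h0 => by
    have h2 := (laxVec_two_ne_zero ε x).1
    simp [h.eq_mul, h0] at h2
  have hdeg := h.natDegree_add
  -- A Bézout combination with the first two coefficients reduced modulo `c 2`; the quotients go into
  -- the third coefficient, whose degree is then bounded by that of `f`.
  set δ0 := (u 0 * f) % c 2
  set δ1 := (u 1 * f) % c 2
  set δ2 := u 2 * f + c 0 * ((u 0 * f) / c 2) + c 1 * ((u 1 * f) / c 2)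
  have h0 : δ0.degree < (c 2).natDegree :=
    (EuclideanDomain.mod_lt _ hc2).trans_eq (degree_eq_natDegree hc2)
  have h1 : δ1.degree < (c 2).natDegree :=
    (EuclideanDomain.mod_lt _ hc2).trans_eq (degree_eq_natDegree hc2)
  have hsum : c 0 * δ0 + c 1 * δ1 + c 2 * δ2 = f := by
    have e0 := EuclideanDomain.div_add_mod (u 0 * f) (c 2)
    have e1 := EuclideanDomain.div_add_mod (u 1 * f) (c 2)
    have hb := h.bezout
    rw [Fin.sum_univ_three] at hb
    linear_combination c 0 * e0 + c 1 * e1 + f * hb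
  have hcd : ∀ a, a ≠ 2 → (c a).degree < (c 2).natDegree := by
    intro a ha
    have hlt : (laxVec ε x a).degree < (n + 1 : ℕ) := by
      have : (laxVec ε x a) = laxDir ε x a := by
        fin_cases a
        · exact laxVec_zero ε x
        · exact laxVec_one ε x
        · exact absurd rfl ha
      rw [this]
      exact degree_laxDir_lt ε x a
    rw [h.eq_mul, degree_mul_lt_iff h.monic.ne_zero] at hlt
    rwa [(by omega : n + 1 - d.natDegree = (c 2).natDegree)] at hlt
  have hprod : ∀ p q : ℝ[X], p.degree < (c 2).natDegree → q.degree < (c 2).natDegree →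
      (p * q).degree < (n + (c 2).natDegree : ℕ) := by
    intro p q hp hq
    rcases eq_or_ne p 0 with rfl | hp0
    · simp [bot_lt_iff_ne_bot]
    rw [degree_eq_natDegree hp0] at hp
    rw [degree_mul_lt_iff hp0]
    refine hq.trans_le ?_
    norm_cast at hp ⊢
    omega
  have h2 : δ2.degree < n := by
    have : (c 2 * δ2).degree < (n + (c 2).natDegree : ℕ) := by
      rw [(by linear_combination hsum : c 2 * δ2 = f - c 0 * δ0 - c 1 * δ1), ← mem_degreeLT]
      exact Submodule.sub_mem _ (Submodule.sub_mem _ (mem_degreeLT.2 hf)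
        (mem_degreeLT.2 (hprod _ _ (hcd 0 (by decide)) h0)))
        (mem_degreeLT.2 (hprod _ _ (hcd 1 (by decide)) h1))
    rw [degree_mul_lt_iff hc2] at this
    simpa using this
  have hle : ((c 2).natDegree : WithBot ℕ) ≤ (n + 1 : ℕ) := by exact_mod_cast (by omega)
  obtain ⟨v, v0, v1, v2⟩ := exists_laxDir_eq hε (h0.trans_le hle) (h1.trans_le hle) h2
  exact ⟨v, by rw [Fin.sum_univ_three, v0, v1, v2, hsum]⟩

/-- The image of the differential of the moment map consists of the directions along which the
variation of the spectral polynomial is divisible by the common divisor of the Lax vector. -/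
lemma map_tangent_eq (h : IsLaxGCD ε x d c u) (hε : Function.Injective ε) {s : ℝ} (hs : 0 < s)
    (hx : x ∈ phaseSpace n s) :
    (tangent x).map (fderiv ℝ (momentMap ε) x : Ambient n →ₗ[ℝ] (Fin (n + 1) → ℝ))
      = dvdValues ε d := by
  have hd := isCoprime_poleProd (h.eval_pole_ne_zero hε hs hx)
  ext w
  simp only [Submodule.mem_map, mem_dvdValues, ContinuousLinearMap.coe_coe]
  have hdsum : ∀ v, ∑ a, laxVec ε x a * laxDir ε v a = d * ∑ a, c a * laxDir ε v a := fun v => by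
    rw [Finset.mul_sum]
    exact Finset.sum_congr rfl fun a _ => by rw [h.eq_mul]; ring
  constructor
  · rintro ⟨v, hv, rfl⟩
    refine hd.dvd_of_dvd_mul_left (?_ : d ∣ poleProd ε * _)
    rw [poleProd_mul_valuePoly_fderiv hε hv, hdsum]
    exact (dvd_mul_right _ _).mul_left _
  · rintro ⟨q, hq⟩
    have hqdeg : q.degree < (c 2).natDegree := by
      have := degree_valuePoly_lt ε w
      rw [hq, degree_mul_lt_iff h.monic.ne_zero] at this
      rwa [(by have := h.natDegree_add; omega : n + 1 - d.natDegree = (c 2).natDegree)] at this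
    have hf : (poleProd ε * (C (1 / 2) * q)).degree < ((n + (c 2).natDegree : ℕ) : WithBot ℕ) := by
      rw [degree_mul_lt_iff (poleProd_monic ε).ne_zero, natDegree_poleProd, ← mem_degreeLT,
        ← smul_eq_C_mul]
      refine Submodule.smul_mem _ _ (mem_degreeLT.2 ?_)
      simpa using hqdeg
    obtain ⟨v, hv⟩ := h.exists_laxDir hε hf
    -- `∑ L_a δL_a` vanishes at the poles, which says that the direction is tangent to phase space
    have htan : v ∈ tangent x := by
      intro j
      have h1 := congrArg (eval (ε j)) (hdsum v)
      rw [hv] at h1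
      simp only [eval_finsetSum, eval_mul, eval_poleProd_self, eval_laxVec_pole, laxDir,
        eval_poleComb] at h1
      have h2 : (x.2 j ⬝ᵥ v.2 j) * (poleProdErase ε j).eval (ε j) ^ 2 = 0 := by
        rw [dotProduct, Finset.sum_mul, ← mul_zero (d.eval (ε j)), ← zero_mul, ← h1]
        exact Finset.sum_congr rfl fun a _ => by ring
      exact (mul_eq_zero.1 h2).resolve_right
        (pow_ne_zero 2 (eval_poleProdErase_self_ne_zero hε j))
    refine ⟨v, htan, valuePoly_injective hε (mul_left_cancel₀ (poleProd_monic ε).ne_zero ?_)⟩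
    rw [poleProd_mul_valuePoly_fderiv hε htan, hdsum, hv, hq]
    have : (C 2 * C (1 / 2) : ℝ[X]) = 1 := by rw [← C_mul]; norm_num
    linear_combination d * poleProd ε * q * this

/-- The rank of the moment map is `n + 1` minus the degree of the greatest common divisor of the
numerators of `A, B, C`. -/
lemma momentRank_add (h : IsLaxGCD ε x d c u) (hε : Function.Injective ε) {s : ℝ} (hs : 0 < s)
    (hx : x ∈ phaseSpace n s) : d.natDegree + momentRank ε x = n + 1 := by
  rw [momentRank, h.map_tangent_eq hε hs hx, finrank_dvdValues hε h.monic.ne_zero]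
  have := h.natDegree_add
  omega

end IsLaxGCD

/-! ### Real polynomials: sums of two squares and square factors -/

/-- A real polynomial with leading coefficient `4` and without real roots is `p ^ 2 + q ^ 2`, where
`p + i q` collects its roots in the upper half plane. -/
lemma exists_sq_add_sq_upper (r : ℕ) : ∀ b : ℝ[X], b.natDegree = 2 * r → b.leadingCoeff = 4 →
    (∀ t : ℝ, b.eval t ≠ 0) → ∃ p q : ℝ[X], b = p ^ 2 + q ^ 2 ∧ p.natDegree = r ∧
      p.leadingCoeff = 2 ∧ q.degree < r ∧
      ∀ z : ℂ, aeval z p + Complex.I * aeval z q = 0 → 0 < z.im := by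
  induction r with
  | zero =>
    intro b hb hlead _
    have hb' := eq_C_of_natDegree_eq_zero hb
    rw [hb', leadingCoeff_C] at hlead
    refine ⟨C 2, 0, ?_, natDegree_C 2, leadingCoeff_C 2, by simp [bot_lt_iff_ne_bot], ?_⟩
    · rw [hb', hlead, ← C_pow]; norm_num
    · intro z hz
      simp at hz
  | succ r ih =>
    intro b hb hlead hreal
    obtain ⟨ρ, hρ, hρim⟩ : ∃ ρ : ℂ, aeval ρ b = 0 ∧ 0 < ρ.im := by
      obtain ⟨ρ, hρ⟩ := IsAlgClosed.exists_aeval_eq_zero ℂ b (fun h => by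
        have := natDegree_eq_zero_iff_degree_le_zero.2 h.le
        omega)
      rcases lt_trichotomy ρ.im 0 with h | h | h
      · exact ⟨(starRingEnd ℂ) ρ, by rw [aeval_conj, hρ, map_zero], by simpa using h⟩
      · exfalso
        refine hreal ρ.re ?_
        rw [← Complex.re_add_im ρ, h, Complex.ofReal_zero, zero_mul, add_zero] at hρ
        have h2 : ((b.eval ρ.re : ℝ) : ℂ) = 0 := by
          rw [← hρ]; exact (aeval_algebraMap_apply ℂ ρ.re b).symm
        exact_mod_cast h2
      · exact ⟨ρ, hρ, h⟩
    have ht : X ^ 2 - C (2 * ρ.re) * X + C (‖ρ‖ ^ 2) = (X - C ρ.re) ^ 2 + C ρ.im ^ 2 := by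
      rw [← Complex.normSq_eq_norm_sq, Complex.normSq_apply, ← C_pow]
      simp only [map_add, map_mul, map_pow, map_ofNat]
      ring
    obtain ⟨b', hb'⟩ := ht ▸ b.quadratic_dvd_of_aeval_eq_zero_im_ne_zero hρ hρim.ne'
    have hmon : ((X - C ρ.re) ^ 2 + C ρ.im ^ 2 : ℝ[X]).Monic ∧
        ((X - C ρ.re) ^ 2 + C ρ.im ^ 2 : ℝ[X]).natDegree = 2 := by
      have h2 : ((X - C ρ.re) ^ 2 : ℝ[X]).degree = 2 := by simp [degree_X_sub_C]
      have h1 : (C ρ.im ^ 2 : ℝ[X]).degree < ((X - C ρ.re) ^ 2 : ℝ[X]).degree := by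
        rw [← C_pow, h2]
        exact degree_C_le.trans_lt (by norm_num)
      exact ⟨((monic_X_sub_C _).pow 2).add_of_left h1, by
        rw [natDegree_add_eq_left_of_degree_lt h1, natDegree_eq_of_degree_eq_some h2]⟩
    have hb0 : b' ≠ 0 := by
      rintro rfl
      simp [hb'] at hlead
    obtain ⟨p, q, hpq, hpd, hpl, hqd, hup⟩ := ih b'
      (by rw [hb', hmon.1.natDegree_mul' hb0, hmon.2] at hb; omega)
      (by rwa [hb', leadingCoeff_mul, hmon.1.leadingCoeff, one_mul] at hlead)
      (fun t h => hreal t (by rw [hb', eval_mul, h, mul_zero]))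
    have hp0 : p ≠ 0 := by rintro rfl; simp at hpl
    have hpdeg : p.degree = r := by rw [degree_eq_natDegree hp0, hpd]
    have hXp : ((X - C ρ.re) * p).degree = ((r + 1 : ℕ) : WithBot ℕ) := by
      rw [degree_mul, degree_X_sub_C, hpdeg]; push_cast; ring
    have hlt : (C ρ.im * q).degree < ((X - C ρ.re) * p).degree := by
      rw [hXp, degree_C_mul hρim.ne']
      exact hqd.trans (by exact_mod_cast Nat.lt_succ_self r)
    -- multiply `p + i q` by `X - ρ`
    refine ⟨(X - C ρ.re) * p + C ρ.im * q, (X - C ρ.re) * q - C ρ.im * p, ?_, ?_, ?_, ?_, ?_⟩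
    · rw [hb', hpq]; ring
    · rw [natDegree_add_eq_left_of_degree_lt hlt, natDegree_eq_of_degree_eq_some hXp]
    · rw [leadingCoeff_add_of_degree_lt' hlt, leadingCoeff_mul, leadingCoeff_X_sub_C, hpl, one_mul]
    · rw [← mem_degreeLT]
      refine Submodule.sub_mem _ (mem_degreeLT.2 ?_) (mem_degreeLT.2 ?_)
      · rw [degree_mul_lt_iff (X_sub_C_ne_zero _), natDegree_X_sub_C]
        simpa using hqd
      · rw [degree_C_mul hρim.ne', hpdeg]
        exact_mod_cast Nat.lt_succ_self r
    · intro z hz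
      have hfac : aeval z ((X - C ρ.re) * p + C ρ.im * q)
          + Complex.I * aeval z ((X - C ρ.re) * q - C ρ.im * p)
          = (z - ρ) * (aeval z p + Complex.I * aeval z q) := by
        simp only [map_add, map_sub, map_mul, aeval_X, aeval_C, Complex.coe_algebraMap]
        linear_combination (aeval z p + Complex.I * aeval z q) * (Complex.re_add_im ρ).symm
          + ρ.im * aeval z q * Complex.I_sq
      rw [hfac, mul_eq_zero] at hz
      rcases hz with hz | hz
      · rwa [sub_eq_zero.1 hz]
      · exact hup z hz

/-- A real polynomial of degree `2 r` with leading coefficient `4` and without real roots is a sum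
of two coprime squares. -/
lemma exists_sq_add_sq {r : ℕ} {b : ℝ[X]} (hb : b.natDegree = 2 * r) (hlead : b.leadingCoeff = 4)
    (hreal : ∀ t : ℝ, b.eval t ≠ 0) :
    ∃ p q : ℝ[X], b = p ^ 2 + q ^ 2 ∧ p.natDegree = r ∧ p.leadingCoeff = 2 ∧ q.degree < r ∧
      IsCoprime p q := by
  obtain ⟨p, q, h1, h2, h3, h4, h5⟩ := exists_sq_add_sq_upper r b hb hlead hreal
  refine ⟨p, q, h1, h2, h3, h4, ?_⟩
  refine (isCoprime_iff_aeval_ne_zero_of_isAlgClosed ℝ ℂ p q).2 fun z => ?_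
  by_contra! h
  -- a common zero `z` and its conjugate would both lie in the upper half plane
  have hz := h5 z (by rw [h.1, h.2]; simp)
  have hz' := h5 ((starRingEnd ℂ) z) (by rw [aeval_conj, aeval_conj, h.1, h.2]; simp)
  rw [Complex.conj_im] at hz'
  linarith

lemma dvd_of_sq_dvd_sq_mul_squarefree {a b d : ℝ[X]} (ha : a ≠ 0) (hb : Squarefree b)
    (h : d ^ 2 ∣ a ^ 2 * b) : d ∣ a := by
  obtain ⟨g, a', d', hcop, rfl, rfl⟩ : ∃ g a' d' : ℝ[X], IsCoprime d' a' ∧ a = g * a' ∧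
      d = g * d' := by
    have hg : EuclideanDomain.gcd d a ≠ 0 := fun h0 => ha (EuclideanDomain.gcd_eq_zero_iff.1 h0).2
    obtain ⟨d', hd'⟩ := EuclideanDomain.gcd_dvd_left d a
    obtain ⟨a', ha'⟩ := EuclideanDomain.gcd_dvd_right d a
    refine ⟨EuclideanDomain.gcd d a, a', d', ?_, ha', hd'⟩
    refine ⟨EuclideanDomain.gcdA d a, EuclideanDomain.gcdB d a, mul_left_cancel₀ hg ?_⟩
    have := EuclideanDomain.gcd_eq_gcd_ab d a
    linear_combination (-1 : ℝ[X]) * this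
      - EuclideanDomain.gcdA d a * hd' - EuclideanDomain.gcdB d a * ha'
  have hg : g ≠ 0 := left_ne_zero_of_mul ha
  have h2 : d' ^ 2 ∣ b := by
    refine (hcop.pow (m := 2) (n := 2)).dvd_of_dvd_mul_left ?_
    rw [mul_pow, mul_pow, mul_assoc] at h
    exact (mul_dvd_mul_iff_left (pow_ne_zero 2 hg)).1 h
  exact mul_dvd_mul_left g ((hb d' (by rwa [← sq])).dvd)

lemma exists_monic_sq_mul_squarefree (Q : ℝ[X]) (hQ : Q ≠ 0) :
    ∃ a b : ℝ[X], a.Monic ∧ Squarefree b ∧ Q = a ^ 2 * b := by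
  induction hk : Q.natDegree using Nat.strong_induction_on generalizing Q with
  | _ k ih =>
    by_cases hsq : Squarefree Q
    · exact ⟨1, Q, monic_one, hsq, by simp⟩
    · simp only [Squarefree, not_forall] at hsq
      obtain ⟨y, ⟨Q', hQ'⟩, hy⟩ := hsq
      have hy0 : y ≠ 0 := by rintro rfl; simp at hQ'; exact hQ hQ'
      have hQ0 : Q' ≠ 0 := by rintro rfl; simp at hQ'; exact hQ hQ'
      have hyd : 0 < y.natDegree := by
        rw [Nat.pos_iff_ne_zero]
        intro h0
        rw [eq_C_of_natDegree_eq_zero h0] at hy hy0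
        exact hy (isUnit_C.2 (isUnit_iff_ne_zero.2 fun h => hy0 (by rw [h, C_0])))
      have hdeg : Q'.natDegree < k := by
        rw [← hk, hQ', natDegree_mul (mul_ne_zero hy0 hy0) hQ0, natDegree_mul hy0 hy0]
        omega
      obtain ⟨a, b, ha, hb, hab⟩ := ih _ hdeg Q' hQ0 rfl
      have hl : y.leadingCoeff ≠ 0 := leadingCoeff_ne_zero.2 hy0
      refine ⟨y * C y.leadingCoeff⁻¹ * a, C (y.leadingCoeff ^ 2) * b,
        (monic_mul_leadingCoeff_inv hy0).mul ha, ?_, ?_⟩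
      · refine hb.squarefree_of_dvd ⟨C (y.leadingCoeff ^ 2)⁻¹, ?_⟩
        rw [mul_right_comm, ← C_mul, mul_inv_cancel₀ (pow_ne_zero 2 hl), C_1, one_mul]
      · have : (C y.leadingCoeff⁻¹ * C y.leadingCoeff : ℝ[X]) = 1 := by
          rw [← C_mul, inv_mul_cancel₀ hl, C_1]
        rw [hQ', hab, C_pow]
        linear_combination (-(y * y * a ^ 2 * b) *
          (C y.leadingCoeff⁻¹ * C y.leadingCoeff + 1)) * this

/-! ### Points over a given spectral polynomial -/

lemma degree_spectralPoly_sub_lt (ε : Fin n → ℝ) (s : ℝ) (h : Fin (n + 1) → ℝ) :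
    (spectralPoly ε s h - (C 2 * X * poleProd ε) ^ 2).degree
    < ((2 * n + 1 : ℕ) : WithBot ℕ) := by
  have hsub : spectralPoly ε s h - (C 2 * X * poleProd ε) ^ 2 = poleProd ε * valuePoly ε h
      + ∑ j : Fin n, C (s ^ 2) * poleProdErase ε j ^ 2 := by
    have h4 : (C 4 : ℝ[X]) = C 2 ^ 2 := by rw [← C_pow]; norm_num
    rw [spectralPoly_eq, h4]
    ring
  rw [hsub, ← mem_degreeLT]
  refine Submodule.add_mem _ (mem_degreeLT.2 ?_) (Submodule.sum_mem _ fun j _ => ?_)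
  · rw [degree_mul_lt_iff (poleProd_monic ε).ne_zero, natDegree_poleProd,
      (by omega : 2 * n + 1 - n = n + 1)]
    exact degree_valuePoly_lt ε h
  · rw [← smul_eq_C_mul]
    refine Submodule.smul_mem _ _ (mem_degreeLT.2 ?_)
    have hj := degree_poleProdErase_lt ε j
    have h0 : poleProdErase ε j ≠ 0 := by
      intro h0
      have := X_sub_mul_poleProdErase ε j
      rw [h0, mul_zero] at this
      exact (poleProd_monic ε).ne_zero this.symm
    rw [sq, degree_mul_lt_iff h0]
    refine hj.trans_le ?_
    rw [degree_eq_natDegree h0] at hj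
    norm_cast at hj ⊢
    omega

lemma leadingTerm_spectralPoly (ε : Fin n → ℝ) (s : ℝ) (h : Fin (n + 1) → ℝ) :
    (spectralPoly ε s h).natDegree = 2 * n + 2 ∧ (spectralPoly ε s h).leadingCoeff = 4 := by
  have h1 := degree_spectralPoly_sub_lt ε s h
  have h2 : ((C 2 * X * poleProd ε) ^ 2).natDegree = 2 * n + 2 := by
    rw [natDegree_pow, mul_assoc, natDegree_C_mul two_ne_zero,
      natDegree_X_mul (poleProd_monic ε).ne_zero, natDegree_poleProd]
    ring
  have h3 : ((C 2 * X * poleProd ε) ^ 2).leadingCoeff = 4 := by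
    rw [leadingCoeff_pow, leadingCoeff_mul, (poleProd_monic ε).leadingCoeff]
    simp; norm_num
  have h0 : (C 2 * X * poleProd ε) ^ 2 ≠ 0 := by rw [← leadingCoeff_ne_zero, h3]; norm_num
  have hlt : (spectralPoly ε s h - (C 2 * X * poleProd ε) ^ 2).degree
      < ((C 2 * X * poleProd ε) ^ 2).degree := by
    rw [degree_eq_natDegree h0, h2]
    exact h1.trans (by exact_mod_cast Nat.lt_succ_self _)
  have he : spectralPoly ε s h = (C 2 * X * poleProd ε) ^ 2
      + (spectralPoly ε s h - (C 2 * X * poleProd ε) ^ 2) := by ring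
  rw [he]
  exact ⟨by rw [natDegree_add_eq_left_of_degree_lt hlt, h2],
    by rw [leadingCoeff_add_of_degree_lt' hlt, h3]⟩

lemma spectralPoly_ne_zero (ε : Fin n → ℝ) (s : ℝ) (h : Fin (n + 1) → ℝ) :
    spectralPoly ε s h ≠ 0 := by
  rw [← leadingCoeff_ne_zero, (leadingTerm_spectralPoly ε s h).2]; norm_num

lemma leadingTerm_cofactor {ε : Fin n → ℝ} {s : ℝ} {h : Fin (n + 1) → ℝ} {a b : ℝ[X]} {r : ℕ}
    (ha : a.Monic) (hdeg : a.natDegree + r = n + 1) (hQ : spectralPoly ε s h = a ^ 2 * b) :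
    b.natDegree = 2 * r ∧ b.leadingCoeff = 4 := by
  have hb0 : b ≠ 0 := by rintro rfl; exact spectralPoly_ne_zero ε s h (by rw [hQ, mul_zero])
  obtain ⟨h1, h2⟩ := leadingTerm_spectralPoly ε s h
  rw [hQ, (ha.pow 2).natDegree_mul' hb0, natDegree_pow] at h1
  rw [hQ, leadingCoeff_mul, (ha.pow 2).leadingCoeff, one_mul] at h2
  exact ⟨by omega, h2⟩

/-- If the spectral polynomial is `a ^ 2 * (p ^ 2 + q ^ 2)`, there is a point over it with
`A = a p` and `B = C = a q` up to the common denominator. -/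
lemma exists_laxVec_eq {ε : Fin n → ℝ} (hε : Function.Injective ε) {s : ℝ}
    {h : Fin (n + 1) → ℝ} {a p q : ℝ[X]} {r : ℕ} (ha : a.Monic)
    (hdeg : a.natDegree + r = n + 1) (hp : p.natDegree = r) (hpl : p.leadingCoeff = 2)
    (hq : q.degree < r) (hQ : spectralPoly ε s h = a ^ 2 * (p ^ 2 + q ^ 2)) :
    ∃ x ∈ phaseSpace n s, momentMap ε x = h ∧ ∀ i, laxVec ε x i = a * ![q, 0, p] i := by
  have hp0 : p ≠ 0 := by rintro rfl; simp at hpl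
  have haq : (a * q).degree < (n + 1 : ℕ) := by
    rw [degree_mul_lt_iff ha.ne_zero, (by omega : n + 1 - a.natDegree = r)]; exact hq
  have hap : (a * p).natDegree = n + 1 ∧ (a * p).leadingCoeff = 2 := by
    rw [ha.natDegree_mul' hp0, leadingCoeff_mul, ha.leadingCoeff, one_mul]
    exact ⟨by omega, hpl⟩
  have hXP : (C 2 * X * poleProd ε).natDegree = n + 1 ∧
      (C 2 * X * poleProd ε).leadingCoeff = 2 := by
    rw [mul_assoc, natDegree_C_mul two_ne_zero, natDegree_X_mul (poleProd_monic ε).ne_zero,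
      natDegree_poleProd, leadingCoeff_mul, leadingCoeff_mul, (poleProd_monic ε).leadingCoeff]
    simp
  have hlead : (a * p + C 2 * X * poleProd ε).leadingCoeff = 4 ∧
      (a * p + C 2 * X * poleProd ε).natDegree = n + 1 := by
    have hc : (a * p + C 2 * X * poleProd ε).coeff (n + 1) = 4 := by
      have h1 := hap.2
      have h2 := hXP.2
      rw [leadingCoeff, hap.1] at h1
      rw [leadingCoeff, hXP.1] at h2
      rw [coeff_add, h1, h2]; norm_num
    have hd : (a * p + C 2 * X * poleProd ε).natDegree = n + 1 := by
      refine le_antisymm ((natDegree_add_le _ _).trans (by rw [hap.1, hXP.1, max_self])) ?_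
      exact le_natDegree_of_ne_zero (by rw [hc]; norm_num)
    exact ⟨by rw [leadingCoeff, hd, hc], hd⟩
  -- `(a p)² - (2 X P)²` has degree at most `2 n`, and its factor `a p + 2 X P` has degree `n + 1`
  have hD : (a * p - C 2 * X * poleProd ε).degree < (n : WithBot ℕ) := by
    have h1 : ((a * p + C 2 * X * poleProd ε) * (a * p - C 2 * X * poleProd ε)).degree
        < ((2 * n + 1 : ℕ) : WithBot ℕ) := by
      rw [(by rw [hQ]; ring : (a * p + C 2 * X * poleProd ε) * (a * p - C 2 * X * poleProd ε)
        = (spectralPoly ε s h - (C 2 * X * poleProd ε) ^ 2) - (a * q) ^ 2), ← mem_degreeLT]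
      refine Submodule.sub_mem _ (mem_degreeLT.2 (degree_spectralPoly_sub_lt ε s h))
        (mem_degreeLT.2 ?_)
      rcases eq_or_ne (a * q) 0 with h0 | h0
      · rw [h0, zero_pow two_ne_zero, degree_zero]; exact WithBot.bot_lt_coe _
      · rw [sq, degree_mul_lt_iff h0]
        refine haq.trans_le ?_
        rw [degree_eq_natDegree h0] at haq
        norm_cast at haq ⊢
        omega
    rw [degree_mul_lt_iff (by rw [← leadingCoeff_ne_zero, hlead.1]; norm_num), hlead.2] at h1
    rwa [(by omega : 2 * n + 1 - (n + 1) = n)] at h1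
  obtain ⟨x, x0, x1, x2⟩ := exists_laxDir_eq hε haq
    (by simp [bot_lt_iff_ne_bot] : (0 : ℝ[X]).degree < (n + 1 : ℕ)) hD
  have hL : ∀ i, laxVec ε x i = a * ![q, 0, p] i := by
    intro i
    fin_cases i
    · exact (laxVec_zero ε x).trans x0
    · exact ((laxVec_one ε x).trans x1).trans (mul_zero a).symm
    · exact (laxVec_two ε x).trans (by rw [x2]; simp)
  have hsum : ∑ i, laxVec ε x i ^ 2 = spectralPoly ε s h := by
    rw [Fin.sum_univ_three, hL, hL, hL, hQ]
    simp
    ring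
  -- the residues at the poles determine the spin lengths
  have hx : x ∈ phaseSpace n s := by
    intro j
    have h1 := congrArg (eval (ε j)) hsum
    simp only [eval_spectralPoly_pole, eval_finsetSum, eval_pow, eval_laxVec_pole, mul_pow] at h1
    rw [← Finset.sum_mul] at h1
    rw [dotProduct, ← mul_right_cancel₀ (pow_ne_zero 2 (eval_poleProdErase_self_ne_zero hε j)) h1]
    exact Finset.sum_congr rfl fun i _ => (sq _).symm
  exact ⟨x, hx, spectralPoly_injective hε s (by rw [spectralPoly_momentMap hε hx, hsum]), hL⟩

/-- Over `a ^ 2 * b` with `b` free of real roots there is a point whose Lax vector has greatest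
common divisor exactly `a`. -/
lemma exists_momentRank_eq {ε : Fin n → ℝ} (hε : Function.Injective ε) {s : ℝ} (hs : 0 < s)
    {h : Fin (n + 1) → ℝ} {a b : ℝ[X]} {r : ℕ} (ha : a.Monic) (hdeg : a.natDegree + r = n + 1)
    (hb : ∀ t : ℝ, b.eval t ≠ 0) (hQ : spectralPoly ε s h = a ^ 2 * b) :
    ∃ x ∈ phaseSpace n s, momentMap ε x = h ∧ momentRank ε x = r := by
  obtain ⟨h1, h2⟩ := leadingTerm_cofactor ha hdeg hQ
  obtain ⟨p, q, hpq, hp, hpl, hq, u, v, huv⟩ := exists_sq_add_sq h1 h2 hb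
  obtain ⟨x, hx, hxh, hL⟩ := exists_laxVec_eq hε ha hdeg hp hpl hq (hpq ▸ hQ)
  have hd : IsLaxGCD ε x a ![q, 0, p] ![v, 0, u] :=
    ⟨ha, hL, by rw [Fin.sum_univ_three, ← huv]; simp; ring⟩
  have := hd.momentRank_add hε hs hx
  exact ⟨x, hx, hxh, by omega⟩

lemma mem_rankImage_iff {ε : Fin n → ℝ} (hε : Function.Injective ε) {s : ℝ} (hs : 0 < s)
    (r : ℕ) (h : Fin (n + 1) → ℝ) :
    h ∈ rankImage ε s r ↔
      ∃ a b : ℝ[X], a.Monic ∧ a.natDegree + r = n + 1 ∧ b.natDegree = 2 * r ∧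
        (∀ t : ℝ, b.eval t ≠ 0) ∧ spectralPoly ε s h = a ^ 2 * b := by
  constructor
  · rintro ⟨x, ⟨hx, rfl⟩, rfl⟩
    obtain ⟨d, c, u, hd⟩ := exists_isLaxGCD ε x
    have hdeg := hd.momentRank_add hε hs hx
    have hQ := (spectralPoly_momentMap hε hx).trans hd.sum_sq
    exact ⟨d, _, hd.monic, hdeg, (leadingTerm_cofactor hd.monic hdeg hQ).1,
      hd.eval_sum_sq_ne_zero, hQ⟩
  · rintro ⟨a, b, ha, hdeg, -, hb, hQ⟩
    obtain ⟨x, hx, hxh, hr⟩ := exists_momentRank_eq hε hs ha hdeg hb hQ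
    exact ⟨x, ⟨hx, hr⟩, hxh⟩

/-! ### The fibre over a spectral polynomial -/

lemma IsLaxGCD.dvd_of_squarefree {ε : Fin n → ℝ} (hε : Function.Injective ε) {s : ℝ}
    {x : Ambient n} (hx : x ∈ phaseSpace n s) {d : ℝ[X]} {c u : Fin 3 → ℝ[X]}
    (hd : IsLaxGCD ε x d c u) {a b : ℝ[X]} (ha : a.Monic) (hb : Squarefree b)
    (hQ : spectralPoly ε s (momentMap ε x) = a ^ 2 * b) : d ∣ a := by
  refine dvd_of_sq_dvd_sq_mul_squarefree ha.ne_zero hb ?_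
  rw [← hQ, spectralPoly_momentMap hε hx, hd.sum_sq]
  exact dvd_mul_right _ _

lemma le_momentRank {ε : Fin n → ℝ} (hε : Function.Injective ε) {s : ℝ} (hs : 0 < s)
    {x : Ambient n} (hx : x ∈ phaseSpace n s) {a b : ℝ[X]} {r : ℕ} (ha : a.Monic)
    (hdeg : a.natDegree + r = n + 1) (hb : Squarefree b)
    (hQ : spectralPoly ε s (momentMap ε x) = a ^ 2 * b) : r ≤ momentRank ε x := by
  obtain ⟨d, c, u, hd⟩ := exists_isLaxGCD ε x
  have h1 := hd.momentRank_add hε hs hx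
  have h2 := natDegree_le_of_dvd (hd.dvd_of_squarefree hε hx ha hb hQ) ha.ne_zero
  omega

lemma momentRank_eq_iff {ε : Fin n → ℝ} (hε : Function.Injective ε) {s : ℝ} (hs : 0 < s)
    {x : Ambient n} (hx : x ∈ phaseSpace n s) {a b : ℝ[X]} {r : ℕ} (ha : a.Monic)
    (hdeg : a.natDegree + r = n + 1) (hb : Squarefree b)
    (hQ : spectralPoly ε s (momentMap ε x) = a ^ 2 * b) :
    momentRank ε x = r ↔ ∀ i, a ∣ laxVec ε x i := by
  obtain ⟨d, c, u, hd⟩ := exists_isLaxGCD ε x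
  have h1 := hd.momentRank_add hε hs hx
  have h2 := hd.dvd_of_squarefree hε hx ha hb hQ
  constructor
  · intro hr
    have : a = d := eq_of_monic_of_dvd_of_natDegree_le hd.monic ha h2 (by omega)
    exact fun i => ⟨c i, this ▸ hd.eq_mul i⟩
  · intro h
    have h3 := natDegree_le_of_dvd (hd.dvd_of_forall_dvd h) hd.monic.ne_zero
    have h4 := natDegree_le_of_dvd h2 ha.ne_zero
    omega

/-- For squarefree `b` the common divisor of the Lax vector divides `a` at every point of the fibre
over `a ^ 2 * b`, so that `r = n + 1 - deg a` is a lower bound of the rank, and it is attained. -/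
lemma isLeast_momentRank {ε : Fin n → ℝ} (hε : Function.Injective ε) {s : ℝ}
    (hs : 0 < s) {x : Ambient n} (hx : x ∈ phaseSpace n s) {a b : ℝ[X]} {r : ℕ} (ha : a.Monic)
    (hdeg : a.natDegree + r = n + 1) (hb : Squarefree b)
    (hQ : spectralPoly ε s (momentMap ε x) = a ^ 2 * b) :
    IsLeast (momentRank ε '' {y | y ∈ phaseSpace n s ∧ momentMap ε y = momentMap ε x}) r := by
  constructor
  · obtain ⟨d, c, u, hd⟩ := exists_isLaxGCD ε x
    obtain ⟨e, rfl⟩ := hd.dvd_of_squarefree hε hx ha hb hQ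
    have hc : ∑ i, c i ^ 2 = e ^ 2 * b := by
      refine mul_left_cancel₀ (pow_ne_zero 2 hd.monic.ne_zero) ?_
      rw [← hd.sum_sq, ← spectralPoly_momentMap hε hx, hQ]; ring
    have hreal : ∀ t : ℝ, b.eval t ≠ 0 := fun t h0 => hd.eval_sum_sq_ne_zero t (by
      rw [hc, eval_mul, h0, mul_zero])
    obtain ⟨y, hy, hyx, hr⟩ := exists_momentRank_eq hε hs ha hdeg hreal hQ
    exact ⟨y, ⟨hy, hyx⟩, hr⟩
  · rintro _ ⟨y, ⟨hy, hyx⟩, rfl⟩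
    exact le_momentRank hε hs hy ha hdeg hb (hyx ▸ hQ)

lemma mem_stratum_iff {ε : Fin n → ℝ} (hε : Function.Injective ε) {s : ℝ} (hs : 0 < s)
    (r : ℕ) (h : Fin (n + 1) → ℝ) :
    h ∈ stratum ε s r ↔ h ∈ momentMap ε '' phaseSpace n s ∧
      ∃ a b : ℝ[X], a.Monic ∧ a.natDegree + r = n + 1 ∧ b.natDegree = 2 * r ∧
        Squarefree b ∧ spectralPoly ε s h = a ^ 2 * b := by
  constructor
  · intro hr
    obtain ⟨x, ⟨hx, rfl⟩, -⟩ := hr.1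
    obtain ⟨a, b, ha, hb, hQ⟩ := exists_monic_sq_mul_squarefree _
      (spectralPoly_ne_zero ε s (momentMap ε x))
    have hle : a.natDegree ≤ n + 1 := by
      have h1 := natDegree_le_of_dvd (Dvd.intro _ hQ.symm) (spectralPoly_ne_zero ε s _)
      rw [natDegree_pow, (leadingTerm_spectralPoly ε s _).1] at h1
      omega
    have hdeg : a.natDegree + (n + 1 - a.natDegree) = n + 1 := by omega
    have := (isLeast_momentRank hε hs hx ha hdeg hb hQ).unique hr
    rw [this] at hdeg
    exact ⟨⟨x, hx, rfl⟩, a, b, ha, hdeg, (leadingTerm_cofactor ha hdeg hQ).1, hb, hQ⟩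
  · rintro ⟨⟨x, hx, rfl⟩, a, b, ha, hdeg, -, hb, hQ⟩
    exact isLeast_momentRank hε hs hx ha hdeg hb hQ

/-! ### The Lax matrix and its common zeros -/

lemma eval_map_poleProd (ε : Fin n → ℝ) (z : ℂ) :
    ((poleProd ε).map (algebraMap ℝ ℂ)).eval z = ∏ j, (z - ε j) := by
  simp [poleProd, Polynomial.map_prod, eval_prod]

lemma eval_map_poleProdErase (ε : Fin n → ℝ) (z : ℂ) (j : Fin n) :
    (z - ε j) * ((poleProdErase ε j).map (algebraMap ℝ ℂ)).eval z = ∏ j, (z - ε j) := by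
  rw [← eval_map_poleProd, ← X_sub_mul_poleProdErase ε j]
  simp

lemma sum_div_mul_prod (ε : Fin n → ℝ) (u : Fin n → ℂ) {z : ℂ} (hz : ∀ j, z ≠ ε j) :
    (∑ j, u j / (z - ε j)) * ∏ j, (z - ε j)
      = (∑ j, C (u j) * (poleProdErase ε j).map (algebraMap ℝ ℂ)).eval z := by
  rw [Finset.sum_mul, eval_finsetSum]
  refine Finset.sum_congr rfl fun j _ => ?_
  have h : z - ε j ≠ 0 := sub_ne_zero.2 (hz j)
  rw [eval_mul, eval_C, ← eval_map_poleProdErase ε z j]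
  field_simp

lemma laxA_mul_prod (ε : Fin n → ℝ) (x : Ambient n) {z : ℂ} (hz : ∀ j, z ≠ ε j) :
    laxA ε x z * ∏ j, (z - ε j) = (numA ε x).eval z := by
  rw [laxA, add_mul, sum_div_mul_prod ε _ hz, numA, eval_add, eval_mul, eval_map_poleProd]
  simp

lemma laxB_mul_prod (ε : Fin n → ℝ) (x : Ambient n) {z : ℂ} (hz : ∀ j, z ≠ ε j) :
    laxB ε x z * ∏ j, (z - ε j) = (numB ε x).eval z := by
  rw [laxB, add_mul, sum_div_mul_prod ε _ hz, numB, eval_add, eval_mul, eval_map_poleProd]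
  simp

lemma laxC_mul_prod (ε : Fin n → ℝ) (x : Ambient n) {z : ℂ} (hz : ∀ j, z ≠ ε j) :
    laxC ε x z * ∏ j, (z - ε j) = (numC ε x).eval z := by
  rw [laxC, add_mul, sum_div_mul_prod ε _ hz, numC, eval_add, eval_mul, eval_map_poleProd]
  simp

lemma numA_sq_add (ε : Fin n → ℝ) (x : Ambient n) :
    numA ε x ^ 2 + numB ε x * numC ε x = (∑ i, laxVec ε x i ^ 2).map (algebraMap ℝ ℂ) := by
  have hI : (C Complex.I : ℂ[X]) ^ 2 = -1 := by rw [← C_pow, Complex.I_sq]; simp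
  rw [numA_eq, numB_eq, numC_eq, Fin.sum_univ_three]
  simp only [Polynomial.map_add, Polynomial.map_pow]
  linear_combination -(map (algebraMap ℝ ℂ) (laxVec ε x 1)) ^ 2 * hI

lemma numA_sq_add_eq_spectralPoly {ε : Fin n → ℝ} (hε : Function.Injective ε) {s : ℝ}
    {x : Ambient n} (hx : x ∈ phaseSpace n s) (z : ℂ) :
    (numA ε x).eval z ^ 2 + (numB ε x).eval z * (numC ε x).eval z
      = aeval z (spectralPoly ε s (momentMap ε x)) := by
  rw [← eval_map_algebraMap, spectralPoly_momentMap hε hx, ← numA_sq_add]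
  simp

lemma half_trace_lax_sq {ε : Fin n → ℝ} (hε : Function.Injective ε) {s : ℝ} {x : Ambient n}
    (hx : x ∈ phaseSpace n s) {z : ℂ} (hz : ∀ j, z ≠ ε j) :
    (1 / 2) * (lax ε x z ^ 2).trace
      = (spectralPoly ε s (momentMap ε x)).aeval z / ∏ j, (z - ε j) ^ 2 := by
  have h0 : ∏ j, (z - ε j) ^ 2 ≠ 0 :=
    Finset.prod_ne_zero_iff.2 fun j _ => pow_ne_zero 2 (sub_ne_zero.2 (hz j))
  rw [eq_div_iff h0, ← numA_sq_add_eq_spectralPoly hε hx, ← laxA_mul_prod ε x hz,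
    ← laxB_mul_prod ε x hz, ← laxC_mul_prod ε x hz, Finset.prod_pow, sq (lax ε x z)]
  simp only [lax, trace_fin_two, mul_apply, Fin.sum_univ_two, of_apply, cons_val', cons_val_zero,
    cons_val_one, cons_val_fin_one]
  ring

lemma num_eval_eq_zero_iff (ε : Fin n → ℝ) (x : Ambient n) (z : ℂ) :
    ((numA ε x).eval z = 0 ∧ (numB ε x).eval z = 0 ∧ (numC ε x).eval z = 0)
      ↔ ∀ i, aeval z (laxVec ε x i) = 0 := by
  simp only [numA_eq, numB_eq, numC_eq, eval_add, eval_sub, eval_mul, eval_C, eval_map_algebraMap]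
  constructor
  · rintro ⟨h2, hB, hC⟩
    have h0 : aeval z (laxVec ε x 0) = 0 := by linear_combination (hB + hC) / 2
    have h1 : aeval z (laxVec ε x 1) = 0 := by
      linear_combination (-Complex.I / 2) * (hC - hB) + aeval z (laxVec ε x 1) * Complex.I_sq
    intro i
    fin_cases i
    exacts [h0, h1, h2]
  · intro h
    simp [h]

lemma lax_eq_zero_iff (ε : Fin n → ℝ) (x : Ambient n) {z : ℂ} (hz : ∀ j, z ≠ ε j) :
    (laxA ε x z = 0 ∧ laxB ε x z = 0 ∧ laxC ε x z = 0)
      ↔ ∀ i, aeval z (laxVec ε x i) = 0 := by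
  have h0 : ∏ j, (z - ε j) ≠ 0 := Finset.prod_ne_zero_iff.2 fun j _ => sub_ne_zero.2 (hz j)
  rw [← num_eval_eq_zero_iff, ← laxA_mul_prod ε x hz, ← laxB_mul_prod ε x hz,
    ← laxC_mul_prod ε x hz]
  simp [h0]

lemma aeval_ofReal_eq_zero_iff (f : ℝ[X]) (t : ℝ) : aeval (t : ℂ) f = 0 ↔ f.eval t = 0 := by
  have : aeval (t : ℂ) f = ((f.eval t : ℝ) : ℂ) := aeval_algebraMap_apply ℂ t f
  rw [this, Complex.ofReal_eq_zero]

lemma lax_ofReal_eq_zero_iff (ε : Fin n → ℝ) (x : Ambient n) {E : ℝ} (hE : ∀ j, E ≠ ε j) :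
    (laxA ε x E = 0 ∧ laxB ε x E = 0 ∧ laxC ε x E = 0) ↔ ∀ i, (laxVec ε x i).eval E = 0 := by
  rw [lax_eq_zero_iff ε x fun j => by exact_mod_cast hE j]
  simp only [aeval_ofReal_eq_zero_iff]

lemma map_dvd_num_iff (ε : Fin n → ℝ) (x : Ambient n) (a : ℝ[X]) :
    (a.map (algebraMap ℝ ℂ) ∣ numA ε x ∧ a.map (algebraMap ℝ ℂ) ∣ numB ε x ∧
      a.map (algebraMap ℝ ℂ) ∣ numC ε x) ↔ ∀ i, a ∣ laxVec ε x i := by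
  have hI : (C Complex.I : ℂ[X]) ^ 2 = -1 := by rw [← C_pow, Complex.I_sq]; simp
  have h2 : (C (1 / 2) * C 2 : ℂ[X]) = 1 := by rw [← C_mul]; norm_num
  have hC2 : (C 2 : ℂ[X]) = 2 := rfl
  rw [hC2] at h2
  constructor
  · rintro ⟨hA, hB, hC⟩
    have h0 : a.map (algebraMap ℝ ℂ) ∣ (laxVec ε x 0).map (algebraMap ℝ ℂ) := by
      have : (laxVec ε x 0).map (algebraMap ℝ ℂ) = C (1 / 2) * (numB ε x + numC ε x) := by
        rw [numB_eq, numC_eq]; linear_combination -map (algebraMap ℝ ℂ) (laxVec ε x 0) * h2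
      rw [this]
      exact (hB.add hC).mul_left _
    have h1 : a.map (algebraMap ℝ ℂ) ∣ (laxVec ε x 1).map (algebraMap ℝ ℂ) := by
      have : (laxVec ε x 1).map (algebraMap ℝ ℂ)
          = C Complex.I * C (1 / 2) * (numB ε x - numC ε x) := by
        rw [numB_eq, numC_eq]
        linear_combination -map (algebraMap ℝ ℂ) (laxVec ε x 1) * h2
          + map (algebraMap ℝ ℂ) (laxVec ε x 1) * (C (1 / 2) * 2) * hI
      rw [this]
      exact (dvd_sub hB hC).mul_left _
    intro i
    rw [← map_dvd_map' (algebraMap ℝ ℂ)]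
    fin_cases i
    exacts [h0, h1, numA_eq ε x ▸ hA]
  · intro h
    have h' := fun i => (map_dvd_map' (algebraMap ℝ ℂ)).2 (h i)
    rw [numA_eq, numB_eq, numC_eq]
    exact ⟨h' 2, dvd_sub (h' 0) ((h' 1).mul_left _), (h' 0).add ((h' 1).mul_left _)⟩

/-! ### A real double root of the spectral polynomial -/

lemma ne_pole_of_isRoot {ε : Fin n → ℝ} (hε : Function.Injective ε) {s : ℝ} (hs : 0 < s)
    {h : Fin (n + 1) → ℝ} {E : ℝ} (hE : (spectralPoly ε s h).eval E = 0) (j : Fin n) :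
    E ≠ ε j := by
  rintro rfl
  exact eval_spectralPoly_pole_ne_zero hε hs h j hE

lemma laxVec_eval_eq_zero {ε : Fin n → ℝ} (hε : Function.Injective ε) {s : ℝ} {x : Ambient n}
    (hx : x ∈ phaseSpace n s) {E : ℝ} (hE : (spectralPoly ε s (momentMap ε x)).eval E = 0)
    (i : Fin 3) : (laxVec ε x i).eval E = 0 := by
  rw [spectralPoly_momentMap hε hx] at hE
  simp only [eval_finsetSum, eval_pow] at hE
  have := (Finset.sum_eq_zero_iff_of_nonneg (fun i _ => sq_nonneg _)).1 hE i (Finset.mem_univ i)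
  exact pow_eq_zero_iff two_ne_zero |>.1 this

section DoubleRoot

variable {ε : Fin n → ℝ} {s : ℝ} {x : Ambient n} {E : ℝ} {Qt d : ℝ[X]} {c u : Fin 3 → ℝ[X]}

lemma eval_spectralPoly_doubleRoot {h : Fin (n + 1) → ℝ}
    (hQ : spectralPoly ε s h = (X - C E) ^ 2 * Qt) : (spectralPoly ε s h).eval E = 0 := by
  rw [hQ]; simp

lemma IsLaxGCD.X_sub_C_dvd (hd : IsLaxGCD ε x d c u) (hε : Function.Injective ε)
    (hx : x ∈ phaseSpace n s)
    (hQ : spectralPoly ε s (momentMap ε x) = (X - C E) ^ 2 * Qt) : X - C E ∣ d :=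
  hd.dvd_of_forall_dvd fun i =>
    dvd_iff_isRoot.2 (laxVec_eval_eq_zero hε hx (eval_spectralPoly_doubleRoot hQ) i)

lemma IsLaxGCD.quotient_eq (hd : IsLaxGCD ε x ((X - C E) * d) c u) (hε : Function.Injective ε)
    (hx : x ∈ phaseSpace n s)
    (hQ : spectralPoly ε s (momentMap ε x) = (X - C E) ^ 2 * Qt) : Qt = d ^ 2 * ∑ i, c i ^ 2 := by
  refine mul_left_cancel₀ (pow_ne_zero 2 (X_sub_C_ne_zero E)) ?_
  rw [← hQ, spectralPoly_momentMap hε hx, hd.sum_sq]; ring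

lemma momentRank_le_of_doubleRoot (hε : Function.Injective ε) (hs : 0 < s)
    (hx : x ∈ phaseSpace n s)
    (hQ : spectralPoly ε s (momentMap ε x) = (X - C E) ^ 2 * Qt) : momentRank ε x ≤ n := by
  obtain ⟨d, c, u, hd⟩ := exists_isLaxGCD ε x
  have h1 := hd.momentRank_add hε hs hx
  have h2 := natDegree_le_of_dvd (hd.X_sub_C_dvd hε hx hQ) hd.monic.ne_zero
  rw [natDegree_X_sub_C] at h2
  omega

lemma momentRank_eq_of_squarefree (hε : Function.Injective ε) (hs : 0 < s)
    (hx : x ∈ phaseSpace n s)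
    (hQ : spectralPoly ε s (momentMap ε x) = (X - C E) ^ 2 * Qt) (hsq : Squarefree Qt) :
    momentRank ε x = n := by
  obtain ⟨d, c, u, hd⟩ := exists_isLaxGCD ε x
  obtain ⟨e, rfl⟩ := hd.X_sub_C_dvd hε hx hQ
  have h1 := hd.momentRank_add hε hs hx
  have he : IsUnit e := hsq e (by
    rw [hd.quotient_eq hε hx hQ, ← sq]; exact dvd_mul_right _ _)
  rw [natDegree_mul (X_sub_C_ne_zero E) he.ne_zero, natDegree_X_sub_C,
    natDegree_eq_zero_of_isUnit he] at h1
  omega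

lemma momentRank_eq_iff_of_doubleRoot (hε : Function.Injective ε) (hs : 0 < s)
    (hx : x ∈ phaseSpace n s)
    (hQ : spectralPoly ε s (momentMap ε x) = (X - C E) ^ 2 * Qt) :
    momentRank ε x = n ↔ Qt.eval E ≠ 0 ∧ ∀ z : ℂ, (∀ j, z ≠ ε j) →
      laxA ε x z = 0 → laxB ε x z = 0 → laxC ε x z = 0 → z = E := by
  obtain ⟨d, c, u, hd⟩ := exists_isLaxGCD ε x
  obtain ⟨e, rfl⟩ := hd.X_sub_C_dvd hε hx hQ
  have h1 := hd.momentRank_add hε hs hx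
  have he0 : e ≠ 0 := right_ne_zero_of_mul hd.monic.ne_zero
  have hem : e.Monic := (monic_X_sub_C E).of_mul_monic_left hd.monic
  rw [natDegree_mul (X_sub_C_ne_zero E) he0, natDegree_X_sub_C] at h1
  have hq := hd.quotient_eq hε hx hQ
  have hdpole := hd.eval_pole_ne_zero hε hs hx
  constructor
  · intro hr
    have he1 : e = 1 := hem.natDegree_eq_zero.1 (by omega)
    subst he1
    refine ⟨by rw [hq]; simpa using hd.eval_sum_sq_ne_zero E, fun z hz hA hB hC => ?_⟩
    have hL := (lax_eq_zero_iff ε x hz).1 ⟨hA, hB, hC⟩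
    have hb := congrArg (aeval z) hd.bezout
    rw [map_sum, map_one] at hb
    by_contra hne
    have hc : ∀ i, aeval z (c i) = 0 := fun i => by
      have := hL i
      rw [hd.eq_mul i] at this
      simpa [sub_eq_zero, hne] using this
    simp [hc] at hb
  · rintro ⟨hQt, hz⟩
    suffices e.natDegree = 0 by omega
    by_contra hne
    obtain ⟨z, hze⟩ := IsAlgClosed.exists_aeval_eq_zero ℂ e (fun h =>
      hne (natDegree_eq_zero_iff_degree_le_zero.2 h.le))
    have hzε : ∀ j, z ≠ ε j := by
      rintro j rfl
      refine hdpole j ?_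
      rw [eval_mul, (aeval_ofReal_eq_zero_iff e (ε j)).1 hze, mul_zero]
    have hL : ∀ i, aeval z (laxVec ε x i) = 0 := fun i => by
      rw [hd.eq_mul i, map_mul, map_mul, hze, mul_zero, zero_mul]
    obtain ⟨hA, hB, hC⟩ := (lax_eq_zero_iff ε x hzε).2 hL
    have hzE := hz z hzε hA hB hC
    subst hzE
    refine hQt ?_
    rw [hq, eval_mul, eval_pow, (aeval_ofReal_eq_zero_iff e E).1 hze]
    ring

end DoubleRoot

/-! ### Hamiltonian vector fields -/

/-- A directional derivative is the linear coefficient along a line on which the function is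
quadratic. -/
lemma fderiv_apply_of_quadratic {V : Type*} [NormedAddCommGroup V] [NormedSpace ℝ V] {f : V → ℝ}
    {x v : V} {c₀ c₁ c₂ : ℝ} (hf : DifferentiableAt ℝ f x)
    (h : ∀ t : ℝ, f (x + t • v) = c₀ + t * c₁ + t ^ 2 * c₂) : fderiv ℝ f x v = c₁ := by
  have h1 : HasDerivAt (fun t : ℝ => f (x + t • v)) (fderiv ℝ f x v) 0 := by
    have h1 : HasDerivAt (fun t : ℝ => x + t • v) v 0 := by
      simpa using ((hasDerivAt_id (0 : ℝ)).smul_const v).const_add x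
    have h2 : HasFDerivAt f (fderiv ℝ f x) (x + (0 : ℝ) • v) := by simpa using hf.hasFDerivAt
    exact h2.comp_hasDerivAt 0 h1
  have h2 : HasDerivAt (fun t : ℝ => c₀ + t * c₁ + t ^ 2 * c₂) c₁ 0 := by
    have := (((hasDerivAt_id (0 : ℝ)).mul_const c₁).const_add c₀).add
      (((hasDerivAt_id (0 : ℝ)).pow 2).mul_const c₂)
    convert! this using 1
    simp
  rw [funext h] at h1
  exact h1.unique h2

lemma fderiv_spinHam (ε : Fin n → ℝ) (i : Fin n) (x v : Ambient n) :
    fderiv ℝ (spinHam ε i) x v = 2 * ε i * v.2 i 2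
      + ∑ a, (oscVec v a * x.2 i a + oscVec x a * v.2 i a)
      + ∑ k, (v.2 i ⬝ᵥ x.2 k + x.2 i ⬝ᵥ v.2 k) / (ε i - ε k) := by
  refine fderiv_apply_of_quadratic (c₀ := spinHam ε i x)
    (c₂ := ∑ a, oscVec v a * v.2 i a + ∑ k, (v.2 i ⬝ᵥ v.2 k) / (ε i - ε k))
    (differentiable_spinHam ε i x) fun t => ?_
  simp only [spinHam_eq, oscVec_add, oscVec_smul, Prod.snd_add, Prod.smul_snd, Pi.add_apply,
    Pi.smul_apply, smul_eq_mul, dotProduct_add, add_dotProduct, dotProduct_smul, smul_dotProduct,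
    mul_add, Finset.mul_sum]
  have h1 : ∀ k, (x.2 i ⬝ᵥ x.2 k + t * v.2 i ⬝ᵥ x.2 k + (t * x.2 i ⬝ᵥ v.2 k
      + t * (t * v.2 i ⬝ᵥ v.2 k))) / (ε i - ε k) = (x.2 i ⬝ᵥ x.2 k) / (ε i - ε k)
      + t * ((v.2 i ⬝ᵥ x.2 k + x.2 i ⬝ᵥ v.2 k) / (ε i - ε k))
      + t ^ 2 * ((v.2 i ⬝ᵥ v.2 k) / (ε i - ε k)) := fun k => by ring
  simp only [h1, Fin.sum_univ_three, Finset.sum_add_distrib, ← Finset.mul_sum]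
  ring

lemma fderiv_totalHam (x v : Ambient n) :
    fderiv ℝ (totalHam (n := n)) x v
      = (∑ a, oscVec x a * oscVec v a) / 2 + ∑ j, v.2 j 2 := by
  refine fderiv_apply_of_quadratic (c₀ := totalHam x)
    (c₂ := (∑ a, oscVec v a ^ 2) / 4) (differentiable_totalHam x) fun t => ?_
  refine mul_left_cancel₀ four_ne_zero ?_
  rw [totalHam_eq, mul_add, mul_add, totalHam_eq]
  simp only [oscVec_add, oscVec_smul, Prod.snd_add, Prod.smul_snd, Pi.add_apply,
    Pi.smul_apply, smul_eq_mul, Fin.sum_univ_three, Finset.sum_add_distrib, ← Finset.mul_sum]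
  ring

lemma fderiv_re (x v : Ambient n) : fderiv ℝ (fun y : Ambient n => y.1.re) x v = v.1.re :=
  fderiv_apply_of_quadratic (c₀ := x.1.re) (c₂ := 0) (differentiable_re x) fun t => by simp

lemma fderiv_im (x v : Ambient n) : fderiv ℝ (fun y : Ambient n => y.1.im) x v = v.1.im :=
  fderiv_apply_of_quadratic (c₀ := x.1.im) (c₂ := 0) (differentiable_im x) fun t => by simp

lemma fderiv_spin (j : Fin n) (a : Fin 3) (x v : Ambient n) :
    fderiv ℝ (fun y : Ambient n => y.2 j a) x v = v.2 j a :=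
  fderiv_apply_of_quadratic (c₀ := x.2 j a) (c₂ := 0) (differentiable_spin j a x) fun t => by simp

lemma oscVec_hamField (H : Ambient n → ℝ) (x : Ambient n) :
    oscVec (hamField H x) = ![fderiv ℝ H x (Complex.I, 0), fderiv ℝ H x (1, 0), 0] := by
  have h1 : ∀ j, spinGrad (fun y : Ambient n => y.1.re) x j = 0 := fun j => by
    funext a; simp [spinGrad, fderiv_re]
  have h2 : ∀ j, spinGrad (fun y : Ambient n => y.1.im) x j = 0 := fun j => by
    funext a; simp [spinGrad, fderiv_im]
  simp [oscVec, hamField, poisson, fderiv_re, fderiv_im, h1, h2]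

/-- A spin precesses about the gradient of the Hamiltonian. -/
lemma hamField_spin (H : Ambient n → ℝ) (x : Ambient n) (j : Fin n) :
    (hamField H x).2 j = spinGrad H x j ⨯₃ x.2 j := by
  funext a
  have h1 : ∀ k, spinGrad (fun y : Ambient n => y.2 j a) x k
      = if k = j then Pi.single a 1 else 0 := fun k => by
    funext b
    rw [spinGrad, fderiv_spin]
    rcases eq_or_ne k j with rfl | h
    · simp [Pi.single_apply, eq_comm]
    · simp [h, h.symm]
  have h2 : ∀ k, x.2 k ⬝ᵥ (spinGrad H x k ⨯₃ if k = j then Pi.single a 1 else 0)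
      = if k = j then x.2 j ⬝ᵥ (spinGrad H x j ⨯₃ Pi.single a 1) else 0 := fun k => by
    split_ifs with h
    · rw [h]
    · simp
  simp only [hamField, poisson, fderiv_spin, h1, h2, Finset.sum_ite_eq', Finset.mem_univ, if_true]
  simp only [dotProduct, Fin.sum_univ_three, cross_apply]
  fin_cases a <;> simp <;> ring

lemma spinGrad_spinHam (ε : Fin n → ℝ) (i j : Fin n) (x : Ambient n) (a : Fin 3) :
    spinGrad (spinHam ε i) x j a
      = (if j = i then 2 * ε i * (Pi.single 2 1 : Fin 3 → ℝ) a + oscVec x a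
          + ∑ k, x.2 k a / (ε i - ε k) else 0) + x.2 i a / (ε i - ε j) := by
  have h0 : oscVec ((0, Pi.single j (Pi.single a 1)) : Ambient n) = 0 := by
    funext b; fin_cases b <;> simp [oscVec]
  have h1 : ∀ k, x.2 i ⬝ᵥ (Pi.single j (Pi.single a 1) : Fin n → Fin 3 → ℝ) k
      = if k = j then x.2 i a else 0 := fun k => by
    rcases eq_or_ne k j with rfl | h
    · simp
    · simp [h]
  rw [spinGrad, fderiv_spinHam, h0]
  simp only [h1, add_div, ite_div, zero_div, Finset.sum_add_distrib, Finset.sum_ite_eq',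
    Finset.mem_univ, if_true, Pi.zero_apply, zero_mul, zero_add]
  rcases eq_or_ne j i with rfl | h
  · simp [Pi.single_apply, eq_comm]
  · simp [h, h.symm]

lemma spinGrad_totalHam (j : Fin n) (x : Ambient n) :
    spinGrad (totalHam (n := n)) x j = Pi.single 2 1 := by
  funext a
  have h0 : oscVec ((0, Pi.single j (Pi.single a 1)) : Ambient n) = 0 := by
    funext b; fin_cases b <;> simp [oscVec]
  have h1 : ∀ k, (Pi.single j (Pi.single a 1) : Fin n → Fin 3 → ℝ) k 2
      = if k = j then (Pi.single a 1 : Fin 3 → ℝ) 2 else 0 := fun k => by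
    rcases eq_or_ne k j with rfl | h
    · simp
    · simp [h]
  rw [spinGrad, fderiv_totalHam, h0]
  simp only [h1, Finset.sum_ite_eq', Finset.mem_univ, if_true]
  simp [Pi.single_apply, eq_comm]

/-! ### The Lax equation -/

/-- A component of the commutator in the Lax equation for `H_i`. Here `p`, `q` are two components of
the spins, `κ`, `μ` those of the external field on the spin `i`, and the factor multiplying `q j`
is a component of the gradient of `H_i` in the spin `j`. -/
lemma X_sub_mul_sum_spin (ε : Fin n → ℝ) (hε : Function.Injective ε) (i : Fin n)
    (p q : Fin n → ℝ) (κ μ : ℝ) :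
    (X - C (ε i)) * ∑ j, C (((if j = i then κ + ∑ k, p k / (ε i - ε k) else 0)
        + p i / (ε i - ε j)) * q j
      - ((if j = i then μ + ∑ k, q k / (ε i - ε k) else 0) + q i / (ε i - ε j)) * p j)
        * poleProdErase ε j
      = C (κ * q i - μ * p i) * poleProd ε
        + ∑ j, C (p j * q i - q j * p i) * poleProdErase ε j := by
  have h1 : ∀ j, (X - C (ε i)) * (C (((if j = i then κ + ∑ k, p k / (ε i - ε k) else 0)
        + p i / (ε i - ε j)) * q j
      - ((if j = i then μ + ∑ k, q k / (ε i - ε k) else 0) + q i / (ε i - ε j)) * p j)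
        * poleProdErase ε j)
      = (if j = i then C ((κ + ∑ k, p k / (ε i - ε k)) * q i
          - (μ + ∑ k, q k / (ε i - ε k)) * p i) * poleProd ε else 0)
        + C ((p i * q j - q i * p j) / (ε i - ε j)) * poleProd ε
        + C (p j * q i - q j * p i) * poleProdErase ε j := by
    intro j
    rcases eq_or_ne j i with rfl | hj
    · rw [if_pos rfl, if_pos rfl, if_pos rfl, ← X_sub_mul_poleProdErase ε j]
      simp only [sub_self, div_zero, add_zero, map_zero, zero_mul, mul_comm (q j) (p j)]
      ring
    · have hne : ε i - ε j ≠ 0 := sub_ne_zero.2 (hε.ne hj.symm)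
      have hX : X - C (ε i) = (X - C (ε j)) - C (ε i - ε j) := by rw [C_sub]; ring
      have hc : C (p j * q i - q j * p i)
          = - (C ((p i * q j - q i * p j) / (ε i - ε j)) * C (ε i - ε j)) := by
        rw [← C_mul, div_mul_cancel₀ _ hne, ← C_neg]; congr 1; ring
      have hc2 : (0 + p i / (ε i - ε j)) * q j - (0 + q i / (ε i - ε j)) * p j
          = (p i * q j - q i * p j) / (ε i - ε j) := by ring
      rw [if_neg hj, if_neg hj, if_neg hj, hc, hc2, hX, ← X_sub_mul_poleProdErase ε j]
      ring
  rw [Finset.mul_sum]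
  simp only [h1, Finset.sum_add_distrib, Finset.sum_ite_eq', Finset.mem_univ, if_true]
  rw [← Finset.sum_mul, ← add_mul, ← map_sum, ← C_add]
  congr 3
  have : ∀ j, (p i * q j - q i * p j) / (ε i - ε j)
      = (q j / (ε i - ε j)) * p i - (p j / (ε i - ε j)) * q i := fun j => by ring
  simp only [this, Finset.sum_sub_distrib, ← Finset.sum_mul]
  ring

/-- The Lax equation for the flow of `H_i`: the Lax vector precesses about `s_i / (λ - ε_i)`. -/
lemma laxDir_hamField_spinHam {ε : Fin n → ℝ} (hε : Function.Injective ε) (i : Fin n)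
    (x : Ambient n) (a : Fin 3) :
    (X - C (ε i)) * laxDir ε (hamField (spinHam ε i) x) a
      = (laxVec ε x ⨯₃ fun b => C (x.2 i b)) a := by
  have hI : fderiv ℝ (spinHam ε i) x (Complex.I, 0) = -2 * x.2 i 1 := by
    rw [fderiv_spinHam]; simp [Fin.sum_univ_three, oscVec]
  have h1 : fderiv ℝ (spinHam ε i) x (1, 0) = 2 * x.2 i 0 := by
    rw [fderiv_spinHam]; simp [Fin.sum_univ_three, oscVec]
  have key := fun b c : Fin 3 => X_sub_mul_sum_spin ε hε i (fun j => x.2 j b) (fun j => x.2 j c)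
    (2 * ε i * (Pi.single 2 1 : Fin 3 → ℝ) b + oscVec x b)
    (2 * ε i * (Pi.single 2 1 : Fin 3 → ℝ) c + oscVec x c)
  have hsub : ∀ b c : Fin 3, ∑ j, C (x.2 j b * x.2 i c - x.2 j c * x.2 i b) * poleProdErase ε j
      = (∑ j, C (x.2 j b) * poleProdErase ε j) * C (x.2 i c)
        - (∑ j, C (x.2 j c) * poleProdErase ε j) * C (x.2 i b) := fun b c => by
    rw [Finset.sum_mul, Finset.sum_mul, ← Finset.sum_sub_distrib]
    exact Finset.sum_congr rfl fun j _ => by rw [C_sub, C_mul, C_mul]; ring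
  rw [laxDir, poleComb_apply, mul_add, oscVec_hamField, hI, h1]
  simp only [hamField_spin, cross_apply, spinGrad_spinHam]
  fin_cases a
  · simp only [Fin.zero_eta, cons_val_zero]
    rw [key 1 2, hsub, laxVec_one, laxVec_two, laxDir, laxDir, poleComb_apply, poleComb_apply]
    simp [oscVec]
    ring
  · simp only [Fin.mk_one, cons_val_one, cons_val_zero]
    rw [key 2 0, hsub, laxVec_zero, laxVec_two, laxDir, laxDir, poleComb_apply, poleComb_apply]
    simp [oscVec]
    ring
  · simp only [Fin.reduceFinMk, cons_val]
    rw [key 0 1, hsub, laxVec_zero, laxVec_one, laxDir, laxDir, poleComb_apply, poleComb_apply]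
    simp [oscVec]
    ring

/-- The Lax equation for the flow of `H_{n+1}`: the Lax vector rotates about the third axis. -/
lemma laxDir_hamField_totalHam (ε : Fin n → ℝ) (x : Ambient n) (a : Fin 3) :
    laxDir ε (hamField totalHam x) a = ![-laxVec ε x 1, laxVec ε x 0, 0] a := by
  have hI : fderiv ℝ totalHam x (Complex.I, 0) = 2 * x.1.im := by
    rw [fderiv_totalHam]; simp [Fin.sum_univ_three, oscVec]
  have h1 : fderiv ℝ totalHam x (1, 0) = 2 * x.1.re := by
    rw [fderiv_totalHam]; simp [Fin.sum_univ_three, oscVec]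
  rw [laxDir, poleComb_apply, oscVec_hamField, hI, h1]
  simp only [hamField_spin, cross_apply, spinGrad_totalHam]
  fin_cases a
  · simp [laxVec_one, laxDir, poleComb_apply, oscVec, Finset.sum_neg_distrib]
    ring
  · simp [laxVec_zero, laxDir, poleComb_apply, oscVec]
  · simp

lemma hasDerivAt_laxVec {F : Type*} [NormedAddCommGroup F] [NormedSpace ℝ F] (ε : Fin n → ℝ)
    (φ : ℝ[X] →ₗ[ℝ] F) {γ : ℝ → Ambient n} {v : Ambient n} {t : ℝ} (h : HasDerivAt γ v t)
    (a : Fin 3) : HasDerivAt (fun t => φ (laxVec ε (γ t) a)) (φ (laxDir ε v a)) t := by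
  let D : Ambient n →ₗ[ℝ] ℝ[X] :=
    { toFun := fun v => laxDir ε v a
      map_add' := fun v w => laxDir_add ε v w a
      map_smul' := fun c v => by rw [laxDir_smul, ← smul_eq_C_mul]; rfl }
  have := ((φ.comp D).toContinuousLinearMap.hasFDerivAt.comp_hasDerivAt t h).const_add
    (φ ((![0, 0, C 2 * X * poleProd ε] : Fin 3 → ℝ[X]) a))
  refine this.congr_of_eventuallyEq (Filter.Eventually.of_forall fun t => ?_)
  simp [laxVec, D]

/-! ### Zeros of the Lax vector along the flows -/

lemma momentMap_castSucc (ε : Fin n → ℝ) (i : Fin n) :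
    (fun y => momentMap ε y i.castSucc) = spinHam ε i := by
  funext y; simp [momentMap]

lemma momentMap_last (ε : Fin n → ℝ) : (fun y => momentMap ε y (Fin.last n)) = totalHam := by
  funext y; simp [momentMap]

/-- Away from the poles, each flow changes the Lax vector orthogonally to itself. -/
lemma sum_eval_laxVec_mul_laxDir {ε : Fin n → ℝ} (hε : Function.Injective ε) (i : Fin (n + 1))
    (x : Ambient n) {E : ℝ} (hE : ∀ j, E ≠ ε j) :
    ∑ a, (laxVec ε x a).eval E
      * (laxDir ε (hamField (fun y => momentMap ε y i) x) a).eval E = 0 := by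
  refine Fin.lastCases ?_ (fun j => ?_) i
  · rw [momentMap_last]
    simp only [laxDir_hamField_totalHam, Fin.sum_univ_three]
    simp
    ring
  · rw [momentMap_castSucc]
    refine (mul_eq_zero.1 (?_ : (E - ε j) * _ = 0)).resolve_left (sub_ne_zero.2 (hE j))
    have h : ∀ a, (E - ε j) * (laxDir ε (hamField (spinHam ε j) x) a).eval E
        = ((laxVec ε x ⨯₃ fun b => C (x.2 j b)) a).eval E := fun a => by
      rw [← laxDir_hamField_spinHam hε]; simp
    rw [Finset.mul_sum]
    simp only [mul_left_comm (E - ε j), h, Fin.sum_univ_three, cross_apply]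
    simp
    ring

/-- The zero `E` of the Lax vector persists along the flows, since the length of the Lax vector at
`E` is conserved. -/
lemma laxVec_eval_eq_zero_of_flow {ε : Fin n → ℝ} (hε : Function.Injective ε) {E : ℝ}
    (hE : ∀ j, E ≠ ε j) {i : Fin (n + 1)} {γ : ℝ → Ambient n} {J : Set ℝ} {t₀ : ℝ}
    (hJ : IsOpen J) (hJ' : IsPreconnected J) (ht₀ : t₀ ∈ J)
    (h0 : ∀ a, (laxVec ε (γ t₀) a).eval E = 0)
    (hγ : ∀ t ∈ J, HasDerivAt γ (hamField (fun y => momentMap ε y i) (γ t)) t) {t : ℝ}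
    (ht : t ∈ J) (a : Fin 3) : (laxVec ε (γ t) a).eval E = 0 := by
  have hd : ∀ t ∈ J, HasDerivAt (fun t => ∑ a, (laxVec ε (γ t) a).eval E ^ 2) 0 t := by
    intro t ht
    have h1 : HasDerivAt (fun t => ∑ a, (laxVec ε (γ t) a).eval E ^ 2)
        (∑ a, 2 * ((laxVec ε (γ t) a).eval E
          * (laxDir ε (hamField (fun y => momentMap ε y i) (γ t)) a).eval E)) t := by
      refine HasDerivAt.fun_sum fun a _ => ?_
      have := (hasDerivAt_laxVec ε (leval E) (hγ t ht) a).pow 2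
      convert! this using 1
      simp [leval]
      ring
    rwa [← Finset.mul_sum, sum_eval_laxVec_mul_laxDir hε i (γ t) hE, mul_zero] at h1
  have hconst := hJ.is_const_of_deriv_eq_zero hJ'
    (fun t ht => (hd t ht).differentiableAt.differentiableWithinAt)
    (fun t ht => (hd t ht).deriv) ht ht₀
  simp only [h0] at hconst
  have := (Finset.sum_eq_zero_iff_of_nonneg (fun i _ => sq_nonneg _)).1
    (hconst.trans (by simp)) a (Finset.mem_univ a)
  exact pow_eq_zero_iff two_ne_zero |>.1 this

lemma IsSeparated.exists_eq {ε : Fin n → ℝ} {x : Ambient n} {l : Fin n → ℂ}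
    (hl : IsSeparated ε x l) {z : ℂ} (hz : (numC ε x).eval z = 0) : ∃ k, l k = z := by
  rw [hl.2, eval_mul, eval_C, eval_prod, mul_eq_zero] at hz
  have h1 : (2 * (starRingEnd ℂ) x.1 : ℂ) ≠ 0 := by simpa using hl.1
  obtain ⟨k, -, hk⟩ := Finset.prod_eq_zero_iff.1 (hz.resolve_left h1)
  exact ⟨k, by simpa [sub_eq_zero, eq_comm] using hk⟩

/-- A continuous choice of pairwise distinct points, one of which is always `E`, has the same index
at `E` throughout. -/
lemma exists_index_const {J : Set ℝ} {t₀ : ℝ} (hJ' : IsPreconnected J)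
    (ht₀ : t₀ ∈ J) {l : ℝ → Fin n → ℂ} (hl : ContinuousOn l J) {E : ℂ}
    (hinj : ∀ t ∈ J, Function.Injective (l t)) (hE : ∀ t ∈ J, ∃ k, l t k = E) :
    ∃ k, ∀ t ∈ J, l t k = E := by
  obtain ⟨k, hk⟩ := hE t₀ ht₀
  refine ⟨k, fun t ht => ?_⟩
  have hlk : ∀ m, ContinuousOn (fun t => l t m) J := fun m =>
    (continuous_apply m).comp_continuousOn hl
  have : Nonempty (Fin n) := ⟨k⟩
  choose! κ hκ using hE
  have hcont : ContinuousOn κ J := by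
    intro t ht
    -- the labels other than `κ t` stay away from `E` near `t`
    have h1 : ∀ᶠ t' in nhdsWithin t J, ∀ m, m ≠ κ t → l t' m ≠ E := by
      rw [Filter.eventually_all]
      intro m
      by_cases hm : m = κ t
      · simp [hm]
      · have hne : l t m ≠ E := fun h => hm (hinj t ht (h.trans (hκ t ht).symm))
        filter_upwards [(hlk m t ht).eventually_ne hne] with t' ht' _ using ht'
    have h2 : ∀ᶠ t' in nhdsWithin t J, κ t' = κ t := by
      filter_upwards [h1, self_mem_nhdsWithin] with t' h ht'
      by_contra hne
      exact h _ hne (hκ t' ht')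
    exact (continuousWithinAt_const (b := κ t)).congr_of_eventuallyEq h2 rfl
  have h3 := hJ'.constant hcont ht ht₀
  have h4 : κ t₀ = k := hinj t₀ ht₀ ((hκ t₀ ht₀).trans hk.symm)
  rw [← h4, ← h3]
  exact hκ t ht

/-! ### The flow of the separated variables -/

/-- A quotient whose numerator vanishes is differentiable as soon as its denominator is
continuous. -/
lemma hasDerivAt_div_of_eq_zero {f g : ℝ → ℂ} {f' : ℂ} {t : ℝ} (hf : HasDerivAt f f' t)
    (h0 : f t = 0) (hg : ContinuousAt g t) (hg0 : g t ≠ 0) :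
    HasDerivAt (fun u => f u / g u) (f' / g t) t := by
  rw [hasDerivAt_iff_tendsto_slope] at hf ⊢
  have h1 : Filter.Tendsto (fun u => slope f t u / g u) (nhdsWithin t {t}ᶜ) (nhds (f' / g t)) :=
    hf.div (hg.tendsto.mono_left nhdsWithin_le_nhds) hg0
  refine h1.congr fun u => ?_
  rw [slope_def_module, slope_def_module, h0, zero_div, sub_zero, sub_zero, smul_div_assoc]

lemma sPlus_mul_eval (ε : Fin n → ℝ) (i : Fin n) (x : Ambient n) :
    sPlus x i * ∏ j ∈ Finset.univ.erase i, ((ε i : ℂ) - ε j) = (numC ε x).eval (ε i : ℂ) := by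
  have h : (((poleProdErase ε i).eval (ε i) : ℝ) : ℂ) = ∏ j ∈ Finset.univ.erase i, ((ε i : ℂ) - ε j) := by
    rw [poleProdErase, eval_prod]; push_cast; simp
  have h1 : ∀ a, aeval (ε i : ℂ) (laxVec ε x a)
      = (x.2 i a : ℂ) * (((poleProdErase ε i).eval (ε i) : ℝ) : ℂ) := fun a => by
    rw [← Complex.ofReal_mul, ← eval_laxVec_pole]
    exact aeval_algebraMap_apply ℂ (ε i) _
  rw [numC_eq, eval_add, eval_mul, eval_C, eval_map_algebraMap, eval_map_algebraMap, h1, h1, ← h,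
    sPlus]
  ring

lemma sZ_mul_eval (ε : Fin n → ℝ) (i : Fin n) (x : Ambient n) :
    (sZ x i : ℂ) * ∏ j ∈ Finset.univ.erase i, ((ε i : ℂ) - ε j) = (numA ε x).eval (ε i : ℂ) := by
  have h : (((poleProdErase ε i).eval (ε i) : ℝ) : ℂ) = ∏ j ∈ Finset.univ.erase i, ((ε i : ℂ) - ε j) := by
    rw [poleProdErase, eval_prod]; push_cast; simp
  rw [numA_eq, eval_map_algebraMap, ← h, sZ, ← Complex.ofReal_mul, ← eval_laxVec_pole]
  exact (aeval_algebraMap_apply ℂ (ε i) _).symm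

/-- The derivative of the numerator of `C` in the direction `v`. -/
noncomputable def dirC (ε : Fin n → ℝ) (v : Ambient n) : ℂ[X] :=
  (laxDir ε v 0).map (algebraMap ℝ ℂ) + C Complex.I * (laxDir ε v 1).map (algebraMap ℝ ℂ)

lemma hasDerivAt_numC (ε : Fin n → ℝ) (z : ℂ) {γ : ℝ → Ambient n} {v : Ambient n} {t : ℝ}
    (h : HasDerivAt γ v t) :
    HasDerivAt (fun t => (numC ε (γ t)).eval z) ((dirC ε v).eval z) t := by
  have h0 := hasDerivAt_laxVec ε (aeval z : ℝ[X] →ₐ[ℝ] ℂ).toLinearMap h 0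
  have h1 := (hasDerivAt_laxVec ε (aeval z : ℝ[X] →ₐ[ℝ] ℂ).toLinearMap h 1).const_mul Complex.I
  simpa only [numC_eq, dirC, eval_add, eval_mul, eval_C, eval_map_algebraMap,
    AlgHom.toLinearMap_apply] using h0.fun_add h1

lemma X_sub_mul_dirC {ε : Fin n → ℝ} (hε : Function.Injective ε) (i : Fin n) (x : Ambient n) :
    (X - C (ε i : ℂ)) * dirC ε (hamField (spinHam ε i) x)
      = C Complex.I * (numA ε x * C (sPlus x i) - C (sZ x i : ℂ) * numC ε x) := by
  have hI : (C Complex.I : ℂ[X]) ^ 2 = -1 := by rw [← C_pow, Complex.I_sq]; simp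
  have h := fun a => congrArg (Polynomial.map (algebraMap ℝ ℂ)) (laxDir_hamField_spinHam hε i x a)
  have h0 := h 0
  have h1 := h 1
  simp only [cross_apply, cons_val_zero, cons_val_one, Polynomial.map_mul, Polynomial.map_sub,
    map_X, map_C, Complex.coe_algebraMap] at h0 h1
  rw [dirC, numA_eq, numC_eq, sPlus, sZ, C_add, C_mul]
  linear_combination h0 + C Complex.I * h1
    - (map (algebraMap ℝ ℂ) (laxVec ε x 2) * C (x.2 i 1 : ℂ)
      - map (algebraMap ℝ ℂ) (laxVec ε x 1) * C (x.2 i 2 : ℂ)) * hI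

/-- The variation of the numerator of `C` at a separated variable. The two sides are compared after
multiplication by `λ - ε_i`; when the separated variable sits at `ε_i`, this factor is cancelled
before evaluation. -/
lemma eval_dirC {ε : Fin n → ℝ} (hε : Function.Injective ε) (i k : Fin n) {x : Ambient n}
    {l : Fin n → ℂ} (hl : IsSeparated ε x l) :
    (∏ j ∈ Finset.univ.erase i, ((ε i : ℂ) - ε j))
        * (dirC ε (hamField (spinHam ε i) x)).eval (l k)
      = - Complex.I * (numA ε x).eval (l k) * (2 * (starRingEnd ℂ) x.1)
        * ∏ m ∈ Finset.univ.erase k, ((ε i : ℂ) - l m) := by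
  set G : ℂ[X] := ∏ m ∈ Finset.univ.erase k, (X - C (l m)) with hG
  have hGe : ∀ z, G.eval z = ∏ m ∈ Finset.univ.erase k, (z - l m) := fun z => by
    simp [hG, eval_prod]
  have hC : numC ε x = C (2 * (starRingEnd ℂ) x.1) * ((X - C (l k)) * G) := by
    rw [hl.2, hG, Finset.mul_prod_erase Finset.univ (fun m => X - C (l m)) (Finset.mem_univ k)]
  set D : ℂ := ∏ j ∈ Finset.univ.erase i, ((ε i : ℂ) - ε j) with hD
  have h1 := X_sub_mul_dirC hε i x
  have h2 : C D * ((X - C (ε i : ℂ)) * dirC ε (hamField (spinHam ε i) x))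
      = C Complex.I * (numA ε x * C ((numC ε x).eval (ε i : ℂ))
        - C ((numA ε x).eval (ε i : ℂ)) * numC ε x) := by
    rw [h1, ← sPlus_mul_eval, ← sZ_mul_eval, C_mul, C_mul]; ring
  rw [← hGe]
  by_cases h : l k = ε i
  · have hzero : (numC ε x).eval (ε i : ℂ) = 0 := by
      rw [hC, ← h]; simp
    rw [hzero, C_0, mul_zero, zero_sub, hC, h] at h2
    have h3 : C D * dirC ε (hamField (spinHam ε i) x)
        = C Complex.I * (-(C ((numA ε x).eval (ε i : ℂ)) * (C (2 * (starRingEnd ℂ) x.1) * G))) := by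
      refine mul_left_cancel₀ (X_sub_C_ne_zero (ε i : ℂ)) ?_
      linear_combination h2
    have h4 := congrArg (eval (ε i : ℂ)) h3
    simp only [eval_mul, eval_C, eval_neg] at h4
    rw [h]
    linear_combination h4
  · have h4 := congrArg (eval (l k)) h2
    rw [hC] at h4
    simp only [eval_mul, eval_C, eval_sub, eval_X] at h4
    refine mul_left_cancel₀ (sub_ne_zero.2 h) ?_
    linear_combination h4

/-- The separated variables are differentiable along the flow of `H_i`, as simple zeros of `C`. -/
lemma hasDerivAt_separated {ε : Fin n → ℝ} (hε : Function.Injective ε) (i k : Fin n)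
    {γ : ℝ → Ambient n} {l : ℝ → Fin n → ℂ} (hinj : Function.Injective (l 0))
    (hl : ContinuousAt l 0) (hγ : HasDerivAt γ (hamField (spinHam ε i) (γ 0)) 0)
    (hsep : ∀ᶠ t in nhds 0, IsSeparated ε (γ t) (l t)) :
    HasDerivAt (fun t => l t k)
      (Complex.I * (numA ε (γ 0)).eval (l 0 k)
        * (∏ m ∈ Finset.univ.erase k, ((ε i : ℂ) - l 0 m))
        / ((∏ j ∈ Finset.univ.erase i, ((ε i : ℂ) - ε j))
          * ∏ m ∈ Finset.univ.erase k, (l 0 k - l 0 m))) 0 := by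
  have hsep0 := hsep.self_of_nhds
  set g : ℝ → ℂ := fun t =>
    2 * (starRingEnd ℂ) (γ t).1 * ∏ m ∈ Finset.univ.erase k, (l 0 k - l t m) with hg
  have hfac : ∀ t, IsSeparated ε (γ t) (l t) →
      (numC ε (γ t)).eval (l 0 k) = g t * (l 0 k - l t k) := by
    intro t ht
    rw [ht.2, eval_mul, eval_C, eval_prod,
      ← Finset.mul_prod_erase Finset.univ _ (Finset.mem_univ k), hg]
    simp only [eval_sub, eval_X, eval_C]
    ring
  have hb0 : (2 * (starRingEnd ℂ) (γ 0).1 : ℂ) ≠ 0 := by simpa using hsep0.1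
  have hP0 : ∏ m ∈ Finset.univ.erase k, (l 0 k - l 0 m) ≠ 0 :=
    Finset.prod_ne_zero_iff.2 fun m hm =>
      sub_ne_zero.2 (hinj.ne (Finset.ne_of_mem_erase hm).symm)
  have hD : ∏ j ∈ Finset.univ.erase i, ((ε i : ℂ) - ε j) ≠ 0 :=
    Finset.prod_ne_zero_iff.2 fun j hj => sub_ne_zero.2 (by
      exact_mod_cast hε.ne (Finset.ne_of_mem_erase hj).symm)
  have hg0 : g 0 ≠ 0 := mul_ne_zero hb0 hP0
  have hgc : ContinuousAt g 0 := by
    have h1 : ContinuousAt (fun t => (γ t).1) 0 := continuous_fst.continuousAt.comp hγ.continuousAt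
    have h2 : ∀ m, ContinuousAt (fun t => l t m) 0 := fun m =>
      (continuous_apply m).continuousAt.comp hl
    refine (continuousAt_const.mul (Complex.continuous_conj.continuousAt.comp h1)).mul ?_
    exact tendsto_finsetProd _ fun m _ => (continuousAt_const.sub (h2 m))
  have hN := hasDerivAt_numC ε (l 0 k) hγ
  have h0 : (numC ε (γ 0)).eval (l 0 k) = 0 := by rw [hfac 0 hsep0, sub_self, mul_zero]
  have hq := (hasDerivAt_div_of_eq_zero hN h0 hgc hg0).const_sub (l 0 k)
  have heq : (fun t => l t k) =ᶠ[nhds 0] fun t => l 0 k - (numC ε (γ t)).eval (l 0 k) / g t := by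
    filter_upwards [hsep, hgc.eventually_ne hg0] with t ht hgt
    rw [hfac t ht, mul_div_cancel_left₀ _ hgt]
    ring
  convert! hq.congr_of_eventuallyEq heq using 1
  have h := eval_dirC hε i k hsep0
  have hd : (dirC ε (hamField (spinHam ε i) (γ 0))).eval (l 0 k)
      = - Complex.I * (numA ε (γ 0)).eval (l 0 k) * (2 * (starRingEnd ℂ) (γ 0).1)
        * (∏ m ∈ Finset.univ.erase k, ((ε i : ℂ) - l 0 m))
        / ∏ j ∈ Finset.univ.erase i, ((ε i : ℂ) - ε j) := by
    rw [eq_div_iff hD, ← h, mul_comm]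
  have hb1 : (starRingEnd ℂ) (γ 0).1 ≠ 0 := right_ne_zero_of_mul hb0
  rw [hd, hg]
  field_simp

/-- Sums over the poles of a polynomial of degree less than `n - 1`, divided by the derivative of
`∏ (X - ε_j)`, vanish. -/
lemma sum_eval_div_prod_eq_zero {ε : Fin n → ℝ} (hε : Function.Injective ε) {f : ℂ[X]}
    (hf : f.degree < (n - 1 : ℕ)) :
    ∑ i, f.eval (ε i : ℂ) / ∏ j ∈ Finset.univ.erase i, ((ε i : ℂ) - ε j) = 0 := by
  have hinj : Set.InjOn (fun i => (ε i : ℂ)) (Finset.univ : Finset (Fin n)) :=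
    (Complex.ofReal_injective.comp hε).injOn
  have hcard : (Finset.univ : Finset (Fin n)).card = n := by simp
  have h := Lagrange.coeff_eq_sum hinj (P := f)
    (hf.trans_le (by rw [hcard]; exact_mod_cast Nat.sub_le n 1))
  rw [← h, hcard]
  exact coeff_eq_zero_of_degree_lt hf

/-- The velocities of the separated variables when one of them sits at the double root `E`: the
factor belonging to `E` splits off from the products in `hasDerivAt_separated`. In the weighted
sum over the flows it cancels the weight `1 / (ε i - E)`, and what remains is a sum over the poles
of a polynomial of degree `n - 2`. -/
lemma separated_flow {ε : Fin n → ℝ} (hε : Function.Injective ε) {s : ℝ} (hs : 0 < s)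
    {x : Ambient n} (hx : x ∈ phaseSpace n s) {E : ℝ} {Qt : ℝ[X]}
    (hQ : spectralPoly ε s (momentMap ε x) = (X - C E) ^ 2 * Qt)
    {k₁ : Fin n} {l₀ : Fin n → ℂ} (hinj : Function.Injective l₀) (hk₁ : l₀ k₁ = E)
    {γ : Fin n → ℝ → Ambient n} {l : Fin n → ℝ → Fin n → ℂ}
    (hγ : ∀ i, γ i 0 = x ∧ l i 0 = l₀ ∧ ContinuousAt (l i) 0 ∧
      (∀ᶠ t in nhds 0, HasDerivAt (γ i) (hamField (spinHam ε i) (γ i t)) t) ∧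
      ∀ᶠ t in nhds 0, IsSeparated ε (γ i t) (l i t)) :
    (∃ w : Fin n → ℂ,
      (∀ k, k ≠ k₁ →
        w k = -(numA ε x).eval (l₀ k) / (l₀ k - E) ∧
        w k ^ 2 = Qt.aeval (l₀ k)) ∧
      ∀ i k, k ≠ k₁ →
        HasDerivAt (fun t => l i t k)
          (-Complex.I * (w k / ∏ m ∈ (Finset.univ.erase k₁).erase k, (l₀ k - l₀ m))
            * ((∏ m ∈ (Finset.univ.erase k₁).erase k, ((ε i : ℂ) - l₀ m))
              / ∏ j ∈ Finset.univ.erase i, ((ε i : ℂ) - ε j))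
            * ((ε i : ℂ) - E)) 0) ∧
    (∀ i, HasDerivAt (fun t => l i t k₁) 0 0) ∧
    ∀ k, ∑ i, ((ε i : ℂ) - E)⁻¹ * deriv (fun t => l i t k) 0 = 0 := by
  have hE := eval_spectralPoly_doubleRoot hQ
  have hEε := ne_pole_of_isRoot hε hs hE
  have hL := laxVec_eval_eq_zero hε hx hE
  have hsep : IsSeparated ε x l₀ := by
    obtain ⟨h1, h2, -, -, h5⟩ := hγ k₁
    have := h5.self_of_nhds
    rwa [h1, h2] at this
  have hder : ∀ i k, HasDerivAt (fun t => l i t k)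
      (Complex.I * (numA ε x).eval (l₀ k) * (∏ m ∈ Finset.univ.erase k, ((ε i : ℂ) - l₀ m))
        / ((∏ j ∈ Finset.univ.erase i, ((ε i : ℂ) - ε j))
          * ∏ m ∈ Finset.univ.erase k, (l₀ k - l₀ m))) 0 := by
    intro i k
    obtain ⟨h1, h2, h3, h4, h5⟩ := hγ i
    have := hasDerivAt_separated hε i k (h2 ▸ hinj) h3 h4.self_of_nhds h5
    rwa [h1, h2] at this
  have hne : ∀ k, k ≠ k₁ → l₀ k - E ≠ 0 := fun k hk =>
    sub_ne_zero.2 (hk₁ ▸ hinj.ne hk)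
  have hmain : ∀ i k, k ≠ k₁ → HasDerivAt (fun t => l i t k)
      (-Complex.I * (-(numA ε x).eval (l₀ k) / (l₀ k - E)
          / ∏ m ∈ (Finset.univ.erase k₁).erase k, (l₀ k - l₀ m))
        * ((∏ m ∈ (Finset.univ.erase k₁).erase k, ((ε i : ℂ) - l₀ m))
          / ∏ j ∈ Finset.univ.erase i, ((ε i : ℂ) - ε j))
        * ((ε i : ℂ) - E)) 0 := by
    intro i k hk
    convert! hder i k using 1
    have hmem : k₁ ∈ Finset.univ.erase k := Finset.mem_erase.2 ⟨hk.symm, Finset.mem_univ _⟩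
    rw [← Finset.mul_prod_erase (Finset.univ.erase k) (fun m => (ε i : ℂ) - l₀ m) hmem,
      ← Finset.mul_prod_erase (Finset.univ.erase k) (fun m => l₀ k - l₀ m) hmem, hk₁,
      Finset.erase_right_comm]
    have h1 : ∏ m ∈ (Finset.univ.erase k₁).erase k, (l₀ k - l₀ m) ≠ 0 :=
      Finset.prod_ne_zero_iff.2 fun m hm =>
        sub_ne_zero.2 (hinj.ne (Finset.ne_of_mem_erase hm).symm)
    have h2 : ∏ j ∈ Finset.univ.erase i, ((ε i : ℂ) - ε j) ≠ 0 :=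
      Finset.prod_ne_zero_iff.2 fun j hj => sub_ne_zero.2 (by
        exact_mod_cast hε.ne (Finset.ne_of_mem_erase hj).symm)
    have h3 := hne k hk
    field_simp
  have hzero : ∀ i, HasDerivAt (fun t => l i t k₁) 0 0 := by
    intro i
    convert! hder i k₁ using 1
    have : (numA ε x).eval (l₀ k₁) = 0 := by
      rw [hk₁, numA_eq, eval_map_algebraMap]
      exact (aeval_ofReal_eq_zero_iff _ _).2 (hL 2)
    rw [this]; simp
  refine ⟨⟨fun k => -(numA ε x).eval (l₀ k) / (l₀ k - E), fun k hk => ⟨rfl, ?_⟩,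
    hmain⟩, hzero, fun k => ?_⟩
  · have hC : (numC ε x).eval (l₀ k) = 0 := by
      rw [hsep.2, eval_mul, eval_prod, Finset.prod_eq_zero (Finset.mem_univ k) (by simp), mul_zero]
    have h1 := numA_sq_add_eq_spectralPoly hε hx (l₀ k)
    rw [hC, mul_zero, add_zero, hQ, map_mul, map_pow, map_sub, aeval_X, aeval_C,
      Complex.coe_algebraMap] at h1
    rw [div_pow, neg_sq, h1, mul_div_cancel_left₀ _ (pow_ne_zero 2 (hne k hk))]
  · rcases eq_or_ne k k₁ with rfl | hk
    · simp [(hzero _).deriv]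
    set f : ℂ[X] := ∏ m ∈ (Finset.univ.erase k₁).erase k, (X - C (l₀ m)) with hf
    have hfd : f.degree < (n - 1 : ℕ) := by
      have hcard : ((Finset.univ.erase k₁).erase k).card = n - 1 - 1 := by
        rw [Finset.card_erase_of_mem (Finset.mem_erase.2 ⟨hk, Finset.mem_univ k⟩),
          Finset.card_erase_of_mem (Finset.mem_univ k₁), Finset.card_univ, Fintype.card_fin]
      have hn : 2 ≤ n := by
        have h1 := k.2
        have h2 := k₁.2
        have h3 : (k : ℕ) ≠ k₁ := fun h => hk (Fin.ext h)
        omega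
      rw [hf, degree_prod]
      simp only [degree_X_sub_C, Finset.sum_const, hcard, nsmul_one]
      exact_mod_cast (by omega : n - 1 - 1 < n - 1)
    have hsum := sum_eval_div_prod_eq_zero hε hfd
    rw [← mul_zero (-Complex.I * (-(numA ε x).eval (l₀ k) / (l₀ k - E)
      / ∏ m ∈ (Finset.univ.erase k₁).erase k, (l₀ k - l₀ m))), ← hsum, Finset.mul_sum]
    refine Finset.sum_congr rfl fun i _ => ?_
    have h4 : (ε i : ℂ) - E ≠ 0 := sub_ne_zero.2 (by exact_mod_cast (hEε i).symm)
    have h5 : f.eval (ε i : ℂ) = ∏ m ∈ (Finset.univ.erase k₁).erase k, ((ε i : ℂ) - l₀ m) := by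
      rw [hf, eval_prod]; simp
    rw [(hmain i k hk).deriv, h5]
    field_simp

/-! ### Hausdorff dimension and tangent directions -/

section TangentCone

open Filter Topology

variable {V : Type*} [NormedAddCommGroup V] [NormedSpace ℝ V] [FiniteDimensional ℝ V]

/-- A linear map which is injective on a subspace containing all tangent directions of `Z` at `z`
controls the distance to `z` within `Z`. -/
lemma exists_norm_sub_le_of_tangentCone {F : Type*} [NormedAddCommGroup F] [NormedSpace ℝ F]
    {Z : Set V} {z : V} {T : Submodule ℝ V}
    (hT : ∀ v ∈ tangentConeAt ℝ Z z, v ∈ T) {L : V →L[ℝ] F} (hL : ∀ v ∈ T, L v = 0 → v = 0) :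
    ∃ N : ℕ, ∀ z' ∈ Z, ‖z' - z‖ < 1 / (N + 1) → ‖z' - z‖ ≤ (N + 1) * ‖L (z' - z)‖ := by
  have : ProperSpace V := FiniteDimensional.proper ℝ V
  by_contra! hcon
  -- rescaled counterexamples accumulate at a tangent direction in the kernel of `L`
  choose u huZ hu1 hu2 using hcon
  have hpos : ∀ N, 0 < ‖u N - z‖ := fun N =>
    lt_of_le_of_lt (by positivity) (hu2 N)
  set w : ℕ → V := fun N => ‖u N - z‖⁻¹ • (u N - z) with hw
  have hws : ∀ N, w N ∈ Metric.sphere (0 : V) 1 := fun N => by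
    rw [mem_sphere_zero_iff_norm, hw, norm_smul, norm_inv, norm_norm,
      inv_mul_cancel₀ (hpos N).ne']
  obtain ⟨v, hv, φ, hφ, hlim⟩ := (isCompact_sphere (0 : V) 1).tendsto_subseq hws
  have htend : Tendsto (fun N => u N - z) atTop (𝓝 0) :=
    squeeze_zero_norm (fun N => (hu1 N).le) tendsto_one_div_add_atTop_nhds_zero_nat
  have hcone : v ∈ tangentConeAt ℝ Z z :=
    mem_tangentConeAt_of_seq atTop (fun N => ‖u (φ N) - z‖⁻¹) (fun N => u (φ N) - z)
      (htend.comp hφ.tendsto_atTop) (Eventually.of_forall fun N => by simpa using huZ (φ N)) hlim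
  have hLv : L v = 0 := by
    have h1 : Tendsto (fun N => L (w (φ N))) atTop (𝓝 (L v)) :=
      (L.continuous.tendsto v).comp hlim
    have h2 : Tendsto (fun N => L (w N)) atTop (𝓝 0) := by
      refine squeeze_zero_norm (fun N => ?_) tendsto_one_div_add_atTop_nhds_zero_nat
      have h3 := hpos N
      have h4 : (0 : ℝ) < N + 1 := by positivity
      rw [hw, map_smul, norm_smul, norm_inv, norm_norm, le_div_iff₀ h4, inv_mul_eq_div,
        div_mul_eq_mul_div, div_le_one h3, mul_comm]
      exact (hu2 N).le
    exact tendsto_nhds_unique h1 (h2.comp hφ.tendsto_atTop)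
  have := hL v (hT v hcone) hLv
  rw [this] at hv
  simp at hv

/-- A set whose tangent directions at each point lie in a subspace of dimension `k` has Hausdorff
dimension at most `k`: it is a countable union of sets on which some linear map to `ℝ ^ k` has
a Lipschitz inverse. -/
theorem dimH_le_of_tangentCone {Z : Set V} {k : ℕ}
    (h : ∀ z ∈ Z, ∃ T : Submodule ℝ V, Module.finrank ℝ T = k ∧
      ∀ v ∈ tangentConeAt ℝ Z z, v ∈ T) : dimH Z ≤ k := by
  set D := TopologicalSpace.denseSeq (V →L[ℝ] (Fin k → ℝ)) with hD
  set S : ℕ × ℕ → Set V := fun p => {z ∈ Z | ∀ z' ∈ Z, ‖z' - z‖ < 1 / (p.2 + 1) →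
    ‖z' - z‖ ≤ 2 * (p.2 + 1) * ‖D p.1 (z' - z)‖} with hS
  have hcover : Z ⊆ ⋃ p, S p := by
    intro z hz
    obtain ⟨T, hTk, hT⟩ := h z hz
    let e : T ≃ₗ[ℝ] (Fin k → ℝ) := LinearEquiv.ofFinrankEq _ _ (by simpa using hTk)
    obtain ⟨L₀, hL₀⟩ := LinearMap.exists_extend (e : T →ₗ[ℝ] (Fin k → ℝ))
    set L : V →L[ℝ] (Fin k → ℝ) := L₀.toContinuousLinearMap with hLdef
    obtain ⟨N, hN⟩ := exists_norm_sub_le_of_tangentCone hT (L := L) fun v hv hv0 => by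
      have h1 : e ⟨v, hv⟩ = 0 := by
        rw [← hv0]; exact (LinearMap.congr_fun hL₀ ⟨v, hv⟩).symm
      simpa using h1
    have hpos : (0 : ℝ) < 1 / (2 * (N + 1)) := by positivity
    obtain ⟨m, hm⟩ := (TopologicalSpace.denseRange_denseSeq (V →L[ℝ] (Fin k → ℝ))).exists_dist_lt
      L hpos
    refine Set.mem_iUnion.2 ⟨(m, N), hz, fun z' hz' hlt => ?_⟩
    have h1 := hN z' hz' hlt
    have h2 : ‖L (z' - z)‖ ≤ ‖D m (z' - z)‖ + 1 / (2 * (N + 1)) * ‖z' - z‖ := by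
      have h3 : L (z' - z) = D m (z' - z) + (L - D m) (z' - z) := by simp
      rw [h3]
      refine (norm_add_le _ _).trans (add_le_add_right ?_ _)
      refine ((L - D m).le_opNorm _).trans (mul_le_mul_of_nonneg_right ?_ (norm_nonneg _))
      rw [← dist_eq_norm]; exact hm.le
    have hN0 : (0 : ℝ) < N + 1 := by positivity
    have h4 := h1.trans (mul_le_mul_of_nonneg_left h2 hN0.le)
    have h5 : ((N : ℝ) + 1) * (‖D m (z' - z)‖ + 1 / (2 * (N + 1)) * ‖z' - z‖)
        = (N + 1) * ‖D m (z' - z)‖ + ‖z' - z‖ / 2 := by field_simp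
    rw [h5] at h4
    simp only
    linarith
  refine (dimH_mono hcover).trans ?_
  rw [dimH_iUnion]
  refine iSup_le fun p => ?_
  by_contra! hlt
  obtain ⟨z, hz, hloc⟩ := exists_mem_nhdsWithin_lt_dimH_of_lt_dimH hlt
  have hpos : (0 : ℝ) < 1 / (p.2 + 1) / 2 := by positivity
  set B : Set V := S p ∩ Metric.ball z (1 / (p.2 + 1) / 2) with hB
  have hBmem : B ∈ 𝓝[S p] z := by
    exact Filter.inter_mem self_mem_nhdsWithin
      (mem_nhdsWithin_of_mem_nhds (Metric.ball_mem_nhds z hpos))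
  have hanti : AntilipschitzWith (2 * (p.2 + 1)) fun y : B => D p.1 (y : V) := by
    refine AntilipschitzWith.of_le_mul_dist fun x y => ?_
    have hx : (x : V) ∈ S p ∩ Metric.ball z (1 / (p.2 + 1) / 2) := x.2
    have hy : (y : V) ∈ S p ∩ Metric.ball z (1 / (p.2 + 1) / 2) := y.2
    have hd : ‖(x : V) - y‖ < 1 / (p.2 + 1) := by
      rw [← dist_eq_norm]
      have := dist_triangle_right (x : V) y z
      have h1 := hx.2
      have h2 := hy.2
      rw [Metric.mem_ball] at h1 h2
      linarith
    have := hy.1.2 x hx.1.1 hd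
    rw [Subtype.dist_eq, dist_eq_norm, dist_eq_norm, ← map_sub]
    exact_mod_cast this
  have h1 := hanti.le_dimH_image Set.univ
  have h2 : dimH B = dimH (Set.univ : Set B) := by
    rw [← (isometry_subtype_coe (s := B)).dimH_image, Set.image_univ, Subtype.range_coe]
  have h3 := (h1.trans (dimH_mono (Set.subset_univ _))).trans_eq (Real.dimH_univ_pi_fin k)
  exact absurd (hloc B hBmem) (not_lt.2 (h2 ▸ h3))

end TangentCone

/-! ### Polynomials with prescribed multiplicities -/

/-- If `G = gcd (Q, Q')`, a direction `v` along which the logarithmic derivative `Q' / Q` keeps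
its denominator to first order is divisible by `G`: the derivative of `v / Q` has at most double
poles, hence `v / Q` has at most simple ones. -/
lemma dvd_of_dvd_derivative_mul_sub {Q G W M v : ℝ[X]} (hQ0 : Q ≠ 0) (hQ : Q = G * W)
    (hQ' : derivative Q = G * M) (hcop : IsCoprime W M)
    (hv : G ∣ derivative v * W - v * M) : G ∣ v := by
  rcases eq_or_ne v 0 with rfl | hv0
  · exact dvd_zero G
  obtain ⟨g, v₁, G₁, hcop₁, hvg, hGg⟩ : ∃ g v₁ G₁ : ℝ[X], IsCoprime v₁ G₁ ∧ v = g * v₁ ∧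
      G = g * G₁ := by
    have hg : EuclideanDomain.gcd v G ≠ 0 := fun h0 => hv0 (EuclideanDomain.gcd_eq_zero_iff.1 h0).1
    obtain ⟨v₁, hv₁⟩ := EuclideanDomain.gcd_dvd_left v G
    obtain ⟨G₁, hG₁⟩ := EuclideanDomain.gcd_dvd_right v G
    refine ⟨EuclideanDomain.gcd v G, v₁, G₁, ?_, hv₁, hG₁⟩
    refine ⟨EuclideanDomain.gcdA v G, EuclideanDomain.gcdB v G, mul_left_cancel₀ hg ?_⟩
    have := EuclideanDomain.gcd_eq_gcd_ab v G
    linear_combination (-1 : ℝ[X]) * this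
      - EuclideanDomain.gcdA v G * hv₁ - EuclideanDomain.gcdB v G * hG₁
  suffices IsUnit G₁ by
    rw [hGg, hvg]; exact mul_dvd_mul_left g this.dvd
  -- otherwise some irreducible `p` divides `v` less often than `G`; compare multiplicities
  by_contra hunit
  have hG0 : G ≠ 0 := by rintro rfl; exact hQ0 (by rw [hQ, zero_mul])
  have hG₁0 : G₁ ≠ 0 := by rintro rfl; exact hG0 (by rw [hGg, mul_zero])
  obtain ⟨p, hp, hpG₁⟩ := WfDvdMonoid.exists_irreducible_factor hunit hG₁0
  have hpp : Prime p := hp.prime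
  have hder : ¬ p ∣ derivative p := fun h =>
    hp.not_isUnit ((hp.separable : IsCoprime p (derivative p)).isUnit_of_dvd' dvd_rfl h)
  obtain ⟨j, v₂, hv₂, hvj⟩ := WfDvdMonoid.max_power_factor hv0 hp
  obtain ⟨e, Q₁, hQ₁, hQe⟩ := WfDvdMonoid.max_power_factor hQ0 hp
  have dv : p * derivative v = p ^ j * (C (j : ℝ) * derivative p * v₂ + p * derivative v₂) := by
    rw [hvj, derivative_mul, derivative_pow]
    rcases j with _ | j
    · simp
    · simp only [Nat.add_sub_cancel, pow_succ, map_natCast]; push_cast; ring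
  have dQ : p * derivative Q = p ^ e * (C (e : ℝ) * derivative p * Q₁ + p * derivative Q₁) := by
    rw [hQe, derivative_mul, derivative_pow]
    rcases e with _ | e
    · simp
    · simp only [Nat.add_sub_cancel, pow_succ, map_natCast]; push_cast; ring
  have hjG : p ^ (j + 1) ∣ G := by
    have h1 : IsCoprime (p ^ j) v₁ := by
      refine IsCoprime.pow_left (hp.coprime_iff_not_dvd.2 fun h => hp.not_isUnit ?_)
      exact hcop₁.isUnit_of_dvd' h hpG₁
    have h2 : p ^ j ∣ g := by
      refine h1.dvd_of_dvd_mul_right (?_ : p ^ j ∣ g * v₁)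
      rw [← hvg, hvj]; exact dvd_mul_right _ _
    rw [hGg, pow_succ]
    exact mul_dvd_mul h2 hpG₁
  have hcst : ∀ (k : ℝ) (f : ℝ[X]), k ≠ 0 → ¬ p ∣ f → ∀ r : ℝ[X],
      ¬ p ∣ C k * derivative p * f + p * r := by
    intro k f hk hf r hdvd
    have h1 : p ∣ C k * derivative p * f := (dvd_add_left (dvd_mul_right p r)).1 hdvd
    rcases hpp.dvd_or_dvd h1 with h2 | h2
    · rcases hpp.dvd_or_dvd h2 with h3 | h3
      · exact hp.not_isUnit (isUnit_of_dvd_unit h3 (isUnit_C.2 (isUnit_iff_ne_zero.2 hk)))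
      · exact hder h3
    · exact hf h2
  -- the multiplicity of `p` in `G` is at least `j + 1` and smaller than `e`, that in `Q`
  have hej : j + 2 ≤ e := by
    by_contra! hlt
    have h1 : p ^ (j + 1) ∣ p ^ e * Q₁ := by
      rw [← hQe, hQ]; exact hjG.mul_right _
    have h2 : j + 1 ≤ e := by
      by_contra! h3
      have : p ^ (e + 1) ∣ p ^ e * Q₁ := (pow_dvd_pow p h3).trans h1
      rw [pow_succ, mul_dvd_mul_iff_left (pow_ne_zero e hp.ne_zero)] at this
      exact hQ₁ this
    have he : e = j + 1 := by omega
    have h3 : p ^ e * p ∣ p * derivative Q := by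
      rw [hQ', he, mul_comm (p ^ (j + 1)) p]
      exact mul_dvd_mul_left p (hjG.mul_right _)
    rw [dQ, mul_dvd_mul_iff_left (pow_ne_zero e hp.ne_zero)] at h3
    exact hcst e Q₁ (by rw [he]; positivity) hQ₁ _ h3
  have heG : p ^ (e - 1) ∣ G := by
    obtain ⟨a, b, hab⟩ := hcop
    have hG : G = a * Q + b * derivative Q := by
      rw [hQ', hQ]; linear_combination (-G) * hab
    rw [hG]
    refine dvd_add (dvd_mul_of_dvd_right ?_ a) (dvd_mul_of_dvd_right ?_ b)
    · rw [hQe]; exact (pow_dvd_pow p (Nat.sub_le e 1)).mul_right _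
    · have h1 : p * p ^ (e - 1) ∣ p * derivative Q := by
        rw [← pow_succ', (by omega : e - 1 + 1 = e), dQ]; exact dvd_mul_right _ _
      exact (mul_dvd_mul_iff_left hp.ne_zero).1 h1
  -- the order of `v' Q - v Q'` at `p` is `j + e - 1` because `j ≠ e`, but `G²`, which divides it, has
  -- order at least `2 e - 2`
  have hmain : p ^ (j + e) * p ∣ p * (derivative v * Q - v * derivative Q) := by
    have h1 : G * G ∣ derivative v * Q - v * derivative Q := by
      have h2 : derivative v * Q - v * derivative Q = G * (derivative v * W - v * M) := by
        rw [hQ', hQ]; ring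
      rw [h2]; exact mul_dvd_mul_left G hv
    have h3 : p ^ (j + e) ∣ derivative v * Q - v * derivative Q := by
      refine (pow_dvd_pow p (by omega : j + e ≤ e - 1 + (e - 1))).trans ?_
      rw [pow_add]
      exact (mul_dvd_mul heG heG).trans h1
    rw [mul_comm]
    exact mul_dvd_mul_left p h3
  have hfac : p * (derivative v * Q - v * derivative Q) = p ^ (j + e) *
      (C ((j : ℝ) - e) * derivative p * (v₂ * Q₁)
        + p * (derivative v₂ * Q₁ - v₂ * derivative Q₁)) := by
    have h1 : p * (derivative v * Q - v * derivative Q)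
        = (p * derivative v) * Q - v * (p * derivative Q) := by ring
    rw [h1, dv, dQ, hvj, hQe, C_sub, pow_add]
    ring
  rw [hfac, mul_dvd_mul_iff_left (pow_ne_zero _ hp.ne_zero)] at hmain
  refine hcst _ (v₂ * Q₁) ?_ (fun h => (hpp.dvd_or_dvd h).elim hv₂ hQ₁) _ hmain
  have : (j : ℝ) + 2 ≤ e := by exact_mod_cast hej
  intro h0
  linarith

/-! ### The dimension of the discriminant strata from above -/

section UpperBound

open Filter Topology

/-- The polynomials of degree at most `K`, parametrised by their coefficients. -/
noncomputable def polyOfCoeff (K : ℕ) : (Fin (K + 1) → ℝ) →ₗ[ℝ] ℝ[X] :=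
  (degreeLT ℝ (K + 1)).subtype ∘ₗ ((degreeLTEquiv ℝ (K + 1)).symm : (Fin (K + 1) → ℝ) →ₗ[ℝ] _)

lemma polyOfCoeff_injective (K : ℕ) : Function.Injective (polyOfCoeff K) :=
  Subtype.val_injective.comp (degreeLTEquiv ℝ (K + 1)).symm.injective

lemma degree_polyOfCoeff_lt (K : ℕ) (u : Fin (K + 1) → ℝ) :
    (polyOfCoeff K u).degree < ((K + 1 : ℕ) : WithBot ℕ) :=
  mem_degreeLT.1 ((degreeLTEquiv ℝ (K + 1)).symm u).2

lemma exists_polyOfCoeff_eq {K : ℕ} {f : ℝ[X]} (hf : f.degree < ((K + 1 : ℕ) : WithBot ℕ)) :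
    ∃ u, polyOfCoeff K u = f :=
  ⟨degreeLTEquiv ℝ (K + 1) ⟨f, mem_degreeLT.2 hf⟩, by simp [polyOfCoeff]⟩

/-- The bilinear expression `Q' W - Q M` in `Q` and the pair `(W, M)` of polynomials of degree at
most `K`. -/
noncomputable def logDerivForm (K : ℕ) :
    ℝ[X] →ₗ[ℝ] ((Fin (K + 1) → ℝ) × (Fin (K + 1) → ℝ)) →ₗ[ℝ] ℝ[X] :=
  LinearMap.mk₂ ℝ (fun Q y => derivative Q * polyOfCoeff K y.1 - Q * polyOfCoeff K y.2)
    (fun _ _ _ => by simp only [derivative_add]; ring)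
    (fun _ _ _ => by simp only [derivative_smul, smul_mul_assoc, smul_sub])
    (fun _ _ _ => by simp only [Prod.fst_add, Prod.snd_add, map_add]; ring)
    (fun _ _ _ => by simp only [Prod.smul_fst, Prod.smul_snd, map_smul, mul_smul_comm, smul_sub])

lemma logDerivForm_apply (K : ℕ) (Q : ℝ[X]) (y : (Fin (K + 1) → ℝ) × (Fin (K + 1) → ℝ)) :
    logDerivForm K Q y = derivative Q * polyOfCoeff K y.1 - Q * polyOfCoeff K y.2 := rfl

/-- A polynomial-valued bilinear map on finite-dimensional spaces which vanishes along convergent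
families vanishes in the limit. -/
lemma eq_zero_of_tendsto_bilinear {α V Y : Type*} [NormedAddCommGroup V] [NormedSpace ℝ V]
    [FiniteDimensional ℝ V] [NormedAddCommGroup Y] [NormedSpace ℝ Y] [FiniteDimensional ℝ Y]
    (f : V →ₗ[ℝ] Y →ₗ[ℝ] ℝ[X]) {l : Filter α} [l.NeBot] {v : α → V} {y : α → Y} {v₀ : V} {y₀ : Y}
    (hv : Tendsto v l (𝓝 v₀)) (hy : Tendsto y l (𝓝 y₀)) (h : ∀ᶠ t in l, f (v t) (y t) = 0) :
    f v₀ y₀ = 0 := by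
  ext i
  set g : V →L[ℝ] Y →L[ℝ] ℝ := (f.compr₂ (lcoeff ℝ i)).toContinuousBilinearMap with hg
  have hgv : ∀ v y, g v y = (f v y).coeff i := fun _ _ => rfl
  rw [← hgv, coeff_zero]
  refine tendsto_nhds_unique ((isBoundedBilinearMap_apply.continuous.tendsto (g v₀, y₀)).comp
    (((g.continuous.tendsto v₀).comp hv).prodMk_nhds hy))
    (tendsto_const_nhds.congr' ?_)
  filter_upwards [h] with t ht
  simp [hgv, ht]

/-- The values whose spectral polynomial `Q` has a greatest common divisor with `Q'` of degree
`e`. -/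
def gcdStratum (ε : Fin n → ℝ) (s : ℝ) (e : ℕ) : Set (Fin (n + 1) → ℝ) :=
  {h | ∃ G W M : ℝ[X], G.Monic ∧ G.natDegree = e ∧ spectralPoly ε s h = G * W ∧
    derivative (spectralPoly ε s h) = G * M ∧ IsCoprime W M}

lemma natDegree_add_of_gcd {ε : Fin n → ℝ} {s : ℝ} {h : Fin (n + 1) → ℝ} {G W : ℝ[X]}
    (hG : G.Monic) (hQ : spectralPoly ε s h = G * W) :
    W ≠ 0 ∧ G.natDegree + W.natDegree = 2 * n + 2 := by
  have h0 := spectralPoly_ne_zero ε s h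
  have hW : W ≠ 0 := by rintro rfl; exact h0 (by rw [hQ, mul_zero])
  refine ⟨hW, ?_⟩
  rw [← natDegree_mul hG.ne_zero hW, ← hQ, (leadingTerm_spectralPoly ε s h).1]

/-- A pair of cofactors of `gcd (Q, Q')`, normalised to have a coefficient vector of norm one. -/
lemma exists_cofactors_mem_sphere {ε : Fin n → ℝ} {s : ℝ} {e K : ℕ} (heK : e + K = 2 * n + 2)
    {h : Fin (n + 1) → ℝ} (hh : h ∈ gcdStratum ε s e) :
    ∃ y ∈ Metric.sphere (0 : (Fin (K + 1) → ℝ) × (Fin (K + 1) → ℝ)) 1,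
      logDerivForm K (spectralPoly ε s h) y = 0 := by
  obtain ⟨G, W, M, hG, hGe, hQ, hQ', -⟩ := hh
  obtain ⟨hW, hdeg⟩ := natDegree_add_of_gcd hG hQ
  have hWd : W.degree < ((K + 1 : ℕ) : WithBot ℕ) := by
    rw [degree_eq_natDegree hW]; norm_cast; omega
  have hMd : M.degree < ((K + 1 : ℕ) : WithBot ℕ) := by
    have h1 : (G * M).degree < ((2 * n + 2 : ℕ) : WithBot ℕ) := by
      rw [← hQ', ← (leadingTerm_spectralPoly ε s h).1,
        ← degree_eq_natDegree (spectralPoly_ne_zero ε s h)]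
      exact degree_derivative_lt (spectralPoly_ne_zero ε s h)
    rw [degree_mul_lt_iff hG.ne_zero] at h1
    exact h1.trans (by norm_cast; omega)
  obtain ⟨u, hu⟩ := exists_polyOfCoeff_eq hWd
  obtain ⟨w, hw⟩ := exists_polyOfCoeff_eq hMd
  have hne : ((u, w) : (Fin (K + 1) → ℝ) × (Fin (K + 1) → ℝ)) ≠ 0 := by
    intro h0
    rw [(Prod.mk_eq_zero.1 h0).1, map_zero] at hu
    exact hW hu.symm
  refine ⟨‖((u, w) : (Fin (K + 1) → ℝ) × (Fin (K + 1) → ℝ))‖⁻¹ • (u, w), ?_, ?_⟩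
  · rw [mem_sphere_zero_iff_norm, norm_smul, norm_inv, norm_norm,
      inv_mul_cancel₀ (norm_ne_zero_iff.2 hne)]
  · rw [map_smul, logDerivForm_apply, hu, hw, hQ', hQ]
    rw [show G * M * W - G * W * M = 0 by ring, smul_zero]

/-- In a limit of values `h + d` in the stratum, the cofactors of `gcd (Q, Q')` converge after
normalisation, so the logarithmic derivative keeps its denominator to first order. -/
lemma mem_dvdValues_of_mem_tangentCone {ε : Fin n → ℝ} (hε : Function.Injective ε) {s : ℝ}
    (hs : 0 < s) {h v : Fin (n + 1) → ℝ} {G W M : ℝ[X]} (hG : G.Monic)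
    (hQ : spectralPoly ε s h = G * W) (hQ' : derivative (spectralPoly ε s h) = G * M)
    (hcop : IsCoprime W M) (hv : v ∈ tangentConeAt ℝ (gcdStratum ε s G.natDegree) h) :
    v ∈ dvdValues ε G := by
  obtain ⟨hW, hdeg⟩ := natDegree_add_of_gcd hG hQ
  set K := W.natDegree with hK
  obtain ⟨α, l, hl, c, d, hd, hmem, hcd⟩ := exists_fun_of_mem_tangentConeAt hv
  -- use an ultrafilter, along which the cofactors converge by compactness
  set l' : Ultrafilter α := Ultrafilter.of l with hl'
  have hle : (l' : Filter α) ≤ l := Ultrafilter.of_le l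
  have hex : ∀ t, ∃ y ∈ Metric.sphere (0 : (Fin (K + 1) → ℝ) × (Fin (K + 1) → ℝ)) 1,
      h + d t ∈ gcdStratum ε s G.natDegree →
        logDerivForm K (spectralPoly ε s (h + d t)) y = 0 := by
    intro t
    by_cases ht : h + d t ∈ gcdStratum ε s G.natDegree
    · obtain ⟨y, hy, hy0⟩ := exists_cofactors_mem_sphere hdeg ht
      exact ⟨y, hy, fun _ => hy0⟩
    · have : Nontrivial ((Fin (K + 1) → ℝ) × (Fin (K + 1) → ℝ)) := inferInstance
      obtain ⟨y, hy⟩ := NormedSpace.sphere_nonempty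
        (x := (0 : (Fin (K + 1) → ℝ) × (Fin (K + 1) → ℝ))).2 zero_le_one
      exact ⟨y, hy, fun h => absurd h ht⟩
  choose y hyS hy using hex
  obtain ⟨y₀, hy₀S, hy₀⟩ := (isCompact_sphere (0 : (Fin (K + 1) → ℝ) × (Fin (K + 1) → ℝ))
    1).ultrafilter_le_nhds (l'.map y) (le_principal_iff.2 (by
      rw [Ultrafilter.mem_coe, Ultrafilter.mem_map]
      exact Filter.univ_mem' hyS))
  have hlim : Tendsto y l' (𝓝 y₀) := hy₀
  -- multiplication by the pole polynomial turns a variation of the value into one of `Q`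
  set N : (Fin (n + 1) → ℝ) →ₗ[ℝ] ℝ[X] := LinearMap.mulLeft ℝ (poleProd ε) ∘ₗ valuePoly ε with hN
  have hNapp : ∀ w, N w = poleProd ε * valuePoly ε w := fun _ => rfl
  have hvar : ∀ w, spectralPoly ε s (h + w) = spectralPoly ε s h + N w := fun w => by
    rw [hNapp, ← add_sub_cancel_left h w, ← spectralPoly_sub ε s]; simp
  have hev : ∀ᶠ t in (l' : Filter α),
      logDerivForm K (spectralPoly ε s h) (y t) + logDerivForm K (N (d t)) (y t) = 0 := by
    filter_upwards [hle hmem] with t ht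
    rw [← LinearMap.add_apply, ← map_add, ← hvar]
    exact hy t ht
  have hlim1 : logDerivForm K (spectralPoly ε s h) y₀ = 0 := by
    have h1 := eq_zero_of_tendsto_bilinear
      ((logDerivForm K).comp ((LinearMap.toSpanSingleton ℝ _ (spectralPoly ε s h)).coprod N))
      (v := fun t => ((1 : ℝ), d t)) (v₀ := (1, 0))
      (tendsto_const_nhds.prodMk_nhds (hd.mono_left hle)) hlim (by
        filter_upwards [hev] with t ht
        simpa using ht)
    simpa using h1
  have hlim2 : G ∣ logDerivForm K (N v) y₀ := by
    have h1 := eq_zero_of_tendsto_bilinear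
      (((logDerivForm K).comp N).compr₂ (modByMonicHom G)) (hcd.mono_left hle) hlim (by
        filter_upwards [hev] with t ht
        have h2 : logDerivForm K (N (d t)) (y t)
            = G * -(M * polyOfCoeff K (y t).1 - W * polyOfCoeff K (y t).2) := by
          rw [eq_neg_of_add_eq_zero_right ht, logDerivForm_apply, hQ', hQ]; ring
        simp only [LinearMap.compr₂_apply, LinearMap.comp_apply, map_smul, LinearMap.smul_apply]
        rw [modByMonicHom_apply, h2, (modByMonic_eq_zero_iff_dvd hG).2 (dvd_mul_right _ _),
          smul_zero])
    exact (modByMonic_eq_zero_iff_dvd hG).1 h1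
  -- the limiting cofactors are a constant multiple of `(W, M)`
  have hcross : M * polyOfCoeff K y₀.1 = W * polyOfCoeff K y₀.2 := by
    rw [logDerivForm_apply, hQ', hQ, sub_eq_zero, mul_assoc, mul_assoc] at hlim1
    exact mul_left_cancel₀ hG.ne_zero hlim1
  obtain ⟨q, hq⟩ : W ∣ polyOfCoeff K y₀.1 :=
    hcop.dvd_of_dvd_mul_left (hcross ▸ dvd_mul_right W _)
  have hq2 : polyOfCoeff K y₀.2 = M * q := by
    refine mul_left_cancel₀ hW ?_
    rw [← hcross, hq]; ring
  have hq0 : q ≠ 0 := by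
    rintro rfl
    rw [mul_zero] at hq hq2
    have : y₀ = 0 := Prod.ext (polyOfCoeff_injective K (by rw [hq]; simp))
      (polyOfCoeff_injective K (by rw [hq2]; simp))
    rw [this] at hy₀S
    simp at hy₀S
  have hqdeg : q.natDegree = 0 := by
    have h1 := degree_polyOfCoeff_lt K y₀.1
    rw [hq, degree_mul_lt_iff hW, ← hK, degree_eq_natDegree hq0] at h1
    norm_cast at h1
    omega
  have hqu : IsUnit q := by
    rw [eq_C_of_natDegree_eq_zero hqdeg] at hq0 ⊢
    exact isUnit_C.2 (isUnit_iff_ne_zero.2 (C_ne_zero.1 hq0))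
  have hdvd : G ∣ derivative (N v) * W - N v * M := by
    have h1 : logDerivForm K (N v) y₀ = (derivative (N v) * W - N v * M) * q := by
      rw [logDerivForm_apply, hq, hq2]; ring
    rw [h1] at hlim2
    exact hqu.dvd_mul_right.1 hlim2
  have hGN : G ∣ poleProd ε * valuePoly ε v :=
    dvd_of_dvd_derivative_mul_sub (spectralPoly_ne_zero ε s h) hQ hQ' hcop hdvd
  refine mem_dvdValues.2 ((isCoprime_poleProd fun j h0 => ?_).dvd_of_dvd_mul_left hGN)
  refine eval_spectralPoly_pole_ne_zero hε hs h j ?_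
  rw [hQ, eval_mul, h0, zero_mul]

lemma dimH_gcdStratum_le {ε : Fin n → ℝ} (hε : Function.Injective ε) {s : ℝ} (hs : 0 < s)
    (e : ℕ) : dimH (gcdStratum ε s e) ≤ ((n + 1 - e : ℕ) : ENNReal) := by
  refine dimH_le_of_tangentCone fun h hh => ?_
  obtain ⟨G, W, M, hG, rfl, hQ, hQ', hcop⟩ := hh
  exact ⟨dvdValues ε G, finrank_dvdValues hε hG.ne_zero,
    fun v hv => mem_dvdValues_of_mem_tangentCone hε hs hG hQ hQ' hcop hv⟩

/-- Every square factor of `Q` contributes to `gcd (Q, Q')`. -/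
lemma rankImage_subset_iUnion_gcdStratum {ε : Fin n → ℝ} (hε : Function.Injective ε) {s : ℝ}
    (hs : 0 < s) (r : ℕ) :
    rankImage ε s r ⊆ ⋃ e : ℕ, gcdStratum ε s (e + (n + 1 - r)) := by
  intro h hh
  obtain ⟨a, b, ha, hdeg, -, -, hQ⟩ := (mem_rankImage_iff hε hs r h).1 hh
  have hQ0 := spectralPoly_ne_zero ε s h
  set Q := spectralPoly ε s h with hQdef
  set G := normalize (EuclideanDomain.gcd Q (derivative Q)) with hG
  have hg0 : EuclideanDomain.gcd Q (derivative Q) ≠ 0 := fun h0 =>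
    hQ0 (EuclideanDomain.gcd_eq_zero_iff.1 h0).1
  have hGm : G.Monic := monic_normalize hg0
  obtain ⟨W, hW⟩ : G ∣ Q := normalize_dvd_iff.2 (EuclideanDomain.gcd_dvd_left _ _)
  obtain ⟨M, hM⟩ : G ∣ derivative Q := normalize_dvd_iff.2 (EuclideanDomain.gcd_dvd_right _ _)
  have hcop : IsCoprime W M := by
    obtain ⟨u, hu⟩ : G ∣ EuclideanDomain.gcd Q (derivative Q) := normalize_dvd_iff.2 dvd_rfl
    obtain ⟨u', hu'⟩ : EuclideanDomain.gcd Q (derivative Q) ∣ G := dvd_normalize_iff.2 dvd_rfl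
    refine ⟨u' * EuclideanDomain.gcdA Q (derivative Q),
      u' * EuclideanDomain.gcdB Q (derivative Q), mul_left_cancel₀ hGm.ne_zero ?_⟩
    have h1 := EuclideanDomain.gcd_eq_gcd_ab Q (derivative Q)
    linear_combination -hu' - u' * h1 - u' * EuclideanDomain.gcdA Q (derivative Q) * hW
      - u' * EuclideanDomain.gcdB Q (derivative Q) * hM
  have haG : a ∣ G := by
    refine dvd_normalize_iff.2 (EuclideanDomain.dvd_gcd ?_ ?_)
    · rw [hQ, pow_two, mul_assoc]; exact dvd_mul_right _ _
    · rw [hQ, derivative_mul, derivative_pow]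
      exact ⟨2 * derivative a * b + a * derivative b, by rw [Nat.cast_two, map_ofNat]; ring⟩
  have hle := natDegree_le_of_dvd haG hGm.ne_zero
  refine Set.mem_iUnion.2 ⟨G.natDegree - (n + 1 - r), G, W, M, hGm, by omega, hW, hM, hcop⟩

theorem dimH_rankImage_le {ε : Fin n → ℝ} (hε : Function.Injective ε) {s : ℝ} (hs : 0 < s)
    (r : ℕ) (hr : r ≤ n + 1) : dimH (rankImage ε s r) ≤ r := by
  refine (dimH_mono (rankImage_subset_iUnion_gcdStratum hε hs r)).trans ?_
  rw [dimH_iUnion]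
  refine iSup_le fun e => (dimH_gcdStratum_le hε hs _).trans ?_
  exact_mod_cast (by omega : n + 1 - (e + (n + 1 - r)) ≤ r)

lemma stratum_subset_rankImage (ε : Fin n → ℝ) (s : ℝ) (r : ℕ) :
    stratum ε s r ⊆ rankImage ε s r := by
  rintro h ⟨⟨x, ⟨hx, rfl⟩, hr⟩, -⟩
  exact ⟨x, ⟨hx, hr⟩, rfl⟩

lemma rankImage_subset_iUnion_stratum (ε : Fin n → ℝ) (s : ℝ) (r : ℕ) :
    rankImage ε s r ⊆ ⋃ k : Fin (r + 1), stratum ε s k := by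
  rintro h ⟨x, ⟨hx, hr⟩, rfl⟩
  set S : Set ℕ := momentRank ε '' {y | y ∈ phaseSpace n s ∧ momentMap ε y = momentMap ε x} with hS
  have hmem : r ∈ S := ⟨x, ⟨hx, rfl⟩, hr⟩
  refine Set.mem_iUnion.2 ⟨⟨sInf S, Nat.lt_succ_of_le (Nat.sInf_le hmem)⟩, ?_⟩
  exact ⟨Nat.sInf_mem ⟨r, hmem⟩, fun k hk => Nat.sInf_le hk⟩

/-- The values which admit a point of rank `r` but have a smaller least rank form a set of
dimension less than `r`. -/
lemma le_dimH_stratum {ε : Fin n → ℝ} (hε : Function.Injective ε) {s : ℝ} (hs : 0 < s) {r : ℕ}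
    (hr : r ≤ n + 1) (h : (r : ENNReal) ≤ dimH (rankImage ε s r)) :
    (r : ENNReal) ≤ dimH (stratum ε s r) := by
  have h1 := h.trans (dimH_mono (rankImage_subset_iUnion_stratum ε s r))
  rw [dimH_iUnion] at h1
  by_contra! hlt
  refine absurd h1 (not_le.2 ?_)
  rw [← Finset.sup_univ_eq_iSup]
  refine (Finset.sup_lt_iff (lt_of_le_of_lt bot_le hlt)).2 fun k _ => ?_
  rcases Nat.lt_succ_iff_lt_or_eq.1 k.2 with hk | hk
  · refine lt_of_le_of_lt ((dimH_mono (stratum_subset_rankImage ε s k)).trans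
      (dimH_rankImage_le hε hs k (by omega))) ?_
    exact_mod_cast hk
  · rwa [hk]

end UpperBound

/-! ### A configuration with real simple roots -/

/-- The point of phase space with vanishing oscillator amplitude and all spins pointing down. -/
def spinDown (n : ℕ) (s : ℝ) : Ambient n := (0, fun _ => ![0, 0, -s])

lemma laxVec_spinDown (ε : Fin n → ℝ) (s : ℝ) :
    laxVec ε (spinDown n s) 2
      = C 2 * X * poleProd ε - C s * ∑ j, poleProdErase ε j := by
  simp [laxVec_two, laxDir, poleComb_apply, spinDown, oscVec, Finset.mul_sum, sub_eq_add_neg]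

lemma eval_laxVec_spinDown_pole (ε : Fin n → ℝ) (s : ℝ) (j : Fin n) :
    (laxVec ε (spinDown n s) 2).eval (ε j) = -s * (poleProdErase ε j).eval (ε j) := by
  rw [eval_laxVec_pole]; simp [spinDown]

/-- With all spins pointing down, `A` maps the upper half plane to itself, so that its zeros are
real. -/
lemma im_eq_zero_of_aeval_spinDown {ε : Fin n → ℝ} (hε : Function.Injective ε) {s : ℝ}
    (hs : 0 < s) {z : ℂ} (hz : aeval z (laxVec ε (spinDown n s) 2) = 0) : z.im = 0 := by
  have hpole : ∀ j, z ≠ ε j := by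
    rintro j rfl
    rw [aeval_ofReal_eq_zero_iff, eval_laxVec_spinDown_pole] at hz
    exact mul_ne_zero (neg_ne_zero.2 hs.ne') (eval_poleProdErase_self_ne_zero hε j) hz
  have hA : laxA ε (spinDown n s) z = 0 := by
    have h0 : ∏ j, (z - ε j) ≠ 0 := Finset.prod_ne_zero_iff.2 fun j _ => sub_ne_zero.2 (hpole j)
    have h1 := laxA_mul_prod ε (spinDown n s) hpole
    rw [numA_eq, eval_map_algebraMap, hz] at h1
    exact (mul_eq_zero.1 h1).resolve_right h0
  have him := congrArg Complex.im hA
  have h1 : ∀ j, ((sZ (spinDown n s) j : ℂ) / (z - ε j)).im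
      = z.im * (s / Complex.normSq (z - ε j)) := fun j => by
    simp [sZ, spinDown, Complex.div_im]; ring
  rw [laxA, Complex.add_im, Complex.im_sum, Finset.sum_congr rfl fun j _ => h1 j,
    ← Finset.mul_sum] at him
  simp only [Complex.mul_im, Complex.re_ofNat, Complex.im_ofNat, zero_mul, add_zero,
    Complex.zero_im] at him
  have hpos : 0 < 2 + ∑ j, s / Complex.normSq (z - ε j) :=
    add_pos_of_pos_of_nonneg two_pos
      (Finset.sum_nonneg fun j _ => div_nonneg hs.le (Complex.normSq_nonneg _))
  have h2 : z.im * (2 + ∑ j, s / Complex.normSq (z - ε j)) = 0 := by linarith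
  exact (mul_eq_zero.1 h2).resolve_right hpos.ne'

lemma poleProd_mul_derivative_poleProdErase (ε : Fin n → ℝ) (j : Fin n) :
    poleProd ε * derivative (poleProdErase ε j) - derivative (poleProd ε) * poleProdErase ε j
      = -poleProdErase ε j ^ 2 := by
  rw [← X_sub_mul_poleProdErase ε j, derivative_mul, derivative_X_sub_C]
  ring

/-- The zeros of `A` are simple when all spins point down, because `A` increases between its
poles. -/
lemma eval_derivative_spinDown_ne_zero {ε : Fin n → ℝ} (hε : Function.Injective ε) {s : ℝ}
    (hs : 0 < s) {t : ℝ} (ht : (laxVec ε (spinDown n s) 2).eval t = 0) :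
    (derivative (laxVec ε (spinDown n s) 2)).eval t ≠ 0 := by
  intro hd
  have hpole : (poleProd ε).eval t ≠ 0 := by
    refine eval_poleProd_ne_zero ?_
    rintro j rfl
    rw [eval_laxVec_spinDown_pole] at ht
    exact mul_ne_zero (neg_ne_zero.2 hs.ne') (eval_poleProdErase_self_ne_zero hε j) ht
  have key : poleProd ε * derivative (laxVec ε (spinDown n s) 2)
      - derivative (poleProd ε) * laxVec ε (spinDown n s) 2
      = C 2 * poleProd ε ^ 2 + C s * ∑ j, poleProdErase ε j ^ 2 := by
    have h1 : ∑ j, poleProdErase ε j ^ 2 = -(poleProd ε * ∑ j, derivative (poleProdErase ε j)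
        - derivative (poleProd ε) * ∑ j, poleProdErase ε j) := by
      rw [Finset.mul_sum, Finset.mul_sum, ← Finset.sum_sub_distrib, ← Finset.sum_neg_distrib]
      exact Finset.sum_congr rfl fun j _ => by rw [poleProd_mul_derivative_poleProdErase, neg_neg]
    rw [h1, laxVec_spinDown]
    simp only [derivative_sub, derivative_mul, derivative_C, derivative_X, derivative_sum]
    ring
  have := congrArg (eval t) key
  simp only [eval_sub, eval_mul, eval_add, eval_pow, eval_C, eval_finsetSum, ht, hd, mul_zero,
    sub_zero] at this
  have h2 : 0 < 2 * eval t (poleProd ε) ^ 2 := by positivity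
  have h3 : 0 ≤ s * ∑ j, eval t (poleProdErase ε j) ^ 2 := by positivity
  linarith

/-- A real polynomial with real simple roots is a product over two disjoint families of distinct
roots of prescribed sizes. -/
lemma exists_eq_prod_mul_prod {f : ℝ[X]} (hreal : ∀ z : ℂ, aeval z f = 0 → z.im = 0)
    (hsimple : ∀ t, f.eval t = 0 → (derivative f).eval t ≠ 0) {m r : ℕ}
    (hdeg : f.natDegree = m + r) :
    ∃ (E' : Fin m → ℝ) (E : Fin r → ℝ), Function.Injective E' ∧ Function.Injective E ∧
      (∀ i j, E' i ≠ E j) ∧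
      f = C f.leadingCoeff * ((∏ i, (X - C (E' i))) * ∏ i, (X - C (E i))) := by
  have hsplit : f.Splits := by
    refine (IsAlgClosed.splits (f.map (algebraMap ℝ ℂ))).of_splits_map (algebraMap ℝ ℂ)
      fun z hz => ?_
    have h1 : aeval z f = 0 := by
      rw [mem_roots', IsRoot.def, eval_map_algebraMap] at hz
      exact hz.2
    exact ⟨z.re, Complex.ext (by simp) (by simp [hreal z h1])⟩
  have hsep : f.Separable := by
    refine (isCoprime_iff_aeval_ne_zero_of_isAlgClosed ℝ ℂ f (derivative f)).2 fun z => ?_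
    by_contra! h
    have h1 : z = (z.re : ℂ) := Complex.ext (by simp) (by simp [hreal z h.1])
    rw [h1, aeval_ofReal_eq_zero_iff, aeval_ofReal_eq_zero_iff] at h
    exact hsimple _ h.1 h.2
  have hnodup := nodup_roots hsep
  have hcard : f.roots.toFinset.card = m + r := by
    rw [Multiset.toFinset_card_of_nodup hnodup, ← hsplit.natDegree_eq_card_roots, hdeg]
  set e := f.roots.toFinset.equivFinOfCardEq hcard with he
  set g : Fin (m + r) → ℝ := fun i => (e.symm i : ℝ) with hg
  have hginj : Function.Injective g := Subtype.val_injective.comp e.symm.injective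
  refine ⟨fun i => g (Fin.castAdd r i), fun i => g (Fin.natAdd m i),
    hginj.comp (Fin.castAdd_injective m r), hginj.comp (Fin.natAdd_injective r m),
    fun i j h => ?_, ?_⟩
  · have := congrArg Fin.val (hginj h)
    simp at this
    omega
  · rw [← Fin.prod_univ_add (fun i => X - C (g i))]
    nth_rewrite 1 [hsplit.eq_prod_roots]
    congr 1
    have h1 : (f.roots.map fun a => X - C a).prod = ∏ a ∈ f.roots.toFinset, (X - C a) := by
      rw [Finset.prod, Multiset.toFinset_val, Multiset.dedup_eq_self.2 hnodup]
    rw [h1, ← Finset.prod_coe_sort, ← e.symm.prod_comp]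

/-! ### Solving the constraints locally -/

section Local

open Filter Topology

/-- If the differential of `Φ` at `0` is invertible, as well as its first component restricted
to the first factor, then the level set of the first component of `Φ` has points with positive
coordinates in the second factor, and the second component of `Φ` is open there. -/
lemma exists_isOpen_of_hasStrictFDerivAt {r : ℕ}
    {Φ : (Fin n → ℝ) × (Fin r → ℝ) → (Fin n → ℝ) × (Fin r → ℝ)}
    {D : ((Fin n → ℝ) × (Fin r → ℝ)) →L[ℝ] (Fin n → ℝ) × (Fin r → ℝ)}
    (hΦ : HasStrictFDerivAt Φ D 0) (hD : ∀ x, D x = 0 → x = 0)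
    (hD' : ∀ z, (D (z, 0)).1 = 0 → z = 0) :
    ∃ U : Set (Fin r → ℝ), IsOpen U ∧ U.Nonempty ∧
      ∀ w ∈ U, ∃ x, (∀ i, 0 < x.2 i) ∧ Φ x = ((Φ 0).1, w) := by
  have hequiv : ∀ L : ((Fin n → ℝ) × (Fin r → ℝ)) →L[ℝ] (Fin n → ℝ) × (Fin r → ℝ),
      (∀ x, L x = 0 → x = 0) → ∃ e : ((Fin n → ℝ) × (Fin r → ℝ)) ≃L[ℝ] (Fin n → ℝ) × (Fin r → ℝ),
        (e : ((Fin n → ℝ) × (Fin r → ℝ)) →L[ℝ] (Fin n → ℝ) × (Fin r → ℝ)) = L := by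
    intro L hL
    refine ⟨(LinearEquiv.ofInjectiveEndo (L : _ →ₗ[ℝ] _)
      ((injective_iff_map_eq_zero _).2 hL)).toContinuousLinearEquiv, ?_⟩
    ext x <;> rfl
  obtain ⟨e, he⟩ := hequiv D hD
  rw [← he] at hΦ
  set H := hΦ.toOpenPartialHomeomorph Φ with hH
  have hHcoe : (H : _ → _) = Φ := hΦ.toOpenPartialHomeomorph_coe
  have hsrc : H.source ∈ 𝓝 (0 : (Fin n → ℝ) × (Fin r → ℝ)) :=
    H.open_source.mem_nhds hΦ.mem_toOpenPartialHomeomorph_source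
  -- the constraints can be solved for the first factor
  obtain ⟨e', he'⟩ := hequiv (((ContinuousLinearMap.fst ℝ _ _).comp D).prod
    (ContinuousLinearMap.snd ℝ _ _)) (by
      rintro ⟨z, y⟩ h
      simp only [ContinuousLinearMap.prod_apply, ContinuousLinearMap.comp_apply,
        ContinuousLinearMap.coe_fst', ContinuousLinearMap.coe_snd', Prod.mk_eq_zero] at h
      obtain ⟨h1, rfl⟩ := h
      rw [hD' z h1]; rfl)
  have hΘ : HasStrictFDerivAt (fun x => ((Φ x).1, x.2))
      (e' : ((Fin n → ℝ) × (Fin r → ℝ)) →L[ℝ] (Fin n → ℝ) × (Fin r → ℝ)) 0 := by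
    rw [he', ← he]
    exact (hasStrictFDerivAt_fst.comp 0 hΦ).prodMk hasStrictFDerivAt_snd
  have hmap := hΘ.map_nhds_eq_of_equiv
  -- the invertible map `(z, y) ↦ ((Φ (z, y)).1, y)` gives a point with all `y i = t` small
  have himg : (fun x : (Fin n → ℝ) × (Fin r → ℝ) => ((Φ x).1, x.2)) '' H.source
      ∈ 𝓝 ((Φ 0).1, (0 : Fin r → ℝ)) := by
    have := image_mem_map (m := fun x : (Fin n → ℝ) × (Fin r → ℝ) => ((Φ x).1, x.2)) hsrc
    rwa [hmap] at this
  have hcurve : Tendsto (fun t : ℝ => ((Φ 0).1, fun _ : Fin r => t)) (𝓝[>] 0)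
      (𝓝 ((Φ 0).1, (0 : Fin r → ℝ))) := by
    refine Tendsto.mono_left ?_ nhdsWithin_le_nhds
    exact tendsto_const_nhds.prodMk_nhds (tendsto_pi_nhds.2 fun _ => tendsto_id)
  obtain ⟨t, ⟨x, hx, hxt⟩, ht⟩ := ((hcurve.eventually himg).and self_mem_nhdsWithin).exists
  obtain ⟨hxt1, hxt2⟩ : (Φ x).1 = (Φ 0).1 ∧ x.2 = fun _ => t := Prod.ext_iff.1 hxt
  set O : Set ((Fin n → ℝ) × (Fin r → ℝ)) := H.source ∩ {x | ∀ i, 0 < x.2 i} with hO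
  have hOopen : IsOpen O := by
    refine H.open_source.inter ?_
    simp only [Set.ofPred_forall]
    exact isOpen_iInter_of_finite fun i =>
      isOpen_lt continuous_const ((continuous_apply i).comp continuous_snd)
  have himage : IsOpen (Φ '' O) := by
    rw [← hHcoe]
    exact H.isOpen_image_of_subset_source hOopen Set.inter_subset_left
  refine ⟨(fun w => ((Φ 0).1, w)) ⁻¹' (Φ '' O), himage.preimage (by fun_prop),
    ⟨(Φ x).2, x, ⟨hx, fun i => by rw [hxt2]; exact ht⟩, ?_⟩, ?_⟩
  · rw [← hxt1]
  · rintro w ⟨x', hx', hxw⟩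
    exact ⟨x', hx'.2, hxw⟩

end Local

/-! ### Polynomials interpolating at the roots -/

/-- Solution of `p α + a π = g` with `α`, `π` of lower degree than `a`, `p`, linear in `g`,
obtained by interpolation at the roots. -/
lemma exists_linear_bezout {m r : ℕ} {E' : Fin m → ℝ} {E : Fin r → ℝ}
    (hE' : Function.Injective E') (hE : Function.Injective E) (hne : ∀ i j, E' i ≠ E j)
    {a p : ℝ[X]} (ha : a = ∏ i, (X - C (E' i))) (hp : p = C 2 * ∏ i, (X - C (E i))) :
    ∃ α π : ℝ[X] →ₗ[ℝ] ℝ[X], (∀ g, (α g).degree < m) ∧ (∀ g, (π g).degree < r) ∧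
      ∀ g : ℝ[X], g.degree < ((m + r : ℕ) : WithBot ℕ) → p * α g + a * π g = g := by
  have ha' : ∀ i, a.eval (E' i) = 0 := fun i => by
    rw [ha, eval_prod]; exact Finset.prod_eq_zero (Finset.mem_univ i) (by simp)
  have hp' : ∀ i, p.eval (E i) = 0 := fun i => by
    rw [hp, eval_mul, eval_prod, Finset.prod_eq_zero (Finset.mem_univ i) (by simp), mul_zero]
  have haE : ∀ i, a.eval (E i) ≠ 0 := fun i => by
    rw [ha, eval_prod]
    refine Finset.prod_ne_zero_iff.2 fun j _ => ?_
    simpa [sub_eq_zero] using (hne j i).symm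
  have hpE' : ∀ i, p.eval (E' i) ≠ 0 := fun i => by
    rw [hp, eval_mul, eval_prod, eval_C]
    refine mul_ne_zero two_ne_zero (Finset.prod_ne_zero_iff.2 fun j _ => ?_)
    simpa [sub_eq_zero] using hne i j
  have hdega : a.degree = m := by
    rw [ha, degree_prod]; simp
  have hdegp : p.degree = r := by
    rw [hp, degree_C_mul two_ne_zero, degree_prod]; simp
  set α : ℝ[X] →ₗ[ℝ] ℝ[X] := Lagrange.interpolate Finset.univ E' ∘ₗ
    LinearMap.pi fun i => (p.eval (E' i))⁻¹ • leval (E' i) with hα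
  set π : ℝ[X] →ₗ[ℝ] ℝ[X] := Lagrange.interpolate Finset.univ E ∘ₗ
    LinearMap.pi fun i => (a.eval (E i))⁻¹ • leval (E i) with hπ
  have hαd : ∀ g, (α g).degree < m := fun g => by
    refine (Lagrange.degree_interpolate_lt (s := Finset.univ) (v := E') _ hE'.injOn).trans_eq ?_
    simp
  have hπd : ∀ g, (π g).degree < r := fun g => by
    refine (Lagrange.degree_interpolate_lt (s := Finset.univ) (v := E) _ hE.injOn).trans_eq ?_
    simp
  have hαe : ∀ g i, (α g).eval (E' i) = (p.eval (E' i))⁻¹ * g.eval (E' i) := fun g i =>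
    Lagrange.eval_interpolate_at_node _ hE'.injOn (Finset.mem_univ i)
  have hπe : ∀ g i, (π g).eval (E i) = (a.eval (E i))⁻¹ * g.eval (E i) := fun g i =>
    Lagrange.eval_interpolate_at_node _ hE.injOn (Finset.mem_univ i)
  refine ⟨α, π, hαd, hπd, fun g hg => ?_⟩
  -- as an identity between polynomials of degree less than `m + r`, it may be checked at the roots
  have hdeg : (p * α g + a * π g - g).degree < ((m + r : ℕ) : WithBot ℕ) := by
    refine (degree_sub_le _ _).trans_lt (max_lt ((degree_add_le _ _).trans_lt (max_lt ?_ ?_)) hg)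
    · rw [degree_mul, hdegp, add_comm, Nat.cast_add]
      exact WithBot.add_lt_add_right (by simp) (hαd g)
    · rw [degree_mul, hdega, Nat.cast_add]
      exact WithBot.add_lt_add_left (by simp) (hπd g)
  have hinj : Function.Injective (Fin.append E' E) := by
    rw [Fin.append_injective_iff]
    exact ⟨hE', hE, hne⟩
  rw [← sub_eq_zero]
  refine eq_zero_of_degree_lt_of_eval_index_eq_zero Finset.univ hinj.injOn
    (by simpa using hdeg) fun i _ => ?_
  refine Fin.addCases (fun i => ?_) (fun i => ?_) i
  · rw [Fin.append_left, eval_sub, eval_add, eval_mul, eval_mul, hαe, ha',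
      mul_inv_cancel_left₀ (hpE' i)]
    ring
  · rw [Fin.append_right, eval_sub, eval_add, eval_mul, eval_mul, hπe, hp',
      mul_inv_cancel_left₀ (haE i)]
    ring

/-- A polynomial with the leading terms of a spectral polynomial and the right double poles is a
spectral polynomial. -/
lemma exists_spectralPoly_eq {ε : Fin n → ℝ} (hε : Function.Injective ε) {s : ℝ} {Q : ℝ[X]}
    (hdeg : (Q - (C 2 * X * poleProd ε) ^ 2).degree < ((2 * n + 1 : ℕ) : WithBot ℕ))
    (hpole : ∀ j, Q.eval (ε j) = s ^ 2 * (poleProdErase ε j).eval (ε j) ^ 2) :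
    ∃ h, spectralPoly ε s h = Q := by
  have hd : (Q - spectralPoly ε s 0).degree < ((2 * n + 1 : ℕ) : WithBot ℕ) := by
    rw [← sub_sub_sub_cancel_right Q _ ((C 2 * X * poleProd ε) ^ 2)]
    exact (degree_sub_le _ _).trans_lt (max_lt hdeg (degree_spectralPoly_sub_lt ε s 0))
  obtain ⟨q, hq⟩ := poleProd_dvd_of_eval hε (f := Q - spectralPoly ε s 0) fun j => by
    rw [eval_sub, hpole, eval_spectralPoly_pole, sub_self]
  rw [hq, degree_mul_lt_iff (poleProd_monic ε).ne_zero, natDegree_poleProd,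
    (by omega : 2 * n + 1 - n = n + 1)] at hd
  obtain ⟨h, hh⟩ := exists_valuePoly_eq hε hd
  refine ⟨h, sub_left_injective (b := spectralPoly ε s 0) ?_⟩
  simp only
  rw [spectralPoly_sub, sub_zero, hh, hq]

/-! ### The dimension of the rank strata from below -/

lemma exists_mem_rankImage_of_eval {ε : Fin n → ℝ} (hε : Function.Injective ε) {s : ℝ}
    (hs : 0 < s) {m r : ℕ} (hmr : m + r = n + 1) {a p σ : ℝ[X]} (ha : a.Monic)
    (ham : a.natDegree = m) (hap : (a * p - C 2 * X * poleProd ε).degree < (n : WithBot ℕ))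
    (hσ : σ.degree < ((2 * r - 1 : ℕ) : WithBot ℕ)) (hpos : ∀ t, 0 < (p ^ 2 + σ).eval t)
    (hpole : ∀ j, (a ^ 2 * (p ^ 2 + σ)).eval (ε j)
      = s ^ 2 * (poleProdErase ε j).eval (ε j) ^ 2) :
    ∃ h ∈ rankImage ε s r, spectralPoly ε s h = a ^ 2 * (p ^ 2 + σ) := by
  -- `Q - (2 X P)² = (a p - 2 X P) (a p + 2 X P) + a² σ` has degree at most `2 n`
  have hdeg : (a ^ 2 * (p ^ 2 + σ) - (C 2 * X * poleProd ε) ^ 2).degree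
      < ((2 * n + 1 : ℕ) : WithBot ℕ) := by
    set f := a * p - C 2 * X * poleProd ε with hf
    set g := C 4 * X * poleProd ε + f with hg
    have h1 : a ^ 2 * (p ^ 2 + σ) - (C 2 * X * poleProd ε) ^ 2 = g * f + a ^ 2 * σ := by
      have h4 : (C 4 : ℝ[X]) = 2 * C 2 := by
        rw [← map_ofNat C 2, ← C_mul]; norm_num
      rw [hg, h4, hf]; ring
    have h4 : (C 4 * X * poleProd ε).degree = ((n + 1 : ℕ) : WithBot ℕ) := by
      rw [mul_assoc, degree_C_mul four_ne_zero, degree_mul, degree_X, degree_poleProd, add_comm]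
      rfl
    have hgd : g.degree = ((n + 1 : ℕ) : WithBot ℕ) := by
      rw [hg, degree_add_eq_left_of_degree_lt, h4]
      rw [h4]
      exact hap.trans (by norm_cast; omega)
    have hg0 : g ≠ 0 := by
      rintro h0
      rw [h0, degree_zero] at hgd
      exact WithBot.natCast_ne_bot _ hgd.symm
    rw [h1]
    refine (degree_add_le _ _).trans_lt (max_lt ?_ ?_)
    · rw [degree_mul_lt_iff hg0, natDegree_eq_of_degree_eq_some hgd]
      exact hap.trans_le (by norm_cast; omega)
    · rw [degree_mul_lt_iff (pow_ne_zero 2 ha.ne_zero), ha.natDegree_pow, ham]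
      exact hσ.trans_le (by norm_cast; omega)
  obtain ⟨h, hh⟩ := exists_spectralPoly_eq hε hdeg hpole
  refine ⟨h, (mem_rankImage_iff hε hs r h).2 ⟨a, p ^ 2 + σ, ha, by omega, ?_,
    fun t => (hpos t).ne', hh⟩, hh⟩
  have h1 := (leadingTerm_spectralPoly ε s h).1
  have h2 : p ^ 2 + σ ≠ 0 := by
    intro h0
    have := hpos 0
    rw [h0, eval_zero] at this
    exact lt_irrefl _ this
  rw [hh, natDegree_mul (pow_ne_zero 2 ha.ne_zero) h2, ha.natDegree_pow, ham] at h1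
  omega

lemma hasStrictFDerivAt_sq_mul {V : Type*} [NormedAddCommGroup V] [NormedSpace ℝ V]
    (a p : ℝ) (α π σ : V →L[ℝ] ℝ) :
    HasStrictFDerivAt (fun x => (a + α x) ^ 2 * ((p + π x) ^ 2 + σ x))
      ((2 * (a * p)) • (p • α + a • π) + a ^ 2 • σ) 0 := by
  have h := ((α.hasStrictFDerivAt (x := 0)).const_add a |>.pow 2).fun_mul
    (((π.hasStrictFDerivAt (x := 0)).const_add p |>.pow 2).fun_add (σ.hasStrictFDerivAt (x := 0)))
  convert! h using 1
  ext v
  simp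
  ring

/-- The weighted sums of squares of the Lagrange basis polynomials with positive weights are
positive. -/
lemma eval_sum_smul_basis_sq_pos {r : ℕ} (hr : 0 < r) {E : Fin r → ℝ}
    (hE : Function.Injective E) {y : Fin r → ℝ} (hy : ∀ i, 0 < y i) (t : ℝ) :
    0 < (∑ i, y i • Lagrange.basis Finset.univ E i ^ 2).eval t := by
  have : Nonempty (Fin r) := ⟨⟨0, hr⟩⟩
  have hsum := congrArg (eval t) (Lagrange.sum_basis (s := Finset.univ) hE.injOn
    Finset.univ_nonempty)
  rw [eval_finsetSum, eval_one] at hsum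
  simp only [eval_finsetSum, eval_smul, eval_pow, smul_eq_mul]
  obtain ⟨i, -, hi⟩ := Finset.exists_ne_zero_of_sum_ne_zero (hsum.trans_ne one_ne_zero)
  refine Finset.sum_pos' (fun i _ => mul_nonneg (hy i).le (sq_nonneg _))
    ⟨i, Finset.mem_univ i, mul_pos (hy i) (by positivity)⟩

/-- The values of `Q_h` at `r` suitable points, as `h` runs through the rank image, fill an open
set: near `A² = a² p²` with `A` having real simple roots, the coefficients of `a` and `p` serve
to satisfy the constraints at the poles, while the values of `σ` in `a² (p² + σ)` at the
roots of `p` are free. -/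
lemma exists_isOpen_subset_image_rankImage {ε : Fin n → ℝ} (hε : Function.Injective ε) {s : ℝ}
    (hs : 0 < s) {r : ℕ} (hr₀ : 0 < r) (hr : r ≤ n + 1) :
    ∃ (E : Fin r → ℝ) (U : Set (Fin r → ℝ)), IsOpen U ∧ U.Nonempty ∧
      U ⊆ (fun h (i : Fin r) => (spectralPoly ε s h).eval (E i)) '' rankImage ε s r := by
  obtain ⟨m, hmr⟩ : ∃ m, m + r = n + 1 := ⟨n + 1 - r, by omega⟩
  set A := laxVec ε (spinDown n s) 2 with hA
  obtain ⟨hAdeg, hAlead⟩ := laxVec_two_ne_zero ε (spinDown n s)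
  obtain ⟨E', E, hE', hE, hne, hprod⟩ := exists_eq_prod_mul_prod
    (fun z hz => im_eq_zero_of_aeval_spinDown hε hs hz)
    (fun t ht => eval_derivative_spinDown_ne_zero hε hs ht) (hAdeg.trans hmr.symm)
  set a₀ : ℝ[X] := ∏ i, (X - C (E' i)) with ha₀
  set p₀ : ℝ[X] := C 2 * ∏ i, (X - C (E i)) with hp₀
  have hA₀ : A = a₀ * p₀ := by rw [hp₀, hA, hprod, hAlead]; ring
  obtain ⟨α, π, hα, hπ, hαπ⟩ := exists_linear_bezout hE' hE hne ha₀ hp₀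
  have ha₀m : a₀.Monic := monic_prod_of_monic _ _ fun i _ => monic_X_sub_C _
  have ha₀d : a₀.degree = m := by rw [ha₀, degree_prod]; simp
  have ha₀E : ∀ i, a₀.eval (E i) ≠ 0 := fun i => by
    rw [ha₀, eval_prod]
    refine Finset.prod_ne_zero_iff.2 fun j _ => ?_
    simpa [sub_eq_zero] using (hne j i).symm
  have hAE : ∀ i, A.eval (E i) = 0 := fun i => by
    have h0 : (∏ k, (X - C (E k))).eval (E i) = 0 := by
      rw [eval_prod]; exact Finset.prod_eq_zero (Finset.mem_univ i) (by simp)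
    rw [hA₀, hp₀, eval_mul, eval_mul, h0, mul_zero, mul_zero]
  have hAε : ∀ j, A.eval (ε j) = -s * (poleProdErase ε j).eval (ε j) :=
    eval_laxVec_spinDown_pole ε s
  -- `z` parametrises the variations of `a p` by their values at the poles
  set G : (Fin n → ℝ) →ₗ[ℝ] ℝ[X] := poleComb ε ∘ₗ LinearMap.inr ℝ ℝ (Fin n → ℝ) with hG
  have hGd : ∀ z, (G z).degree < n := fun z => by
    rw [hG, LinearMap.comp_apply, LinearMap.inr_apply, poleComb_apply, C_0, zero_mul, zero_add]
    exact degree_sum_poleProdErase_lt ε z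
  have hGbez : ∀ z, p₀ * α (G z) + a₀ * π (G z) = G z := fun z =>
    hαπ _ ((hGd z).trans (by norm_cast; omega))
  -- with squares of basis polynomials, positive values at the nodes make `σ` positive everywhere
  set σ : (Fin r → ℝ) →ₗ[ℝ] ℝ[X] :=
    Fintype.linearCombination ℝ fun i => Lagrange.basis Finset.univ E i ^ 2 with hσ
  have hσapp : ∀ y, σ y = ∑ i, y i • Lagrange.basis Finset.univ E i ^ 2 := fun _ => rfl
  have hσE : ∀ y i, (σ y).eval (E i) = y i := fun y i => by
    rw [hσapp, eval_finsetSum, Finset.sum_eq_single i]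
    · rw [eval_smul, eval_pow, Lagrange.eval_basis_self hE.injOn (Finset.mem_univ i)]; simp
    · intro k _ hk
      rw [eval_smul, eval_pow, Lagrange.eval_basis_of_ne hk (Finset.mem_univ i)]; simp
    · simp
  have hσd : ∀ y, (σ y).degree < ((2 * r - 1 : ℕ) : WithBot ℕ) := fun y => by
    rw [hσapp]
    refine (degree_sum_le _ _).trans_lt ((Finset.sup_lt_iff (WithBot.bot_lt_coe _)).2 fun i _ => ?_)
    refine (degree_smul_le _ _).trans_lt ?_
    rw [degree_pow, Lagrange.degree_basis hE.injOn (Finset.mem_univ i), Finset.card_univ,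
      Fintype.card_fin]
    simp only [nsmul_eq_mul]
    norm_cast
    omega
  -- the family `Q = a² (p² + σ)` and its values
  set Q : (Fin n → ℝ) × (Fin r → ℝ) → ℝ[X] := fun x =>
    (a₀ + α (G x.1)) ^ 2 * ((p₀ + π (G x.1)) ^ 2 + σ x.2) with hQ
  set lin : ℝ → (ℝ[X] →ₗ[ℝ] ℝ[X]) → ((Fin n → ℝ) × (Fin r → ℝ)) →L[ℝ] ℝ := fun t f =>
    LinearMap.toContinuousLinearMap (leval t ∘ₗ f ∘ₗ G ∘ₗ LinearMap.fst ℝ _ _) with hlin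
  set D : ℝ → ((Fin n → ℝ) × (Fin r → ℝ)) →L[ℝ] ℝ := fun t =>
    (2 * (a₀.eval t * p₀.eval t)) • (p₀.eval t • lin t α + a₀.eval t • lin t π)
      + a₀.eval t ^ 2 • LinearMap.toContinuousLinearMap (leval t ∘ₗ σ ∘ₗ LinearMap.snd ℝ _ _)
    with hD
  have hQD : ∀ t, HasStrictFDerivAt (fun x => (Q x).eval t) (D t) 0 := fun t => by
    convert! hasStrictFDerivAt_sq_mul (a₀.eval t) (p₀.eval t) (lin t α) (lin t π)
      (LinearMap.toContinuousLinearMap (leval t ∘ₗ σ ∘ₗ LinearMap.snd ℝ _ _)) using 2 with x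
    simp only [hQ, eval_mul, eval_pow, eval_add]
    rfl
  have hDapp : ∀ t x, D t x = 2 * A.eval t * (G x.1).eval t + a₀.eval t ^ 2 * (σ x.2).eval t := by
    intro t x
    rw [← hGbez x.1, hA₀]
    simp only [eval_mul, eval_add]
    change 2 * (a₀.eval t * p₀.eval t) * (p₀.eval t * (α (G x.1)).eval t
      + a₀.eval t * (π (G x.1)).eval t) + a₀.eval t ^ 2 * (σ x.2).eval t = _
    ring
  have hGε : ∀ z, (∀ j, A.eval (ε j) * (G z).eval (ε j) = 0) → z = 0 := by
    intro z hz
    have hne : ∀ j, (poleProdErase ε j).eval (ε j) ≠ 0 := eval_poleProdErase_self_ne_zero hε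
    ext j
    have h1 : (G z).eval (ε j) = z j * (poleProdErase ε j).eval (ε j) := eval_poleComb ε 0 z j
    have h2 := hz j
    rw [h1, hAε] at h2
    have h3 : -s * (poleProdErase ε j).eval (ε j) ≠ 0 := mul_ne_zero (neg_ne_zero.2 hs.ne') (hne j)
    simpa [hs.ne', hne j] using h2
  have hDz : ∀ z, (∀ j, D (ε j) (z, 0) = 0) → z = 0 := fun z hz => hGε z fun j => by
    have h1 := hz j
    rw [hDapp] at h1
    simp only [map_zero, eval_zero, mul_zero, add_zero, mul_assoc] at h1
    exact (mul_eq_zero.1 h1).resolve_left two_ne_zero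
  obtain ⟨U, hU, hUne, hsol⟩ := exists_isOpen_of_hasStrictFDerivAt
    (Φ := fun x => (fun j => (Q x).eval (ε j), fun i => (Q x).eval (E i)))
    (D := (ContinuousLinearMap.pi fun j => D (ε j)).prod (ContinuousLinearMap.pi fun i => D (E i)))
    ((hasStrictFDerivAt_pi.2 fun j => hQD (ε j)).prodMk
      (hasStrictFDerivAt_pi.2 fun i => hQD (E i)))
    (by
      rintro ⟨z, y⟩ h
      obtain ⟨h1, h2⟩ := Prod.mk_eq_zero.1 h
      have hy : y = 0 := by
        ext i
        have h3 : D (E i) (z, y) = 0 := congrFun h2 i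
        rw [hDapp, hAE, hσE, mul_zero, zero_mul, zero_add] at h3
        exact (mul_eq_zero.1 h3).resolve_left (pow_ne_zero 2 (ha₀E i))
      subst hy
      rw [hDz z fun j => congrFun h1 j]
      rfl)
    (fun z h => hDz z fun j => congrFun h j)
  refine ⟨E, U, hU, hUne, fun w hw => ?_⟩
  obtain ⟨x, hxpos, hx⟩ := hsol w hw
  obtain ⟨hx1, hx2⟩ := Prod.mk.inj hx
  have hαd : (α (G x.1)).degree < a₀.degree := by rw [ha₀d]; exact hα _
  have hsq : (α (G x.1) * π (G x.1)).degree < n := by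
    rcases eq_or_ne (α (G x.1)) 0 with h0 | h0
    · rw [h0, zero_mul, degree_zero]; exact WithBot.bot_lt_coe n
    · rw [degree_mul_lt_iff h0]
      have h1 := hα (G x.1)
      rw [degree_eq_natDegree h0] at h1
      norm_cast at h1
      exact (hπ _).trans_le (by norm_cast; omega)
  obtain ⟨h, hh, hQh⟩ := exists_mem_rankImage_of_eval hε hs hmr
    (a := a₀ + α (G x.1)) (p := p₀ + π (G x.1)) (σ := σ x.2) (ha₀m.add_of_left hαd)
    (natDegree_eq_of_degree_eq_some ((degree_add_eq_left_of_degree_lt hαd).trans ha₀d))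
    (by
      have h1 : (a₀ + α (G x.1)) * (p₀ + π (G x.1)) - C 2 * X * poleProd ε
          = laxDir ε (spinDown n s) 2 + G x.1 + α (G x.1) * π (G x.1) := by
        have h2 := laxVec_two ε (spinDown n s)
        rw [← hA, hA₀] at h2
        linear_combination h2 + hGbez x.1
      rw [h1]
      refine (degree_add_le _ _).trans_lt (max_lt ((degree_add_le _ _).trans_lt (max_lt ?_ ?_)) hsq)
      · exact degree_laxDir_two_lt ε _
      · exact hGd _)
    (hσd _)
    (fun t => by
      rw [eval_add, eval_pow]
      exact add_pos_of_nonneg_of_pos (sq_nonneg _) (eval_sum_smul_basis_sq_pos hr₀ hE hxpos t))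
    (fun j => by
      refine (congrFun hx1 j).trans ?_
      simp only [hQ, Prod.fst_zero, Prod.snd_zero, map_zero, add_zero]
      rw [← mul_pow, ← hA₀, eval_pow, hAε]
      ring)
  refine ⟨h, hh, ?_⟩
  simp only [hQh]
  exact hx2

theorem le_dimH_rankImage {ε : Fin n → ℝ} (hε : Function.Injective ε) {s : ℝ} (hs : 0 < s)
    {r : ℕ} (hr : r ≤ n + 1) : (r : ENNReal) ≤ dimH (rankImage ε s r) := by
  rcases Nat.eq_zero_or_pos r with rfl | hr₀
  · simp
  obtain ⟨E, U, hU, hUne, hsub⟩ := exists_isOpen_subset_image_rankImage hε hs hr₀ hr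
  set f : (Fin (n + 1) → ℝ) → Fin r → ℝ := fun h i => (spectralPoly ε s h).eval (E i) with hf
  set T : (Fin (n + 1) → ℝ) →L[ℝ] (Fin r → ℝ) := LinearMap.toContinuousLinearMap
    (LinearMap.pi fun i => leval (E i) ∘ₗ LinearMap.mulLeft ℝ (poleProd ε) ∘ₗ valuePoly ε) with hT
  have hsubT : ∀ h k, f h - f k = T h - T k := fun h k => by
    ext i
    rw [← map_sub, Pi.sub_apply, hf]
    simp only
    rw [← eval_sub, spectralPoly_sub]
    rfl
  have hlip : LipschitzWith ‖T‖₊ f := LipschitzWith.of_dist_le_mul fun h k => by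
    rw [dist_eq_norm, hsubT, ← dist_eq_norm]
    exact T.lipschitz.dist_le_mul h k
  have hdim : dimH U = r := by
    rw [Real.dimH_of_nonempty_interior (by rwa [hU.interior_eq])]
    simp
  rw [← hdim]
  exact (dimH_mono hsub).trans (hlip.dimH_image_le _)

end JCG

theorem mainTheorem5 (n : ℕ) (ε : Fin n → ℝ) (hε : Function.Injective ε) (s : ℝ) (hs : 0 < s) :
    -- the spectral polynomial is that of the Lax matrix
    (∀ x ∈ JCG.phaseSpace n s, ∀ z : ℂ, (∀ j, z ≠ ε j) →
      (1 / 2) * (JCG.lax ε x z ^ 2).trace =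
        (JCG.spectralPoly ε s (JCG.momentMap ε x)).aeval z / ∏ j, (z - ε j) ^ 2) ∧
    -- a double real root `E`
    (∀ x ∈ JCG.phaseSpace n s, ∀ (E : ℝ) (Qt : ℝ[X]),
      JCG.spectralPoly ε s (JCG.momentMap ε x) = (X - C E) ^ 2 * Qt →
      -- `A`, `B`, `C` vanish at `E`
      ((∀ j, E ≠ ε j) ∧ JCG.laxA ε x E = 0 ∧ JCG.laxB ε x E = 0 ∧ JCG.laxC ε x E = 0) ∧
      -- this persists along all flows, and one separated variable is frozen at `E`
      (∀ (i : Fin (n + 1)) (γ : ℝ → JCG.Ambient n) (J : Set ℝ) (t₀ : ℝ),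
        IsOpen J → IsPreconnected J → t₀ ∈ J → γ t₀ = x →
        (∀ t ∈ J, HasDerivAt γ (JCG.hamField (fun y => JCG.momentMap ε y i) (γ t)) t) →
        (∀ t ∈ J, JCG.laxA ε (γ t) E = 0 ∧ JCG.laxB ε (γ t) E = 0 ∧ JCG.laxC ε (γ t) E = 0 ∧
          ∀ l : Fin n → ℂ, JCG.IsSeparated ε (γ t) l → ∃ k, l k = E) ∧
        (∀ l : ℝ → Fin n → ℂ, ContinuousOn l J →
          (∀ t ∈ J, JCG.IsSeparated ε (γ t) (l t) ∧ Function.Injective (l t)) →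
          ∃ k, ∀ t ∈ J, l t k = E)) ∧
      -- the flows of the remaining separated variables, and the relation between them
      (∀ (k₁ : Fin n) (l₀ : Fin n → ℂ), Function.Injective l₀ → l₀ k₁ = E →
        ∀ (γ : Fin n → ℝ → JCG.Ambient n) (l : Fin n → ℝ → Fin n → ℂ),
        (∀ i, γ i 0 = x ∧ l i 0 = l₀ ∧ ContinuousAt (l i) 0 ∧
          (∀ᶠ t in nhds 0,
            HasDerivAt (γ i) (JCG.hamField (JCG.spinHam ε i) (γ i t)) t) ∧
          ∀ᶠ t in nhds 0, JCG.IsSeparated ε (γ i t) (l i t)) →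
        (∃ w : Fin n → ℂ,
          (∀ k, k ≠ k₁ →
            w k = -(JCG.numA ε x).eval (l₀ k) / (l₀ k - E) ∧
            w k ^ 2 = Qt.aeval (l₀ k)) ∧
          ∀ i k, k ≠ k₁ →
            HasDerivAt (fun t => l i t k)
              (-Complex.I * (w k / ∏ m ∈ (Finset.univ.erase k₁).erase k, (l₀ k - l₀ m))
                * ((∏ m ∈ (Finset.univ.erase k₁).erase k, ((ε i : ℂ) - l₀ m))
                  / ∏ j ∈ Finset.univ.erase i, ((ε i : ℂ) - ε j))
                * ((ε i : ℂ) - E)) 0) ∧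
        (∀ i, HasDerivAt (fun t => l i t k₁) 0 0) ∧
        ∀ k, ∑ i, ((ε i : ℂ) - E)⁻¹ * deriv (fun t => l i t k) 0 = 0) ∧
      -- the rank of the moment map
      JCG.momentRank ε x ≤ n ∧
      (Squarefree Qt → JCG.momentRank ε x = n) ∧
      (JCG.momentRank ε x = n ↔
        Qt.eval E ≠ 0 ∧ ∀ z : ℂ, (∀ j, z ≠ ε j) →
          JCG.laxA ε x z = 0 → JCG.laxB ε x z = 0 → JCG.laxC ε x z = 0 → z = E)) ∧
    -- strata of the moment map and degenerations of the spectral curve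
    (∀ (r : ℕ) (h : Fin (n + 1) → ℝ),
      h ∈ JCG.stratum ε s r ↔
        h ∈ JCG.momentMap ε '' JCG.phaseSpace n s ∧
          ∃ a b : ℝ[X], a.Monic ∧ a.natDegree + r = n + 1 ∧ b.natDegree = 2 * r ∧
            Squarefree b ∧ JCG.spectralPoly ε s h = a ^ 2 * b) ∧
    (∀ x ∈ JCG.phaseSpace n s, ∀ (r : ℕ) (a b : ℝ[X]), a.Monic → a.natDegree + r = n + 1 →
      b.natDegree = 2 * r → Squarefree b →
      JCG.spectralPoly ε s (JCG.momentMap ε x) = a ^ 2 * b →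
      (JCG.momentRank ε x = r ↔
        a.map (algebraMap ℝ ℂ) ∣ JCG.numA ε x ∧ a.map (algebraMap ℝ ℂ) ∣ JCG.numB ε x ∧
          a.map (algebraMap ℝ ℂ) ∣ JCG.numC ε x)) ∧
    (∀ (r : ℕ) (h : Fin (n + 1) → ℝ),
      h ∈ JCG.rankImage ε s r ↔
        ∃ a b : ℝ[X], a.Monic ∧ a.natDegree + r = n + 1 ∧ b.natDegree = 2 * r ∧
          (∀ t : ℝ, b.eval t ≠ 0) ∧ JCG.spectralPoly ε s h = a ^ 2 * b) ∧
    -- dimension of the strata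
    (∀ r : ℕ, r ≤ n + 1 →
      dimH (JCG.stratum ε s r) = (r : ENNReal) ∧ dimH (JCG.rankImage ε s r) = (r : ENNReal)) := by
  refine ⟨fun x hx z hz => JCG.half_trace_lax_sq hε hx hz, fun x hx E Qt hQ => ?_,
    JCG.mem_stratum_iff hε hs, fun x hx r a b ha hdeg _ hb hQ =>
      (JCG.momentRank_eq_iff hε hs hx ha hdeg hb hQ).trans (JCG.map_dvd_num_iff ε x a).symm,
    JCG.mem_rankImage_iff hε hs, fun r hr => ?_⟩
  · have hE := JCG.eval_spectralPoly_doubleRoot hQ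
    have hEε := JCG.ne_pole_of_isRoot hε hs hE
    have hL := JCG.laxVec_eval_eq_zero hε hx hE
    refine ⟨⟨hEε, (JCG.lax_ofReal_eq_zero_iff ε x hEε).2 hL⟩, ?_,
      fun k₁ l₀ hinj hk₁ γ l hγ => JCG.separated_flow hε hs hx hQ hinj hk₁ hγ,
      JCG.momentRank_le_of_doubleRoot hε hs hx hQ,
      JCG.momentRank_eq_of_squarefree hε hs hx hQ,
      JCG.momentRank_eq_iff_of_doubleRoot hε hs hx hQ⟩
    intro i γ J t₀ hJ hJ' ht₀ hγ₀ hγ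
    have hLt : ∀ t ∈ J, ∀ a, (JCG.laxVec ε (γ t) a).eval E = 0 := fun t ht a =>
      JCG.laxVec_eval_eq_zero_of_flow hε hEε hJ hJ' ht₀ (hγ₀ ▸ hL) hγ ht a
    have hC : ∀ t ∈ J, (JCG.numC ε (γ t)).eval (E : ℂ) = 0 := fun t ht =>
      ((JCG.num_eval_eq_zero_iff ε (γ t) E).2 fun a =>
        (JCG.aeval_ofReal_eq_zero_iff _ _).2 (hLt t ht a)).2.2
    refine ⟨fun t ht => ?_, fun l hl hsep => ?_⟩
    · obtain ⟨hA, hB, hC'⟩ := (JCG.lax_ofReal_eq_zero_iff ε (γ t) hEε).2 (hLt t ht)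
      exact ⟨hA, hB, hC', fun l hl => hl.exists_eq (hC t ht)⟩
    · exact JCG.exists_index_const hJ' ht₀ hl (fun t ht => (hsep t ht).2)
        fun t ht => (hsep t ht).1.exists_eq (hC t ht)
  · have hle := JCG.dimH_rankImage_le hε hs r hr
    have hge := JCG.le_dimH_rankImage hε hs hr
    exact ⟨((dimH_mono (JCG.stratum_subset_rankImage ε s r)).trans hle).antisymm
      (JCG.le_dimH_stratum hε hs hr hge), hle.antisymm hge⟩
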